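/- **Setting.** PPT means probabilistic (uniform) with running time bounded with certainty by a polynomial in the security parameter $\kappa$ (in the experiment in which the adversary runs); sampling a uniform element of $\{0,\dots,n-1\}$ is an elementary operation. A function $f:\mathbb N\to\mathbb R$ is negligible if $\kappa^k f(\kappa)\to 0$ for every $k$. For every $\kappa$ let $\mathcal F=\mathcal F_\kappa=(X,\mathcal X,\mathsf{AR},\Phi,\epsilon_{\mathcal F})$ be a fuzzy key setting: an abelian group $X$ (elements encoded as strings), discrete probability distributions $\mathcal X$ (data) and $\Phi$ (errors) on $X$, a function $\mathsf{AR}:X\to 2^X$ with $x\in\mathsf{AR}(x)$, and $\epsilon_{\mathcal F}\in[0,1]$ with $\Pr[x\leftarrow\mathcal X;e\leftarrow\Phi: x+e\notin\mathsf{AR}(x)]\le\epsilon_{\mathcal F}$. The distribution $\Phi$ is efficiently samplable. Let $\mathsf{GGen}$ be a PPT algorithm that outputs on input $1^\kappa$ a triple $\mathcal G=(\mathbb G,p,g)$, where $\mathbb G$ is a group of prime order $p$ generated by $g$, with elements represented uniquely by strings of polynomial length and polynomial-time multiplication. A linear sketch scheme for $\mathcal F$ and $(\mathbb Z_p,+)$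 consists of a PPT algorithm $\mathsf{Setup}$ that outputs $\mathsf{pp}$, a deterministic polynomial-time algorithm $\mathsf{Sketch}(\mathsf{pp},x)=(c,a)$ with $c$ a string and $a\in\mathbb Z_p$, and a deterministic polynomial-time algorithm $\mathsf{DiffRec}(\mathsf{pp},c,\tilde c)\in\mathbb Z_p$. It is *linear* if there is a deterministic polynomial-time algorithm $\mathsf M$ such that for all $\mathsf{pp}$ in the support of $\mathsf{Setup}$ and all $x,e\in X$: if $(c,a)=\mathsf{Sketch}(\mathsf{pp},x)$ and $(\tilde c,\Delta a)=\mathsf M(\mathsf{pp},c,e)$, then $\mathsf{Sketch}(\mathsf{pp},x+e)=(\tilde c,a+\Delta a)$. *DL with sketch.* For an algorithm $\mathcal B$ let $\epsilon_{\mathcal B}(\kappa)$ be the probability that $\mathcal B(1^\kappa,\mathcal G,\mathsf{pp},g^a,c)=a$, where $\mathcal G=(\mathbb G,p,g)\leftarrow\mathsf{GGen}(1^\kappa)$, $\mathsf{pp}\leftarrow\mathsf{Setup}$, $x\leftarrow\mathcal X$, $(c,a)=\mathsf{Sketch}(\mathsf{pp},x)$. The assumption says that $\epsilon_{\mathcal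 B}$ is negligible for every PPT $\mathcal B$. *The scheme $\Pi_{\mathsf{FS}}^{\mathsf{DL}}$.* Messages are arbitrary strings and $\mathsf H$ is a random oracle with values in $\mathbb Z_p$. The public parameter is $(\mathcal G,\mathsf{pp})$ with $\mathcal G\leftarrow\mathsf{GGen}(1^\kappa)$, $\mathsf{pp}\leftarrow\mathsf{Setup}$. Fuzzy data $x$ with $(c,a)=\mathsf{Sketch}(\mathsf{pp},x)$ has verification key $(h,c)=(g^a,c)$. To sign $M$ with fuzzy data $x'$, let $(\tilde c,\tilde a)=\mathsf{Sketch}(\mathsf{pp},x')$, $r\leftarrow\mathbb Z_p$, $\beta=\mathsf H(g^{\tilde a},g^r,M)$, $z=\beta\tilde a+r$ and output $(\beta,z,\tilde c)$. To verify $(\beta,z,\tilde c)$, let $\Delta a=\mathsf{DiffRec}(\mathsf{pp},c,\tilde c)$, $\tilde h=h\,g^{\Delta a}$, $R=g^z\tilde h^{-\beta}$ and accept iff $\beta=\mathsf H(\tilde h,R,M)$. *EU-CMA game.* The challenger samples the public parameter and $x\leftarrow\mathcal X$ and gives the public parameter and the verification key of $x$ to the adversary $\mathcal A$, which may adaptively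 query $\mathsf H$ and a signing oracle; the latter answers a query $M$ by sampling a fresh $e\leftarrow\Phi$ and signing $M$ with $x+e$. Finally $\mathcal A$ outputs $(M^*,\sigma^*)$ and wins if $\sigma^*$ is a valid signature on $M^*$ and $M^*$ was not a signing query. The scheme is EU-CMA secure if every PPT $\mathcal A$ wins with negligible probability. **Theorem.** Suppose the linear sketch scheme is linear. 1. If the DL-with-sketch assumption holds, then $\Pi_{\mathsf{FS}}^{\mathsf{DL}}$ is EU-CMA secure in the random oracle model. 2. For every PPT adversary $\mathcal A$ against EU-CMA there is a PPT adversary $\mathcal B$ against DL with sketch such that for every $\kappa$: if $\mathcal A$ always makes at most $Q$ signing queries and at most $Q_{\mathsf H}$ random oracle queries at security parameter $\kappa$, then its winning probability $\epsilon(\kappa)$ satisfies $$\epsilon(\kappa)\le\sqrt{(Q_{\mathsf H}+1)\Big(\epsilon_{\mathcal B}(\kappa)+\tfrac1p\Big)}+\frac{Q(Q+Q_{\mathsf H})}{p},$$ where $1/p$ stands for its expectation over $\mathsf{GGen}(1^\kappa)$ (so it is just $1/p$ if $p$ is determined by $\kappa$). -/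

import Mathlib

open scoped ENNReal

/-! ## Data and probabilistic programs

Bit strings are organised as binary trees whose leaves are natural numbers written in binary. -/

/-- Data values handled by algorithms: trees with binary-encoded natural numbers at the leaves. -/
inductive Val : Type
  | nat (n : ℕ) : Val
  | pair (a b : Val) : Val
  deriving DecidableEq

namespace Val

/-- Length of a value: number of nodes plus the bit lengths of the numbers at the leaves. -/
def size : Val → ℕ
  | nat n => n.size + 1
  | pair a b => a.size + b.size + 1

/-- The number stored in a leaf (and `0` on a pair). -/
def toNat : Val → ℕ
  | nat n => n
  | pair _ _ => 0

end Val

/-- The string `1^κ`: the number whose binary expansion consists of `κ` ones. -/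
def ones (κ : ℕ) : Val := .nat (2 ^ κ - 1)

/-- Elementary deterministic instructions. -/
inductive Instr : Type
  | id | fst | snd | isPair | eq
  | const (n : ℕ)
  | add | sub | mul | div | mod

/-- Effect of an elementary instruction; `0` is returned on arguments of the wrong shape. -/
def Instr.apply : Instr → Val → Val
  | .id, v => v
  | .fst, .pair a _ => a
  | .snd, .pair _ b => b
  | .isPair, .pair _ _ => .nat 1
  | .eq, .pair a b => if a = b then .nat 1 else .nat 0
  | .const n, _ => .nat n
  | .add, .pair (.nat a) (.nat b) => .nat (a + b)
  | .sub, .pair (.nat a) (.nat b) => .nat (a - b)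
  | .mul, .pair (.nat a) (.nat b) => .nat (a * b)
  | .div, .pair (.nat a) (.nat b) => .nat (a / b)
  | .mod, .pair (.nat a) (.nat b) => .nat (a % b)
  | _, _ => .nat 0

/-- Probabilistic programs, acting on one value (the store, whose components serve as registers).
`rand` replaces a number `n` by a uniformly random element of `{0, …, n - 1}`;
`fork f g` is `v ↦ (f v, g v)`; `cond b f g` runs `f` if `b v ≠ 0` and `g` otherwise;
`loop b f` is `while b v ≠ 0 do v := f v`. -/
inductive Prog : Type
  | instr (i : Instr) : Prog
  | rand : Prog
  | seq (f g : Prog) : Prog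
  | fork (f g : Prog) : Prog
  | cond (b f g : Prog) : Prog
  | loop (b f : Prog) : Prog

/-- Uniform distribution on `{0, …, n - 1}` (the point mass at `0` if `n = 0`). -/
noncomputable def unif (n : ℕ) : PMF ℕ :=
  PMF.uniformOfFinset (Finset.range (n - 1 + 1)) ⟨0, by simp⟩

/-- Steps charged for an elementary instruction turning `v` into `w`: quadratic in the lengths, which
covers schoolbook arithmetic. -/
def charge (v w : Val) : ℕ := (v.size + w.size) ^ 2

/-- `while test v ≠ 0 do v := body v` for at most the given number of iterations, with the number of
steps. Every iteration is charged at least one step, and so is reaching the iteration limit, so a loop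
that is cut off at the limit `n` has used more than `n` steps. -/
noncomputable def whileLoop (test body : Val → PMF (Val × ℕ)) : ℕ → Val → PMF (Val × ℕ)
  | 0, v => PMF.pure (v, v.size + 1)
  | n + 1, v =>
    (test v).bind fun b =>
      if b.1 = .nat 0 then PMF.pure (v, v.size + 1 + b.2)
      else (body v).bind fun w => (whileLoop test body n w.1).bind fun u =>
        PMF.pure (u.1, v.size + 1 + b.2 + w.2 + u.2)

/-- Joint distribution of the result and of the number of steps of a program on a given store, where
every loop is cut off after `n` iterations. An execution that takes at most `n` steps is never cut off;
only such executions are used below. -/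
noncomputable def Prog.exec (n : ℕ) : Prog → Val → PMF (Val × ℕ)
  | .instr i, v => PMF.pure (i.apply v, charge v (i.apply v))
  | .rand, v => (unif v.toNat).bind fun r => PMF.pure (.nat r, charge v (.nat r))
  | .seq f g, v =>
    (f.exec n v).bind fun a => (g.exec n a.1).bind fun b => PMF.pure (b.1, a.2 + b.2)
  | .fork f g, v =>
    (f.exec n v).bind fun a => (g.exec n v).bind fun b =>
      PMF.pure (.pair a.1 b.1, v.size + 1 + a.2 + b.2)
  | .cond b f g, v =>
    (b.exec n v).bind fun c =>
      (if c.1 = .nat 0 then g.exec n v else f.exec n v).bind fun a =>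
        PMF.pure (a.1, v.size + 1 + c.2 + a.2)
  | .loop b f, v => whileLoop (b.exec n) (f.exec n) n v

/-- A program together with a polynomial meant to bound its running time. -/
structure Machine where
  prog : Prog
  time : Polynomial ℕ

namespace Machine

/-- On input `v` the machine always halts within a number of steps given by its polynomial at the
length of `v`, and its output has distribution `D`. -/
def Samples (M : Machine) (v : Val) (D : PMF Val) : Prop :=
  (∀ o ∈ (M.prog.exec (M.time.eval v.size) v).support, o.2 ≤ M.time.eval v.size) ∧
    (M.prog.exec (M.time.eval v.size) v).map Prod.fst = D

/-- On input `v` the machine halts within its polynomial time bound and outputs `w`. -/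
def Computes (M : Machine) (v w : Val) : Prop := M.Samples v (PMF.pure w)

end Machine

/-- Run of an interactive (oracle) program against a stateful oracle `O`, returning the final output,
the total number of steps of the program and the final state of the oracle. The program is activated on
`(its own state, incoming message)`. A result `(1, (q, state))` is a query `q`, and the program is next
activated with the answer; a result `(0, out)` ends the run with output `out`. At most the given number
of activations take place; a run that is cut off, here or in a loop, has used more than `n` steps when
this number is `n`. -/
noncomputable def interact {σ : Type} (O : Val → σ → PMF (Val × σ)) (c : Prog) (n : ℕ) :
    ℕ → Val → σ → PMF (Val × ℕ × σ)
  | 0, _, s => PMF.pure (.nat 0, 1, s)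
  | k + 1, v, s =>
    (c.exec n v).bind fun r =>
      match r.1 with
      | .pair (.nat 1) (.pair q st) =>
        (O q s).bind fun a => (interact O c n k (.pair st a.1) a.2).bind fun u =>
          PMF.pure (u.1, r.2 + u.2.1, u.2.2)
      | .pair (.nat 0) out => PMF.pure (out, r.2, s)
      | _ => PMF.pure (.nat 0, r.2, s)

/-- A negligible function: it decays faster than the inverse of every polynomial. -/
def Negligible (f : ℕ → ℝ) : Prop :=
  Asymptotics.SuperpolynomialDecay Filter.atTop (fun κ : ℕ => (κ : ℝ)) f

/-- The probability of an event. -/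
noncomputable def prob {α : Type} (D : PMF α) (E : Set α) : ℝ := (D.toOuterMeasure E).toReal

/-! ## Fuzzy key settings -/

/-- A fuzzy key setting: an abelian group `X` of fuzzy data (with its encoding as strings), the
distribution of fuzzy data, the acceptance region function, the error distribution and the error
parameter. -/
structure FuzzyKeySetting where
  X : Type
  [grp : AddCommGroup X]
  enc : X → Val
  enc_injective : Function.Injective enc
  dist : PMF X
  AR : X → Set X
  self_mem_AR : ∀ x, x ∈ AR x
  err : PMF X
  ε : ℝ
  ε_mem : ε ∈ Set.Icc (0 : ℝ) 1
  fnmr_le :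
    prob (dist.bind fun x => err.bind fun e => PMF.pure (x, e)) {y | y.1 + y.2 ∉ AR y.1} ≤ ε

attribute [instance] FuzzyKeySetting.grp

/-- The error distributions of a family of fuzzy key settings are efficiently samplable. -/
def ErrSamplable (F : ℕ → FuzzyKeySetting) : Prop :=
  ∃ S : Machine, ∀ κ, S.Samples (ones κ) ((F κ).err.map (F κ).enc)

/-! ## Group generation -/

/-- A group generation algorithm `GGen`. On input `1^κ` it outputs `(𝔾, p, g)`, where `𝔾` is given by a
description `d`, the group has prime order `p = order d` and is generated by `g = gen d`. Group
elements are represented by strings of polynomial length, and multiplication takes polynomial time. -/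
structure GroupGen where
  desc : ℕ → PMF Val
  G : Val → Type
  [grp : ∀ d, Group (G d)]
  order : Val → ℕ
  gen : ∀ d, G d
  enc : ∀ d, G d → Val
  enc_injective : ∀ d, Function.Injective (enc d)
  prime_order : ∀ κ, ∀ d ∈ (desc κ).support, (order d).Prime
  card_eq : ∀ κ, ∀ d ∈ (desc κ).support, Nat.card (G d) = order d
  gen_generates : ∀ κ, ∀ d ∈ (desc κ).support, Subgroup.zpowers (gen d) = ⊤
  ppt : ∃ S : Machine, ∀ κ,
    S.Samples (ones κ) ((desc κ).map fun d => .pair d (.pair (.nat (order d)) (enc d (gen d))))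
  enc_size : ∃ P : Polynomial ℕ, ∀ κ, ∀ d ∈ (desc κ).support, ∀ a : G d,
    (enc d a).size ≤ P.eval κ
  mul_polytime : ∃ S : Machine, ∀ κ, ∀ d ∈ (desc κ).support, ∀ a b : G d,
    S.Computes
      (.pair (ones κ) (.pair (.pair d (.pair (.nat (order d)) (enc d (gen d))))
        (.pair (enc d a) (enc d b))))
      (enc d (a * b))

attribute [instance] GroupGen.grp

namespace GroupGen

variable (GG : GroupGen)

/-- The string representing `(𝔾, p, g)`. -/
def triple (d : Val) : Val := .pair d (.pair (.nat (GG.order d)) (GG.enc d (GG.gen d)))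

/-- The group orders that can occur for a given security parameter. -/
def orders (κ : ℕ) : Set ℕ := GG.order '' (GG.desc κ).support

/-- The expectation of `1/p` (which is `1/p` if the order is determined by `κ`). -/
noncomputable def invOrder (κ : ℕ) : ℝ :=
  (∑' d, GG.desc κ d * ((GG.order d : ℝ≥0∞))⁻¹).toReal

end GroupGen

/-! ## Linear sketch -/

/-- A linear sketch scheme for the fuzzy key settings `F κ` and the groups `(ℤ_p, +)` with `p ∈ Λ κ`:
probabilistic polynomial-time `setup`, deterministic polynomial-time `sketch` and `diffRec`. Public
parameters and sketches are strings. -/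
structure LinearSketch (F : ℕ → FuzzyKeySetting) (Λ : ℕ → Set ℕ) where
  setup : ℕ → ℕ → PMF Val
  sketch : (κ p : ℕ) → (pp : Val) → (F κ).X → Val × ZMod p
  diffRec : (κ p : ℕ) → (pp c c' : Val) → ZMod p
  setup_ppt : ∃ S : Machine, ∀ κ, ∀ p ∈ Λ κ, S.Samples (.pair (ones κ) (.nat p)) (setup κ p)
  sketch_polytime : ∃ S : Machine, ∀ κ, ∀ p ∈ Λ κ, ∀ pp ∈ (setup κ p).support, ∀ x : (F κ).X,
    S.Computes (.pair (.pair (ones κ) (.nat p)) (.pair pp ((F κ).enc x)))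
      (.pair (sketch κ p pp x).1 (.nat (sketch κ p pp x).2.val))
  diffRec_polytime : ∃ S : Machine, ∀ κ, ∀ p ∈ Λ κ, ∀ pp ∈ (setup κ p).support, ∀ c c' : Val,
    S.Computes (.pair (.pair (ones κ) (.nat p)) (.pair pp (.pair c c')))
      (.nat (diffRec κ p pp c c').val)

/-- Linearity: some deterministic polynomial-time algorithm `mc` maps the sketch `c` of `x` and a shift
`e` to the sketch of `x + e` and the difference of the proxy keys. -/
def LinearSketch.Linearity {F : ℕ → FuzzyKeySetting} {Λ : ℕ → Set ℕ} (LS : LinearSketch F Λ) : Prop :=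
  ∃ mc : (κ p : ℕ) → (pp c : Val) → (F κ).X → Val × ZMod p,
    (∃ S : Machine, ∀ κ, ∀ p ∈ Λ κ, ∀ pp ∈ (LS.setup κ p).support, ∀ x e : (F κ).X,
      S.Computes
        (.pair (.pair (ones κ) (.nat p)) (.pair pp (.pair (LS.sketch κ p pp x).1 ((F κ).enc e))))
        (.pair (mc κ p pp (LS.sketch κ p pp x).1 e).1
          (.nat (mc κ p pp (LS.sketch κ p pp x).1 e).2.val))) ∧
    ∀ κ, ∀ p ∈ Λ κ, ∀ pp ∈ (LS.setup κ p).support, ∀ x e : (F κ).X,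
      LS.sketch κ p pp (x + e) =
        ((mc κ p pp (LS.sketch κ p pp x).1 e).1,
          (LS.sketch κ p pp x).2 + (mc κ p pp (LS.sketch κ p pp x).1 e).2)

/-! ## The discrete logarithm problem with sketch -/

section DLSketch

variable {F : ℕ → FuzzyKeySetting} (GG : GroupGen) (LS : LinearSketch F GG.orders)

/-- The experiment of the discrete logarithm problem with sketch: whether the adversary, given
`(𝔾, p, g)`, the sketch parameters, `g ^ a` and `c`, outputs `a`, and its number of steps. -/
noncomputable def dlSketchGame (B : Machine) (κ : ℕ) : PMF (Bool × ℕ) :=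
  (GG.desc κ).bind fun d =>
  (LS.setup κ (GG.order d)).bind fun pp =>
  (F κ).dist.bind fun x =>
    let ca := LS.sketch κ (GG.order d) pp x
    (B.prog.exec (B.time.eval κ)
      (.pair (ones κ) (.pair (.pair (GG.triple d) pp)
        (.pair (GG.enc d (GG.gen d ^ ca.2.val)) ca.1)))).bind fun o =>
    PMF.pure (decide (o.1 = .nat ca.2.val), o.2)

/-- The adversary is probabilistic polynomial-time: its steps never exceed its polynomial at `κ`. -/
def DLSketchPPT (B : Machine) : Prop :=
  ∀ κ, ∀ o ∈ (dlSketchGame GG LS B κ).support, o.2 ≤ B.time.eval κ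

/-- Probability that the adversary finds `a`. -/
noncomputable def dlSketchAdv (B : Machine) (κ : ℕ) : ℝ :=
  prob (dlSketchGame GG LS B κ) {o | o.1 = true}

/-- The discrete logarithm assumption with sketch. -/
def DLSketchAssumption : Prop :=
  ∀ B : Machine, DLSketchPPT GG LS B → Negligible (dlSketchAdv GG LS B)

end DLSketch

/-! ## Fuzzy signatures and EU-CMA security in the random oracle model -/

/-- The part of the random oracle with values in `ℤ_p` that has been sampled so far. -/
abbrev HashTable (p : ℕ) := Val → Option (ZMod p)

/-- A query to the lazily sampled random oracle. -/
noncomputable def hashQuery {p : ℕ} (x : Val) (T : HashTable p) : PMF (ZMod p × HashTable p) :=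
  match T x with
  | some β => PMF.pure (β, T)
  | none => (unif p).bind fun b => PMF.pure ((b : ZMod p), Function.update T x (some (b : ZMod p)))

/-- A fuzzy signature scheme in the random oracle model, for the message space of all strings; the hash
function takes values in `ℤ_p` with `p = range pp`. -/
structure FuzzySignature (F : ℕ → FuzzyKeySetting) where
  PP : Type
  encPP : PP → Val
  VK : PP → Type
  encVK : ∀ pp, VK pp → Val
  range : PP → ℕ
  setup : ℕ → PMF PP
  keyGen : (κ : ℕ) → (pp : PP) → (F κ).X → PMF (VK pp)
  sign : (κ : ℕ) → (pp : PP) → (x : (F κ).X) → (M : Val) →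
    HashTable (range pp) → PMF (Val × HashTable (range pp))
  vrfy : (κ : ℕ) → (pp : PP) → (vk : VK pp) → (M σ : Val) →
    HashTable (range pp) → PMF (Bool × HashTable (range pp))

/-- State of the challenger: the random oracle, the messages of all signing queries so far (with
repetitions), and the number of random oracle queries made by the adversary. -/
structure ChallengerState (p : ℕ) where
  table : HashTable p
  signed : List Val
  hashes : ℕ

/-- Result of the EU-CMA game: whether the adversary wins, its number of steps, and the numbers of its
signing queries and of its random oracle queries. -/
structure CMAOutcome where
  win : Bool
  steps : ℕ
  signs : ℕ
  hashes : ℕ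

namespace FuzzySignature

variable {F : ℕ → FuzzyKeySetting} (FS : FuzzySignature F)

/-- The oracles of the adversary: `(0, y)` is the random oracle query `y`, and `(1, M)` asks for a
signature on `M`, made with freshly perturbed fuzzy data `x + e`. -/
noncomputable def oracle (κ : ℕ) (pp : FS.PP) (x : (F κ).X) :
    Val → ChallengerState (FS.range pp) → PMF (Val × ChallengerState (FS.range pp))
  | .pair (.nat 0) y, s =>
    (hashQuery y s.table).bind fun r => PMF.pure (.nat r.1.val, ⟨r.2, s.signed, s.hashes + 1⟩)
  | .pair (.nat 1) M, s =>
    (F κ).err.bind fun e => (FS.sign κ pp (x + e) M s.table).bind fun r =>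
      PMF.pure (r.1, ⟨r.2, M :: s.signed, s.hashes⟩)
  | _, s => PMF.pure (.nat 0, s)

/-- The EU-CMA game. The adversary receives `1^κ`, the public parameter and the verification key, and
finally outputs `(M, σ)`; it wins if `σ` is a valid signature on `M` and `M` was never signed. -/
noncomputable def cmaGame (A : Machine) (κ : ℕ) : PMF CMAOutcome :=
  (FS.setup κ).bind fun pp =>
  (F κ).dist.bind fun x =>
  (FS.keyGen κ pp x).bind fun vk =>
  (interact (FS.oracle κ pp x) A.prog (A.time.eval κ) (A.time.eval κ)
    (.pair (.nat 0) (.pair (ones κ) (.pair (FS.encPP pp) (FS.encVK pp vk))))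
    ⟨fun _ => none, [], 0⟩).bind fun o =>
    match o.1 with
    | .pair M σ =>
      (FS.vrfy κ pp vk M σ o.2.2.table).bind fun b =>
        PMF.pure ⟨b.1 && decide (M ∉ o.2.2.signed), o.2.1, o.2.2.signed.length, o.2.2.hashes⟩
    | _ => PMF.pure ⟨false, o.2.1, o.2.2.signed.length, o.2.2.hashes⟩

/-- The adversary is probabilistic polynomial-time: its steps never exceed its polynomial at `κ`. -/
def CMAPPT (A : Machine) : Prop :=
  ∀ κ, ∀ o ∈ (FS.cmaGame A κ).support, o.steps ≤ A.time.eval κ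

/-- Probability that the adversary wins the EU-CMA game. -/
noncomputable def cmaAdv (A : Machine) (κ : ℕ) : ℝ := prob (FS.cmaGame A κ) {o | o.win = true}

/-- At security parameter `κ` the adversary makes at most `Q` signing queries and at most `QH` random
oracle queries. -/
def QueryBound (A : Machine) (κ Q QH : ℕ) : Prop :=
  ∀ o ∈ (FS.cmaGame A κ).support, o.signs ≤ Q ∧ o.hashes ≤ QH

/-- EU-CMA security in the random oracle model. -/
def EUCMA : Prop := ∀ A : Machine, FS.CMAPPT A → Negligible (FS.cmaAdv A)

end FuzzySignature

/-! ## The fuzzy signature scheme from discrete logarithms -/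

section Schnorr

variable {F : ℕ → FuzzyKeySetting} (GG : GroupGen) (LS : LinearSketch F GG.orders)

/-- The hash input `(h, R, M)`. -/
def hashInput (d : Val) (h R : GG.G d) (M : Val) : Val := .pair (GG.enc d h) (.pair (GG.enc d R) M)

/-- The Schnorr-based fuzzy signature. A public parameter is `(d, pp)` with `d` describing the group and
`pp` the sketch parameter, a verification key is `(g ^ a, c)`, and a signature is `(β, z, c')`. -/
noncomputable def schnorrFS : FuzzySignature F where
  PP := Val × Val
  encPP pp := .pair (GG.triple pp.1) pp.2
  VK pp := GG.G pp.1 × Val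
  encVK pp vk := .pair (GG.enc pp.1 vk.1) vk.2
  range pp := GG.order pp.1
  setup κ := (GG.desc κ).bind fun d => (LS.setup κ (GG.order d)).bind fun pp => PMF.pure (d, pp)
  keyGen κ pp x :=
    let ca := LS.sketch κ (GG.order pp.1) pp.2 x
    PMF.pure (GG.gen pp.1 ^ ca.2.val, ca.1)
  sign κ pp x M T :=
    let ca := LS.sketch κ (GG.order pp.1) pp.2 x
    (unif (GG.order pp.1)).bind fun r =>
    (hashQuery (hashInput GG pp.1 (GG.gen pp.1 ^ ca.2.val) (GG.gen pp.1 ^ r) M) T).bind fun β =>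
    let z : ZMod (GG.order pp.1) := β.1 * ca.2 + (r : ZMod (GG.order pp.1))
    PMF.pure (.pair (.nat β.1.val) (.pair (.nat z.val) ca.1), β.2)
  vrfy κ pp vk M σ T :=
    match σ with
    | .pair (.nat β) (.pair (.nat z) c') =>
      if β < GG.order pp.1 ∧ z < GG.order pp.1 then
        let δ := LS.diffRec κ (GG.order pp.1) pp.2 vk.2 c'
        let h := vk.1 * GG.gen pp.1 ^ δ.val
        let R := GG.gen pp.1 ^ z * (h ^ β)⁻¹
        (hashQuery (hashInput GG pp.1 h R M) T).bind fun b => PMF.pure (decide (b.1.val = β), b.2)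
      else PMF.pure (false, T)
    | _ => PMF.pure (false, T)

end Schnorr

/-! ## Running times of programs -/

/-! The argument is the forking proof for Schnorr signatures. Linearity of the sketch makes it work
for a signer whose key changes with every signature.

Simulation. From `c` and an error `e` the algorithm `mc` computes the sketch of `x + e` and the
shift `Δ` of the proxy key, so the key of `x + e` is `h * g ^ Δ`, although `a` is unknown. A
signature is simulated by choosing `β` and `z` first and programming the hash at the point formed
from this key, `R = g ^ z * (h * g ^ Δ) ^ (-β)` and `M`. This fails only if the point already has a
value. For fixed `β` the point is an injective function of `z`, and at most `Q + QH` points are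
recorded, so all signatures together cost at most `Q (Q + QH) / p` (`expect_sign_le`,
`expect_winProb_le`).

Forking. Let `a_i` be the probability that the simulated attack ends with a forgery whose hash point
is the fresh hash query number `i`, and `f` the probability that this point has no value yet. A
programmed point contains a signed message and is useless for a forgery; a point without value is
answered as the forgery needs with probability at most `1/p`. Hence the success probability is at
most `∑ a_i + f/p` plus the loss from signatures (`winProb_le`). The state of the adversary is an
explicit value and its coins are fresh in each activation, so a run can be resumed from the state
recorded at a query, with a new answer. Given the history up to query `i`, the old and the new
continuation are independent with the same distribution. Jensen's inequality gives `∑ a_i ^ 2 ≤ frk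
+ (∑ a_i) / p`, where `frk` is the probability of a useful pair of runs and `1/p` accounts for equal
answers (`sum_sq_expect_le`). Two forgeries at one point have the same key `g ^ (a + Δ)` and the
same `R`, whence `(a + Δ) (β - β') = z - z'`, which reveals `a` (`extractLog_eq`). The number `f/p`
is treated as one more term beside the `a_i`: Cauchy-Schwarz with `QH + 1` terms and `∑ a_i + f ≤ 1`
give the factor `QH + 1` and the summand `1/p` under the root (`Setup.sq_value_le`). A last use of
Jensen averages over the choices of the challenger.

Running time. The reduction is an explicit program and has to stop in polynomial time with
certainty, while the adversary is known to be fast only in the real game. Therefore every running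
state of the simulation, also after rewinding, is shown to occur in the real game with positive
probability (`answer_real`, `Setup.Inv`). Time bounds are propagated for whole families of inputs at
once by `Impl`, with one polynomial for the family.

Asymptotic security also needs `1/p` to be negligible. This follows from the assumption itself,
applied to the adversary that guesses `a` (`exists_guess`). -/

theorem PMF.bind_congr_support {α β : Type*} {D : PMF α} {f g : α → PMF β}
    (h : ∀ a ∈ D.support, f a = g a) : D.bind f = D.bind g := by
  ext b
  simp only [PMF.bind_apply]
  refine tsum_congr fun a => ?_
  by_cases ha : a ∈ D.support
  · rw [h a ha]
  · rw [(PMF.apply_eq_zero_iff D a).2 ha, zero_mul, zero_mul]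

theorem Val.one_le_size (v : Val) : 1 ≤ v.size := by
  cases v <;> simp [Val.size]

theorem le_charge_left (v w : Val) : v.size ≤ charge v w := by
  unfold charge
  nlinarith [v.one_le_size, w.one_le_size]

theorem le_charge_right (v w : Val) : w.size ≤ charge v w := by
  unfold charge
  nlinarith [v.one_le_size, w.one_le_size]

theorem whileLoop_size_le {test body : Val → PMF (Val × ℕ)} (m : ℕ) (v : Val) :
    ∀ o ∈ (whileLoop test body m v).support, v.size ≤ o.2 ∧ o.1.size ≤ o.2 := by
  induction m generalizing v with
  | zero =>
    intro o ho
    simp only [whileLoop, PMF.support_pure, Set.mem_singleton_iff] at ho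
    subst ho; simp
  | succ m ih =>
    intro o ho
    simp only [whileLoop, PMF.mem_support_bind_iff] at ho
    obtain ⟨b, -, ho⟩ := ho
    split_ifs at ho with hb
    · simp only [PMF.support_pure, Set.mem_singleton_iff] at ho
      subst ho
      simp only
      omega
    · simp only [PMF.mem_support_bind_iff, PMF.support_pure, Set.mem_singleton_iff] at ho
      obtain ⟨w, -, u, hu, rfl⟩ := ho
      have := ih _ _ hu
      simp only
      omega

/-- Each instruction is charged for reading its store and for writing its result. Later bounds on
the lengths of intermediate values are mostly obtained from running times in this way. -/
theorem Prog.size_le_steps (P : Prog) (n : ℕ) (v : Val) :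
    ∀ o ∈ (P.exec n v).support, v.size ≤ o.2 ∧ o.1.size ≤ o.2 := by
  induction P generalizing v with
  | instr i =>
    intro o ho
    simp only [Prog.exec, PMF.support_pure, Set.mem_singleton_iff] at ho
    subst ho
    exact ⟨le_charge_left _ _, le_charge_right _ _⟩
  | rand =>
    intro o ho
    simp only [Prog.exec, PMF.mem_support_bind_iff, PMF.support_pure, Set.mem_singleton_iff] at ho
    obtain ⟨r, -, rfl⟩ := ho
    exact ⟨le_charge_left _ _, le_charge_right _ _⟩
  | seq f g hf hg =>
    intro o ho
    simp only [Prog.exec, PMF.mem_support_bind_iff, PMF.support_pure, Set.mem_singleton_iff] at ho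
    obtain ⟨a, ha, b, hb, rfl⟩ := ho
    have := hf _ _ ha
    have := hg _ _ hb
    simp only
    omega
  | fork f g hf hg =>
    intro o ho
    simp only [Prog.exec, PMF.mem_support_bind_iff, PMF.support_pure, Set.mem_singleton_iff] at ho
    obtain ⟨a, ha, b, hb, rfl⟩ := ho
    have := hf _ _ ha
    have := hg _ _ hb
    simp only [Val.size]
    omega
  | cond b f g hb hf hg =>
    intro o ho
    simp only [Prog.exec, PMF.mem_support_bind_iff, PMF.support_pure, Set.mem_singleton_iff] at ho
    obtain ⟨c, hc, a, ha, rfl⟩ := ho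
    have : v.size ≤ a.2 ∧ a.1.size ≤ a.2 := by
      split_ifs at ha
      exacts [hg _ _ ha, hf _ _ ha]
    simp only
    omega
  | loop b f hb hf => exact whileLoop_size_le _ _

theorem Prog.one_le_steps {P : Prog} {n : ℕ} {v : Val} {o : Val × ℕ}
    (ho : o ∈ (P.exec n v).support) : 1 ≤ o.2 :=
  v.one_le_size.trans (P.size_le_steps n v o ho).1

/-- An iteration costs at least one step and so does reaching the limit. A run that stays within `m`
steps therefore never reaches the limit `m`, and raising the limit changes nothing. -/
theorem whileLoop_eq_of_le {test body test' body' : Val → PMF (Val × ℕ)} {n : ℕ}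
    (htest : ∀ v, (∀ o ∈ (test v).support, o.2 ≤ n) → test' v = test v)
    (hbody : ∀ v, (∀ o ∈ (body v).support, o.2 ≤ n) → body' v = body v)
    (j m : ℕ) (hm : m ≤ n) (v : Val) (h : ∀ o ∈ (whileLoop test body m v).support, o.2 ≤ m) :
    whileLoop test' body' (m + j) v = whileLoop test body m v := by
  induction m generalizing v with
  -- With no iteration allowed the cut-off costs a step, against the bound `0`.
  | zero => simp [whileLoop] at h
  | succ m ih =>
    rw [Nat.add_right_comm]
    simp only [whileLoop, PMF.mem_support_bind_iff] at h ⊢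
    have ht : ∀ b ∈ (test v).support, b.2 ≤ n ∧ (b.1 ≠ .nat 0 →
        ∀ w ∈ (body v).support, w.2 ≤ n ∧
          ∀ u ∈ (whileLoop test body m w.1).support, u.2 ≤ m) := by
      intro b hb
      by_cases h0 : b.1 = .nat 0
      · have := h (v, v.size + 1 + b.2) ⟨b, hb, by simp [h0]⟩
        simp only at this
        exact ⟨by omega, fun h1 => absurd h0 h1⟩
      · have key : ∀ w ∈ (body v).support, ∀ u ∈ (whileLoop test body m w.1).support,
            v.size + 1 + b.2 + w.2 + u.2 ≤ m + 1 := by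
          intro w hw u hu
          refine h (u.1, v.size + 1 + b.2 + w.2 + u.2) ⟨b, hb, ?_⟩
          rw [if_neg h0]
          simp only [PMF.mem_support_bind_iff]
          exact ⟨w, hw, u, hu, by simp⟩
        -- Supports are nonempty, so each prefix of a run extends to a complete run, whose bound
        -- then limits the prefix.
        obtain ⟨w, hw⟩ := (body v).support_nonempty
        obtain ⟨u, hu⟩ := (whileLoop test body m w.1).support_nonempty
        have := key w hw u hu
        refine ⟨by omega, fun _ w hw => ⟨?_, fun u hu => ?_⟩⟩
        · obtain ⟨u, hu⟩ := (whileLoop test body m w.1).support_nonempty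
          have := key w hw u hu
          omega
        · have := key w hw u hu
          omega
    rw [htest v fun o ho => (ht o ho).1]
    refine PMF.bind_congr_support fun b hb => ?_
    by_cases h0 : b.1 = .nat 0
    · simp [h0]
    · rw [if_neg h0, if_neg h0, hbody v fun o ho => ((ht b hb).2 h0 o ho).1]
      refine PMF.bind_congr_support fun w hw => ?_
      rw [ih (by omega) w.1 ((ht b hb).2 h0 w hw).2]

/-- This makes the distribution of a program independent of the iteration limit as soon as the limit
is an actual time bound, so that programs with different limits can be composed. -/
theorem Prog.exec_eq_of_le {n n' : ℕ} (hn : n ≤ n') (P : Prog) (v : Val)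
    (h : ∀ o ∈ (P.exec n v).support, o.2 ≤ n) : P.exec n' v = P.exec n v := by
  induction P generalizing v with
  | instr i => rfl
  | rand => rfl
  | seq f g hf hg =>
    simp only [Prog.exec, PMF.mem_support_bind_iff, PMF.support_pure, Set.mem_singleton_iff] at h ⊢
    rw [hf v fun o ho => ?_]
    · refine PMF.bind_congr_support fun a ha => ?_
      rw [hg _ fun o ho => ?_]
      have := h _ ⟨a, ha, o, ho, rfl⟩
      simp only at this
      omega
    · obtain ⟨b, hb⟩ := (g.exec n o.1).support_nonempty
      have := h _ ⟨o, ho, b, hb, rfl⟩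
      simp only at this
      omega
  | fork f g hf hg =>
    simp only [Prog.exec, PMF.mem_support_bind_iff, PMF.support_pure, Set.mem_singleton_iff] at h ⊢
    rw [hf v fun o ho => ?_, hg v fun o ho => ?_]
    · obtain ⟨b, hb⟩ := (f.exec n v).support_nonempty
      have := h _ ⟨b, hb, o, ho, rfl⟩
      simp only at this
      omega
    · obtain ⟨b, hb⟩ := (g.exec n v).support_nonempty
      have := h _ ⟨o, ho, b, hb, rfl⟩
      simp only at this
      omega
  | cond b f g hb hf hg =>
    simp only [Prog.exec, PMF.mem_support_bind_iff, PMF.support_pure, Set.mem_singleton_iff] at h ⊢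
    rw [hb v fun o ho => ?_]
    · refine PMF.bind_congr_support fun c hc => ?_
      by_cases h0 : c.1 = .nat 0
      · simp only [h0, if_true]
        rw [hg v fun o ho => ?_]
        have := h _ ⟨c, hc, o, by simpa [h0] using ho, rfl⟩
        simp only at this
        omega
      · simp only [h0, if_false]
        rw [hf v fun o ho => ?_]
        have := h _ ⟨c, hc, o, by simpa [h0] using ho, rfl⟩
        simp only at this
        omega
    · obtain ⟨a, ha⟩ := (if o.1 = .nat 0 then g.exec n v else f.exec n v).support_nonempty
      have := h _ ⟨o, ho, a, ha, rfl⟩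
      simp only at this
      omega
  | loop b f hb hf =>
    obtain ⟨j, rfl⟩ := Nat.exists_eq_add_of_le hn
    simp only [Prog.exec] at h ⊢
    exact whileLoop_eq_of_le hb hf j n le_rfl v h

/-- With any iteration limit that is at least `t`, the program takes at most `t` steps on input `v`, and
its output has distribution `D`. -/
def Runs (P : Prog) (v : Val) (D : PMF Val) (t : ℕ) : Prop :=
  ∀ n, t ≤ n → (∀ o ∈ (P.exec n v).support, o.2 ≤ t) ∧ (P.exec n v).map Prod.fst = D

theorem Runs.mono {P : Prog} {v : Val} {D : PMF Val} {t t' : ℕ} (h : Runs P v D t) (ht : t ≤ t') :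
    Runs P v D t' :=
  fun n hn => ⟨fun o ho => ((h n (ht.trans hn)).1 o ho).trans ht, (h n (ht.trans hn)).2⟩

theorem Runs.of_exec {P : Prog} {v : Val} {n : ℕ} (h : ∀ o ∈ (P.exec n v).support, o.2 ≤ n) :
    Runs P v ((P.exec n v).map Prod.fst) n := fun m hm => by
  rw [Prog.exec_eq_of_le hm P v h]
  exact ⟨h, rfl⟩

theorem Runs.of_samples {M : Machine} {v : Val} {D : PMF Val} (h : M.Samples v D) :
    Runs M.prog v D (M.time.eval v.size) := by
  have := Runs.of_exec h.1
  rwa [h.2] at this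

theorem Runs.size_le {P : Prog} {v : Val} {D : PMF Val} {t : ℕ} (h : Runs P v D t) :
    v.size ≤ t := by
  obtain ⟨o, ho⟩ := (P.exec t v).support_nonempty
  exact (P.size_le_steps t v o ho).1.trans ((h t le_rfl).1 o ho)

theorem Runs.size_le_of_mem {P : Prog} {v w : Val} {D : PMF Val} {t : ℕ} (h : Runs P v D t)
    (hw : w ∈ D.support) : w.size ≤ t := by
  rw [← (h t le_rfl).2, PMF.mem_support_map_iff] at hw
  obtain ⟨o, ho, rfl⟩ := hw
  exact (P.size_le_steps t v o ho).2.trans ((h t le_rfl).1 o ho)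

theorem Runs.instr (i : Instr) (v : Val) :
    Runs (.instr i) v (PMF.pure (i.apply v)) (charge v (i.apply v)) := fun n _ => by
  simp [Prog.exec, PMF.pure_map]

theorem Runs.rand (m : ℕ) {t : ℕ} (ht : ∀ r ∈ (unif m).support, charge (.nat m) (.nat r) ≤ t) :
    Runs .rand (.nat m) ((unif m).map .nat) t := fun n _ => by
  constructor
  · intro o ho
    simp only [Prog.exec, PMF.mem_support_bind_iff, PMF.support_pure, Set.mem_singleton_iff] at ho
    obtain ⟨r, hr, rfl⟩ := ho
    exact ht r hr
  · simp only [Prog.exec, PMF.map_bind, PMF.pure_map, Val.toNat]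
    rfl

/-- The intermediate result is described by an abstract value `a` with encoding `φ a`. The final
distribution may depend on `a` itself, so `φ` need not be injective. -/
theorem Runs.seq {α : Type} {f g : Prog} {v : Val} {D : PMF α} {φ : α → Val} {E : α → PMF Val}
    {t₁ t₂ : ℕ} (hf : Runs f v (D.map φ) t₁) (hg : ∀ a ∈ D.support, Runs g (φ a) (E a) t₂) :
    Runs (f.seq g) v (D.bind E) (t₁ + t₂) := fun n hn => by
  obtain ⟨h1, h2⟩ := hf n (by omega)
  constructor
  · intro o ho
    simp only [Prog.exec, PMF.mem_support_bind_iff, PMF.support_pure, Set.mem_singleton_iff] at ho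
    obtain ⟨a, ha, b, hb, rfl⟩ := ho
    have h3 : a.1 ∈ (D.map φ).support := by
      rw [← h2, PMF.mem_support_map_iff]; exact ⟨a, ha, rfl⟩
    rw [PMF.mem_support_map_iff] at h3
    obtain ⟨x, hx, hxa⟩ := h3
    rw [← hxa] at hb
    exact Nat.add_le_add (h1 a ha) ((hg x hx n (by omega)).1 b hb)
  · have e1 : ((f.seq g).exec n v).map Prod.fst =
        ((f.exec n v).map Prod.fst).bind fun w => (g.exec n w).map Prod.fst := by
      simp only [Prog.exec, PMF.map_bind, PMF.pure_map, PMF.bind_map]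
      rfl
    rw [e1, h2, PMF.bind_map]
    exact PMF.bind_congr_support fun a ha => (hg a ha n (by omega)).2

theorem Runs.fork {f g : Prog} {v : Val} {D D' : PMF Val} {t₁ t₂ : ℕ} (hf : Runs f v D t₁)
    (hg : Runs g v D' t₂) :
    Runs (f.fork g) v (D.bind fun a => D'.map (Val.pair a)) (v.size + 1 + t₁ + t₂) := fun n hn => by
  obtain ⟨h1, h2⟩ := hf n (by omega)
  obtain ⟨h3, h4⟩ := hg n (by omega)
  constructor
  · intro o ho
    simp only [Prog.exec, PMF.mem_support_bind_iff, PMF.support_pure, Set.mem_singleton_iff] at ho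
    obtain ⟨a, ha, b, hb, rfl⟩ := ho
    have := h1 a ha
    have := h3 b hb
    simp only
    omega
  · rw [← h2, ← h4, PMF.bind_map]
    simp only [Prog.exec, PMF.map_bind, PMF.pure_map, PMF.map_comp]
    rfl

theorem Runs.cond {b f g : Prog} {v w : Val} {D : PMF Val} {t₁ t₂ : ℕ}
    (hb : Runs b v (PMF.pure w) t₁) (hf : w ≠ .nat 0 → Runs f v D t₂)
    (hg : w = .nat 0 → Runs g v D t₂) : Runs (b.cond f g) v D (v.size + 1 + t₁ + t₂) := fun n hn => by
  obtain ⟨h1, h2⟩ := hb n (by omega)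
  have hw : ∀ c ∈ (b.exec n v).support, c.1 = w := fun c hc => by
    have : c.1 ∈ (PMF.pure w).support := by rw [← h2, PMF.mem_support_map_iff]; exact ⟨c, hc, rfl⟩
    simpa using this
  have h3 : (∀ o ∈ (if w = .nat 0 then g.exec n v else f.exec n v).support, o.2 ≤ t₂) ∧
      (if w = .nat 0 then g.exec n v else f.exec n v).map Prod.fst = D := by
    split_ifs with h0
    exacts [hg h0 n (by omega), hf h0 n (by omega)]
  constructor
  · intro o ho
    simp only [Prog.exec, PMF.mem_support_bind_iff, PMF.support_pure, Set.mem_singleton_iff] at ho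
    obtain ⟨c, hc, a, ha, rfl⟩ := ho
    rw [hw c hc] at ha
    have := h1 c hc
    have := h3.1 a ha
    simp only
    omega
  · have e1 : ((b.cond f g).exec n v).map Prod.fst = (b.exec n v).bind fun c =>
        (if c.1 = .nat 0 then g.exec n v else f.exec n v).map Prod.fst := by
      simp only [Prog.exec, PMF.map_bind, PMF.pure_map]
      rfl
    rw [e1, PMF.bind_congr_support (g := fun _ => D) fun c hc => by rw [hw c hc]; exact h3.2,
      PMF.bind_const]

/-- Iterate a random step while a test holds, at most the given number of times. -/
noncomputable def iterWhile {σ : Type} (test : σ → Bool) (step : σ → PMF σ) : ℕ → σ → PMF σ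
  | 0, s => PMF.pure s
  | k + 1, s => if test s then (step s).bind (iterWhile test step k) else PMF.pure s

theorem iterWhile_of_not {σ : Type} {test : σ → Bool} {step : σ → PMF σ} {s : σ}
    (h : test s = false) (k : ℕ) : iterWhile test step k s = PMF.pure s := by
  cases k <;> simp [iterWhile, h]

/-- The index of `Inv` bounds the number of iterations still to come and exists only in the proof;
the program carries no counter. One iteration costs at most `t₁` for the length of the store, which
the test has to read, `t₁` for the test, `t₂` for the body and one more step. The last, failing test
explains the factor `k + 1`. -/
theorem Runs.loop {σ : Type} {b f : Prog} (enc : σ → Val) (test : σ → Bool) (step : σ → PMF σ)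
    (Inv : ℕ → σ → Prop) {N t₁ t₂ : ℕ}
    (htest : ∀ k ≤ N, ∀ s, Inv k s → ∃ w, Runs b (enc s) (PMF.pure w) t₁ ∧
      (w = .nat 0 ↔ test s = false))
    (hbody : ∀ k ≤ N, ∀ s, Inv k s → test s = true → Runs f (enc s) ((step s).map enc) t₂)
    (hstep : ∀ k ≤ N, ∀ s, Inv k s → test s = true →
      0 < k ∧ ∀ s' ∈ (step s).support, Inv (k - 1) s')
    (k : ℕ) (hk : k ≤ N) (s : σ) (hs : Inv k s) :
    Runs (b.loop f) (enc s) ((iterWhile test step k s).map enc) ((k + 1) * (2 * t₁ + t₂ + 1)) := by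
  intro n hn
  have hn1 : 2 * t₁ + t₂ + 1 ≤ n :=
    (Nat.le_mul_of_pos_left _ (Nat.succ_pos k)).trans hn
  have hn2 : k + 1 ≤ n := (Nat.le_mul_of_pos_right _ (by omega)).trans hn
  simp only [Prog.exec]
  suffices H : ∀ k ≤ N, ∀ s, Inv k s → ∀ m, k + 1 ≤ m →
      (∀ o ∈ (whileLoop (b.exec n) (f.exec n) m (enc s)).support,
        o.2 ≤ (k + 1) * (2 * t₁ + t₂ + 1)) ∧
      (whileLoop (b.exec n) (f.exec n) m (enc s)).map Prod.fst =
        (iterWhile test step k s).map enc from H k hk s hs n hn2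
  intro k
  induction k with
  | zero =>
    intro hk s hs m hm
    obtain ⟨m, rfl⟩ := Nat.exists_eq_add_of_le' hm
    obtain ⟨w, hw, hw0⟩ := htest 0 hk s hs
    -- At index `0` the test must fail, because a successful test would force the index to be
    -- positive.
    have hts : test s = false := by
      by_contra h
      exact absurd (hstep 0 hk s hs (by simpa using h)).1 (lt_irrefl 0)
    have hsz := hw.size_le
    obtain ⟨h1, h2⟩ := hw n (by omega)
    have hc : ∀ c ∈ (b.exec n (enc s)).support, c.1 = .nat 0 := fun c hc => by
      have : c.1 ∈ (PMF.pure w).support := by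
        rw [← h2, PMF.mem_support_map_iff]; exact ⟨c, hc, rfl⟩
      rw [← hw0.2 hts]; simpa using this
    constructor
    · intro o ho
      simp only [whileLoop, PMF.mem_support_bind_iff] at ho
      obtain ⟨c, hc', ho⟩ := ho
      rw [if_pos (hc c hc')] at ho
      simp only [PMF.support_pure, Set.mem_singleton_iff] at ho
      subst ho
      have := h1 c hc'
      simp only
      omega
    · simp only [whileLoop, iterWhile, PMF.map_bind, PMF.pure_map]
      rw [PMF.bind_congr_support (g := fun _ => PMF.pure (enc s)) fun c hc' => by
        rw [if_pos (hc c hc'), PMF.pure_map], PMF.bind_const]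
  | succ k ih =>
    intro hk s hs m hm
    obtain ⟨m, rfl⟩ : ∃ m', m = m' + 1 := ⟨m - 1, by omega⟩
    obtain ⟨w, hw, hw0⟩ := htest _ hk s hs
    have hsz := hw.size_le
    obtain ⟨h1, h2⟩ := hw n (by omega)
    have hc : ∀ c ∈ (b.exec n (enc s)).support, c.1 = w := fun c hc => by
      have : c.1 ∈ (PMF.pure w).support := by
        rw [← h2, PMF.mem_support_map_iff]; exact ⟨c, hc, rfl⟩
      simpa using this
    cases hts : test s with
    | false =>
      have hw1 := hw0.2 hts
      constructor
      · intro o ho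
        simp only [whileLoop, PMF.mem_support_bind_iff] at ho
        obtain ⟨c, hc', ho⟩ := ho
        rw [if_pos ((hc c hc').trans hw1)] at ho
        simp only [PMF.support_pure, Set.mem_singleton_iff] at ho
        subst ho
        have := h1 c hc'
        simp only
        nlinarith
      · rw [iterWhile_of_not hts, PMF.pure_map]
        simp only [whileLoop, PMF.map_bind]
        rw [PMF.bind_congr_support (g := fun _ => PMF.pure (enc s)) fun c hc' => by
          rw [if_pos ((hc c hc').trans hw1), PMF.pure_map], PMF.bind_const]
    | true =>
      have hw1 : w ≠ .nat 0 := fun h => by simpa [hts] using hw0.1 h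
      obtain ⟨h3, h4⟩ := hbody _ hk s hs hts n (by omega)
      have hnext := (hstep _ hk s hs hts).2
      simp only [Nat.add_sub_cancel] at hnext
      constructor
      · intro o ho
        simp only [whileLoop, PMF.mem_support_bind_iff] at ho
        obtain ⟨c, hc', ho⟩ := ho
        rw [if_neg ((hc c hc').trans_ne hw1)] at ho
        simp only [PMF.mem_support_bind_iff, PMF.support_pure, Set.mem_singleton_iff] at ho
        obtain ⟨a, ha, u, hu, rfl⟩ := ho
        have h5 : a.1 ∈ ((step s).map enc).support := by
          rw [← h4, PMF.mem_support_map_iff]; exact ⟨a, ha, rfl⟩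
        rw [PMF.mem_support_map_iff] at h5
        obtain ⟨s', hs', hsa⟩ := h5
        rw [← hsa] at hu
        have := (ih (by omega) s' (hnext s' hs') m (by omega)).1 u hu
        have := h1 c hc'
        have := h3 a ha
        simp only
        nlinarith
      · simp only [whileLoop, PMF.map_bind, iterWhile, hts, if_true]
        rw [PMF.bind_congr_support (g := fun _ => ((f.exec n (enc s)).map Prod.fst).bind fun w =>
            (whileLoop (b.exec n) (f.exec n) m w).map Prod.fst) fun c hc' => by
          rw [if_neg ((hc c hc').trans_ne hw1)]
          simp only [PMF.map_bind, PMF.pure_map, PMF.bind_map]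
          rfl, PMF.bind_const, h4, PMF.bind_map]
        exact PMF.bind_congr_support fun s' hs' =>
          (ih (by omega) s' (hnext s' hs') m (by omega)).2

/-! ## Polynomially bounded families -/

theorem Polynomial.eval_nat_mono (q : Polynomial ℕ) : Monotone fun n : ℕ => q.eval n := by
  intro m n h
  simp only [Polynomial.eval_eq_sum_range]
  gcongr

/-- `f` is bounded by a polynomial in `κ`. -/
def PolyBdd {J : Type} (κ f : J → ℕ) : Prop := ∃ t : Polynomial ℕ, ∀ j, f j ≤ t.eval (κ j)

namespace PolyBdd

variable {J : Type} {κ f g : J → ℕ}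

theorem const (c : ℕ) : PolyBdd κ fun _ => c := ⟨Polynomial.C c, fun j => by simp⟩

theorem self : PolyBdd κ κ := ⟨Polynomial.X, fun j => by simp⟩

theorem mono (hg : PolyBdd κ g) (h : ∀ j, f j ≤ g j) : PolyBdd κ f :=
  let ⟨t, ht⟩ := hg
  ⟨t, fun j => (h j).trans (ht j)⟩

theorem add (hf : PolyBdd κ f) (hg : PolyBdd κ g) : PolyBdd κ fun j => f j + g j :=
  let ⟨s, hs⟩ := hf
  let ⟨t, ht⟩ := hg
  ⟨s + t, fun j => by simpa using Nat.add_le_add (hs j) (ht j)⟩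

theorem mul (hf : PolyBdd κ f) (hg : PolyBdd κ g) : PolyBdd κ fun j => f j * g j :=
  let ⟨s, hs⟩ := hf
  let ⟨t, ht⟩ := hg
  ⟨s * t, fun j => by simpa using Nat.mul_le_mul (hs j) (ht j)⟩

theorem pow (hf : PolyBdd κ f) (m : ℕ) : PolyBdd κ fun j => f j ^ m :=
  let ⟨s, hs⟩ := hf
  ⟨s ^ m, fun j => by simpa using Nat.pow_le_pow_left (hs j) m⟩

theorem eval (hf : PolyBdd κ f) (q : Polynomial ℕ) : PolyBdd κ fun j => q.eval (f j) :=
  let ⟨s, hs⟩ := hf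
  ⟨q.comp s, fun j => by simpa [Polynomial.eval_comp] using q.eval_nat_mono (hs j)⟩

theorem reindex {J' : Type} (hf : PolyBdd κ f) (i : J' → J) :
    PolyBdd (fun j => κ (i j)) fun j => f (i j) :=
  let ⟨t, ht⟩ := hf
  ⟨t, fun j => ht (i j)⟩

end PolyBdd

/-- The lengths of the values `v j` are bounded by a polynomial in `κ`. -/
def PolySized {J : Type} (κ : J → ℕ) (v : J → Val) : Prop := PolyBdd κ fun j => (v j).size

namespace PolySized

variable {J : Type} {κ : J → ℕ} {v w : J → Val}

theorem reindex {J' : Type} (hv : PolySized κ v) (i : J' → J) :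
    PolySized (fun j => κ (i j)) fun j => v (i j) :=
  PolyBdd.reindex hv i

theorem pair (hv : PolySized κ v) (hw : PolySized κ w) : PolySized κ fun j => .pair (v j) (w j) :=
  ((PolyBdd.add hv hw).add (.const 1)).mono fun _ => by simp [Val.size]

theorem of_pair_left (h : PolySized κ fun j => .pair (v j) (w j)) : PolySized κ v :=
  PolyBdd.mono h fun _ => by simp only [Val.size]; omega

theorem of_pair_right (h : PolySized κ fun j => .pair (v j) (w j)) : PolySized κ w :=
  PolyBdd.mono h fun _ => by simp only [Val.size]; omega

theorem mono (hw : PolySized κ w) (h : ∀ j, (v j).size ≤ (w j).size) : PolySized κ v :=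
  PolyBdd.mono hw h

theorem const (a : Val) : PolySized κ fun _ => a := PolyBdd.const _

theorem nat_mono {f g : J → ℕ} (h : PolySized κ fun j => .nat (g j)) (hfg : ∀ j, f j ≤ g j) :
    PolySized κ fun j => .nat (f j) :=
  PolyBdd.mono h fun j => by simpa [Val.size] using Nat.size_le_size (hfg j)

theorem size_nat {f : J → ℕ} (h : PolySized κ fun j => .nat (f j)) :
    PolyBdd κ fun j => (f j).size :=
  PolyBdd.mono h fun j => by simp [Val.size]

theorem nat_add {f g : J → ℕ} (hf : PolySized κ fun j => .nat (f j))
    (hg : PolySized κ fun j => .nat (g j)) : PolySized κ fun j => .nat (f j + g j) :=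
  (PolyBdd.add hf hg).mono fun j => by
    have h : (f j + g j).size ≤ (f j).size + (g j).size + 1 := by
      rw [Nat.size_le, pow_succ, pow_add]
      have h1 := Nat.lt_size_self (f j)
      have h2 := Nat.lt_size_self (g j)
      nlinarith
    simp only [Val.size]
    omega

theorem nat_mul {f g : J → ℕ} (hf : PolySized κ fun j => .nat (f j))
    (hg : PolySized κ fun j => .nat (g j)) : PolySized κ fun j => .nat (f j * g j) :=
  (PolyBdd.add hf hg).mono fun j => by
    have h : (f j * g j).size ≤ (f j).size + (g j).size := by
      rw [Nat.size_le, pow_add]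
      exact Nat.mul_lt_mul'' (Nat.lt_size_self (f j)) (Nat.lt_size_self (g j))
    simp only [Val.size]
    omega

end PolySized

/-! ## Straight-line programs -/

/-- Programs without loops and random choices. -/
def Prog.Straight : Prog → Bool
  | .instr _ => true
  | .rand => false
  | .seq f g => f.Straight && g.Straight
  | .fork f g => f.Straight && g.Straight
  | .cond b f g => b.Straight && f.Straight && g.Straight
  | .loop _ _ => false

/-- The function computed by a straight-line program. -/
def Prog.denote : Prog → Val → Val
  | .instr i, v => i.apply v
  | .rand, v => v
  | .seq f g, v => g.denote (f.denote v)
  | .fork f g, v => .pair (f.denote v) (g.denote v)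
  | .cond b f g, v => if b.denote v = .nat 0 then g.denote v else f.denote v
  | .loop _ _, v => v

/-- Even a product has no more bits than its two factors together, and both factors are part of the
argument. -/
theorem Instr.size_apply_le (i : Instr) : ∃ C, ∀ v, (i.apply v).size ≤ v.size + C := by
  have hnat : ∀ a b : ℕ, a ≤ b → a.size ≤ b.size := fun a b h => Nat.size_le_size h
  cases i with
  | id => exact ⟨0, fun v => by simp [Instr.apply]⟩
  | const n => exact ⟨n.size + 1, fun v => by simp [Instr.apply, Val.size]⟩
  | fst =>
    refine ⟨1, fun v => ?_⟩
    rcases v with n | ⟨a, b⟩ <;> simp only [Instr.apply, Val.size, Nat.size_zero] <;> omega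
  | snd =>
    refine ⟨1, fun v => ?_⟩
    rcases v with n | ⟨a, b⟩ <;> simp only [Instr.apply, Val.size, Nat.size_zero] <;> omega
  | isPair =>
    refine ⟨2, fun v => ?_⟩
    rcases v with n | ⟨a, b⟩ <;> simp only [Instr.apply, Val.size, Nat.size_zero, Nat.size_one] <;>
      omega
  | eq =>
    refine ⟨2, fun v => ?_⟩
    rcases v with n | ⟨a, b⟩
    · simp only [Instr.apply, Val.size, Nat.size_zero]; omega
    · simp only [Instr.apply]
      split_ifs <;> simp only [Val.size, Nat.size_zero, Nat.size_one] <;> omega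
  | add =>
    refine ⟨1, fun v => ?_⟩
    rcases v with n | ⟨a | ⟨a, a'⟩, b | ⟨b, b'⟩⟩ <;>
      simp only [Instr.apply, Val.size, Nat.size_zero] <;> try omega
    have h : (a + b).size ≤ a.size + b.size + 1 := by
      rw [Nat.size_le, pow_succ, pow_add]
      have h1 := Nat.lt_size_self a
      have h2 := Nat.lt_size_self b
      nlinarith
    omega
  | mul =>
    refine ⟨1, fun v => ?_⟩
    rcases v with n | ⟨a | ⟨a, a'⟩, b | ⟨b, b'⟩⟩ <;>
      simp only [Instr.apply, Val.size, Nat.size_zero] <;> try omega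
    have h : (a * b).size ≤ a.size + b.size := by
      rw [Nat.size_le, pow_add]
      exact Nat.mul_lt_mul'' (Nat.lt_size_self a) (Nat.lt_size_self b)
    omega
  | sub =>
    refine ⟨1, fun v => ?_⟩
    rcases v with n | ⟨a | ⟨a, a'⟩, b | ⟨b, b'⟩⟩ <;>
      simp only [Instr.apply, Val.size, Nat.size_zero] <;> try omega
    have := hnat _ _ (Nat.sub_le a b)
    omega
  | div =>
    refine ⟨1, fun v => ?_⟩
    rcases v with n | ⟨a | ⟨a, a'⟩, b | ⟨b, b'⟩⟩ <;>
      simp only [Instr.apply, Val.size, Nat.size_zero] <;> try omega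
    have := hnat _ _ (Nat.div_le_self a b)
    omega
  | mod =>
    refine ⟨1, fun v => ?_⟩
    rcases v with n | ⟨a | ⟨a, a'⟩, b | ⟨b, b'⟩⟩ <;>
      simp only [Instr.apply, Val.size, Nat.size_zero] <;> try omega
    have := hnat _ _ (Nat.mod_le a b)
    omega

/-- In a composition the second polynomial is evaluated at the first one, since the running time of
the first program bounds the length of its output. -/
theorem Prog.runs_denote (P : Prog) (hP : P.Straight = true) :
    ∃ q : Polynomial ℕ, ∀ v, Runs P v (PMF.pure (P.denote v)) (q.eval v.size) := by
  induction P with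
  | instr i =>
    obtain ⟨C, hC⟩ := i.size_apply_le
    refine ⟨(Polynomial.X + (Polynomial.X + Polynomial.C C)) ^ 2, fun v => ?_⟩
    refine (Runs.instr i v).mono ?_
    simp only [charge, Polynomial.eval_pow, Polynomial.eval_add, Polynomial.eval_X,
      Polynomial.eval_C]
    have := hC v
    gcongr
  | rand => simp [Prog.Straight] at hP
  | loop b f => simp [Prog.Straight] at hP
  | seq f g hf hg =>
    simp only [Prog.Straight, Bool.and_eq_true] at hP
    obtain ⟨q, hq⟩ := hf hP.1
    obtain ⟨r, hr⟩ := hg hP.2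
    refine ⟨q + r.comp q, fun v => ?_⟩
    have h1 := (hq v).size_le_of_mem (w := f.denote v) (by simp)
    have := Runs.seq (D := PMF.pure ()) (φ := fun _ => f.denote v) (g := g)
      (E := fun _ => PMF.pure (g.denote (f.denote v))) (by simpa [PMF.pure_map] using hq v)
      fun _ _ => (hr (f.denote v)).mono (r.eval_nat_mono h1)
    rw [PMF.pure_bind] at this
    simpa [Prog.denote, Polynomial.eval_comp] using this
  | fork f g hf hg =>
    simp only [Prog.Straight, Bool.and_eq_true] at hP
    obtain ⟨q, hq⟩ := hf hP.1
    obtain ⟨r, hr⟩ := hg hP.2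
    refine ⟨Polynomial.X + 1 + q + r, fun v => ?_⟩
    have := (hq v).fork (hr v)
    simpa [Prog.denote, PMF.pure_bind, PMF.pure_map] using this
  | cond b f g hb hf hg =>
    simp only [Prog.Straight, Bool.and_eq_true] at hP
    obtain ⟨p, hp⟩ := hb hP.1.1
    obtain ⟨q, hq⟩ := hf hP.1.2
    obtain ⟨r, hr⟩ := hg hP.2
    refine ⟨Polynomial.X + 1 + p + (q + r), fun v => ?_⟩
    have := (hp v).cond (f := f) (g := g) (D := PMF.pure ((b.cond f g).denote v))
      (t₂ := q.eval v.size + r.eval v.size)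
      (fun h => by
        simp only [Prog.denote, h, if_false]
        exact (hq v).mono (Nat.le_add_right _ _))
      (fun h => by
        simp only [Prog.denote, h, if_true]
        exact (hr v).mono (Nat.le_add_left _ _))
    simpa using this

theorem mem_support_unif (n r : ℕ) : r ∈ (unif n).support ↔ r ≤ n - 1 := by
  exact (PMF.mem_support_uniformOfFinset_iff _ r).trans (by rw [Finset.mem_range, Nat.lt_succ_iff])

/-! ## Families of runs in uniformly polynomial time -/

/-- On the inputs `v j` the program runs in time polynomial in `κ j`, with output distribution `D j`. -/
def Impl {J : Type} (κ : J → ℕ) (P : Prog) (v : J → Val) (D : J → PMF Val) : Prop :=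
  ∃ t : Polynomial ℕ, ∀ j, Runs P (v j) (D j) (t.eval (κ j))

namespace Impl

variable {J : Type} {κ : J → ℕ} {P b f g : Prog} {v w u : J → Val} {D : J → PMF Val}

theorem of_bdd {T : J → ℕ} (hT : PolyBdd κ T) (h : ∀ j, Runs P (v j) (D j) (T j)) :
    Impl κ P v D :=
  let ⟨t, ht⟩ := hT
  ⟨t, fun j => (h j).mono (ht j)⟩

theorem sized (h : Impl κ P v D) : PolySized κ v :=
  let ⟨t, ht⟩ := h
  ⟨t, fun j => (ht j).size_le⟩

theorem sized_out {J' : Type} (h : Impl κ P v D) (i : J' → J) {w : J' → Val}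
    (hw : ∀ j, w j ∈ (D (i j)).support) : PolySized (fun j => κ (i j)) w :=
  let ⟨t, ht⟩ := h
  ⟨t, fun j => (ht (i j)).size_le_of_mem (hw j)⟩

theorem sized_pure (h : Impl κ P v fun j => PMF.pure (w j)) : PolySized κ w :=
  h.sized_out id fun j => by simp

theorem straight (hP : P.Straight = true) (hv : PolySized κ v) (hw : ∀ j, P.denote (v j) = w j) :
    Impl κ P v fun j => PMF.pure (w j) :=
  let ⟨q, hq⟩ := P.runs_denote hP
  of_bdd (PolyBdd.eval hv q) fun j => hw j ▸ hq (v j)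

theorem straight_denote (hP : P.Straight = true) (hv : PolySized κ v)
    (hD : ∀ j, D j = PMF.pure (P.denote (v j))) : Impl κ P v D := by
  rw [funext hD]
  exact straight hP hv fun _ => rfl

theorem machine {M : Machine} (hv : PolySized κ v) (h : ∀ j, M.Samples (v j) (D j)) :
    Impl κ M.prog v D :=
  of_bdd (PolyBdd.eval hv M.time) fun j => Runs.of_samples (h j)

/-- The second program is a family indexed by the pairs of an index and a possible intermediate
result, so that one polynomial serves all of them. That these results are short is deduced from the
first running time and handed over as a hypothesis. -/
theorem seq {α : J → Type} {D : ∀ j, PMF (α j)} {φ : ∀ j, α j → Val} {E : ∀ j, α j → PMF Val}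
    (hf : Impl κ f v fun j => (D j).map (φ j))
    (hg : PolySized (J := Σ j, {a // a ∈ (D j).support}) (fun x => κ x.1) (fun x => φ x.1 x.2) →
      Impl (J := Σ j, {a // a ∈ (D j).support}) (fun x => κ x.1) g (fun x => φ x.1 x.2)
        fun x => E x.1 x.2) : Impl κ (f.seq g) v fun j => (D j).bind (E j) := by
  obtain ⟨t, ht⟩ := hg (hf.sized_out Sigma.fst fun x =>
    (PMF.mem_support_map_iff _ _ _).2 ⟨x.2.1, x.2.2, rfl⟩)
  obtain ⟨s, hs⟩ := hf
  exact of_bdd (PolyBdd.add ⟨s, fun _ => le_rfl⟩ ⟨t, fun _ => le_rfl⟩) fun j =>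
    (hs j).seq fun a ha => ht ⟨j, a, ha⟩

theorem seqDet (hf : Impl κ f v fun j => PMF.pure (w j)) (hg : Impl κ g w D) :
    Impl κ (f.seq g) v D :=
  let ⟨s, hs⟩ := hf
  let ⟨t, ht⟩ := hg
  of_bdd (PolyBdd.add ⟨s, fun _ => le_rfl⟩ ⟨t, fun _ => le_rfl⟩) fun j => by
    have := Runs.seq (D := PMF.pure ()) (φ := fun _ => w j) (g := g) (E := fun _ => D j)
      (by simpa [PMF.pure_map] using hs j) fun _ _ => ht j
    rwa [PMF.pure_bind] at this

theorem straightSeq (hf : f.Straight = true) (hv : PolySized κ v)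
    (hg : Impl κ g (fun j => f.denote (v j)) D) : Impl κ (f.seq g) v D :=
  (straight hf hv fun _ => rfl).seqDet hg

theorem fork (hf : Impl κ f v fun j => PMF.pure (w j)) {D : J → PMF Val} (hg : Impl κ g v D) :
    Impl κ (f.fork g) v fun j => (D j).map (Val.pair (w j)) := by
  have hv := hf.sized
  obtain ⟨s, hs⟩ := hf
  obtain ⟨t, ht⟩ := hg
  refine of_bdd (T := fun j => (v j).size + 1 + s.eval (κ j) + t.eval (κ j))
    (((PolyBdd.add hv (.const 1)).add ⟨s, fun _ => le_rfl⟩).add ⟨t, fun _ => le_rfl⟩) fun j => ?_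
  simpa [PMF.pure_bind] using (hs j).fork (ht j)

theorem forkDet (hf : Impl κ f v fun j => PMF.pure (w j))
    (hg : Impl κ g v fun j => PMF.pure (u j)) :
    Impl κ (f.fork g) v fun j => PMF.pure (.pair (w j) (u j)) := by
  simpa [PMF.pure_map] using hf.fork hg

/-- Each branch needs a time bound only on the subfamily of inputs that reach it. -/
theorem cond (hb : Impl κ b v fun j => PMF.pure (w j))
    (hf : Impl (J := {j // w j ≠ .nat 0}) (fun j => κ j) f (fun j => v j) fun j => D j)
    (hg : Impl (J := {j // w j = .nat 0}) (fun j => κ j) g (fun j => v j) fun j => D j) :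
    Impl κ (b.cond f g) v D := by
  have hv := hb.sized
  obtain ⟨r, hr⟩ := hb
  obtain ⟨s, hs⟩ := hf
  obtain ⟨t, ht⟩ := hg
  refine of_bdd (T := fun j => (v j).size + 1 + r.eval (κ j) + (s.eval (κ j) + t.eval (κ j)))
    (((PolyBdd.add hv (.const 1)).add ⟨r, fun _ => le_rfl⟩).add
      (.add ⟨s, fun _ => le_rfl⟩ ⟨t, fun _ => le_rfl⟩)) fun j => ?_
  exact (hr j).cond (fun h => (hs ⟨j, h⟩).mono (Nat.le_add_right _ _))
    fun h => (ht ⟨j, h⟩).mono (Nat.le_add_left _ _)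

theorem ite {c : J → Prop} (hb : b.Straight = true) (hv : PolySized κ v)
    (hc : ∀ j, b.denote (v j) = .nat 0 ↔ ¬ c j)
    (hf : Impl (J := {j // c j}) (fun j => κ j) f (fun j => v j) fun j => D j)
    (hg : Impl (J := {j // ¬ c j}) (fun j => κ j) g (fun j => v j) fun j => D j) :
    Impl κ (b.cond f g) v D := by
  refine cond (straight hb hv fun _ => rfl) ?_ ?_
  · obtain ⟨t, ht⟩ := hf
    exact ⟨t, fun j => ht ⟨j.1, by_contra fun h => j.2 ((hc j).2 h)⟩⟩
  · obtain ⟨t, ht⟩ := hg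
    exact ⟨t, fun j => ht ⟨j.1, (hc j).1 j.2⟩⟩

theorem rand {m : J → ℕ} (hm : PolySized κ fun j => .nat (m j)) :
    Impl κ .rand (fun j => .nat (m j)) fun j => (unif (m j)).map .nat := by
  refine of_bdd (T := fun j => ((Val.nat (m j)).size + (Val.nat (m j)).size) ^ 2)
    ((PolyBdd.add hm hm).pow 2) fun j => ?_
  refine Runs.rand (m j) fun r hr => ?_
  have : r ≤ m j := by
    have := (mem_support_unif _ _).1 hr
    omega
  unfold charge
  have : (Val.nat r).size ≤ (Val.nat (m j)).size := by
    simpa [Val.size] using Nat.size_le_size this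
  gcongr

theorem congr {v' : J → Val} {D' : J → PMF Val} (h : Impl κ P v D) (hv : ∀ j, v' j = v j)
    (hD : ∀ j, D' j = D j) : Impl κ P v' D' := by
  rw [funext hv, funext hD]
  exact h

theorem loop {σ : J → Type} (enc : ∀ j, σ j → Val) (test : ∀ j, σ j → Bool)
    (step : ∀ j, σ j → PMF (σ j)) (Inv : ∀ j, ℕ → σ j → Prop) (N : J → ℕ) (hN : PolyBdd κ N)
    (T : ∀ j, σ j → Val) (hT : ∀ j s, T j s = .nat 0 ↔ test j s = false)
    (htest : Impl (J := Σ j, {x : ℕ × σ j // x.1 ≤ N j ∧ Inv j x.1 x.2}) (fun x => κ x.1) b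
      (fun x => enc x.1 x.2.1.2) fun x => PMF.pure (T x.1 x.2.1.2))
    (hbody : Impl (J := Σ j, {x : ℕ × σ j // x.1 ≤ N j ∧ Inv j x.1 x.2 ∧ test j x.2 = true})
      (fun x => κ x.1) f (fun x => enc x.1 x.2.1.2)
      fun x => (step x.1 x.2.1.2).map (enc x.1))
    (hstep : ∀ j k s, k ≤ N j → Inv j k s → test j s = true →
      0 < k ∧ ∀ s' ∈ (step j s).support, Inv j (k - 1) s')
    (s : ∀ j, σ j) (hs : ∀ j, Inv j (N j) (s j)) :
    Impl κ (b.loop f) (fun j => enc j (s j))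
      fun j => (iterWhile (test j) (step j) (N j) (s j)).map (enc j) := by
  obtain ⟨t₁, h₁⟩ := htest
  obtain ⟨t₂, h₂⟩ := hbody
  refine of_bdd (T := fun j => (N j + 1) * (2 * t₁.eval (κ j) + t₂.eval (κ j) + 1))
    ((hN.add (.const 1)).mul ((((PolyBdd.const 2).mul ⟨t₁, fun _ => le_rfl⟩).add
      ⟨t₂, fun _ => le_rfl⟩).add (.const 1))) fun j => ?_
  exact Runs.loop (enc j) (test j) (step j) (Inv j)
    (fun k hk s hs => ⟨T j s, h₁ ⟨j, (k, s), hk, hs⟩, hT j s⟩)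
    (fun k hk s hs ht => h₂ ⟨j, (k, s), hk, hs, ht⟩)
    (fun k hk s hs ht => hstep j k s hk hs ht) (N j) le_rfl (s j) (hs j)

end Impl

/-- `v ↦ post (v, P (pre v))`. -/
def Prog.call (pre P post : Prog) : Prog := .seq (.fork (.instr .id) (.seq pre P)) post

namespace Impl

variable {J : Type} {κ : J → ℕ} {P pre post : Prog} {v w u : J → Val}

/-- The old store survives as the first component of the new one. After several calls the earlier
data are found by taking first components repeatedly. -/
theorem call {α : J → Type} {D : ∀ j, PMF (α j)} {φ : ∀ j, α j → Val} {E : ∀ j, α j → PMF Val}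
    (hpre : pre.Straight = true) (hv : PolySized κ v) (hw : ∀ j, pre.denote (v j) = w j)
    (hP : Impl κ P w fun j => (D j).map (φ j))
    (hpost : PolySized (J := Σ j, {a // a ∈ (D j).support}) (fun x => κ x.1)
        (fun x => .pair (v x.1) (φ x.1 x.2)) →
      Impl (J := Σ j, {a // a ∈ (D j).support}) (fun x => κ x.1) post
        (fun x => .pair (v x.1) (φ x.1 x.2)) fun x => E x.1 x.2) :
    Impl κ (Prog.call pre P post) v fun j => (D j).bind (E j) := by
  refine Impl.seq (φ := fun j a => .pair (v j) (φ j a)) ?_ hpost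
  have := (straight (P := .instr .id) rfl hv (fun _ => rfl)).fork
    ((straight hpre hv hw).seqDet hP)
  simpa [PMF.map_comp, Function.comp_def, Prog.denote, Instr.apply] using this

theorem callDet {D : J → PMF Val} (hpre : pre.Straight = true) (hv : PolySized κ v)
    (hw : ∀ j, pre.denote (v j) = w j) (hP : Impl κ P w fun j => PMF.pure (u j))
    (hpost : PolySized κ (fun j => .pair (v j) (u j)) →
      Impl κ post (fun j => .pair (v j) (u j)) D) : Impl κ (Prog.call pre P post) v D :=
  ((straight (P := .instr .id) rfl hv (fun _ => rfl)).forkDet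
    ((straight hpre hv hw).seqDet hP)).seqDet (hpost (hv.pair hP.sized_pure))

end Impl

/-! ## Expectations -/

namespace PMF

variable {α β : Type}

/-- The expectation of a nonnegative function. -/
noncomputable def expect (D : PMF α) (f : α → ℝ≥0∞) : ℝ≥0∞ := ∑' a, D a * f a

theorem expect_pure (a : α) (f : α → ℝ≥0∞) : (PMF.pure a).expect f = f a := by
  unfold expect
  rw [tsum_eq_single a fun b hb => by simp [PMF.pure_apply, hb]]
  simp [PMF.pure_apply]

theorem expect_bind (D : PMF α) (K : α → PMF β) (f : β → ℝ≥0∞) :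
    (D.bind K).expect f = D.expect fun a => (K a).expect f := by
  simp only [expect, PMF.bind_apply, ← ENNReal.tsum_mul_right, ← ENNReal.tsum_mul_left]
  rw [ENNReal.tsum_comm]
  simp only [mul_assoc]

theorem expect_map (D : PMF α) (g : α → β) (f : β → ℝ≥0∞) :
    (D.map g).expect f = D.expect fun a => f (g a) := by
  rw [PMF.map, expect_bind]
  simp only [Function.comp_apply, expect_pure]

theorem expect_mono {D : PMF α} {f g : α → ℝ≥0∞} (h : ∀ a ∈ D.support, f a ≤ g a) :
    D.expect f ≤ D.expect g := by
  refine ENNReal.tsum_le_tsum fun a => ?_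
  by_cases ha : a ∈ D.support
  · exact mul_le_mul_right (h a ha) _
  · rw [(PMF.apply_eq_zero_iff D a).2 ha, zero_mul, zero_mul]

theorem expect_congr {D : PMF α} {f g : α → ℝ≥0∞} (h : ∀ a ∈ D.support, f a = g a) :
    D.expect f = D.expect g :=
  le_antisymm (expect_mono fun a ha => (h a ha).le) (expect_mono fun a ha => (h a ha).ge)

theorem expect_add (D : PMF α) (f g : α → ℝ≥0∞) :
    (D.expect fun a => f a + g a) = D.expect f + D.expect g := by
  simp only [expect, mul_add, ENNReal.tsum_add]

theorem expect_const_mul (D : PMF α) (c : ℝ≥0∞) (f : α → ℝ≥0∞) :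
    (D.expect fun a => c * f a) = c * D.expect f := by
  simp only [expect, ← ENNReal.tsum_mul_left]
  exact tsum_congr fun a => by ring

theorem expect_const (D : PMF α) (c : ℝ≥0∞) : (D.expect fun _ => c) = c := by
  simp only [expect, ENNReal.tsum_mul_right, PMF.tsum_coe, one_mul]

theorem expect_le_expect_add {D : PMF α} {f g : α → ℝ≥0∞} {c : ℝ≥0∞}
    (h : ∀ a ∈ D.support, f a ≤ g a + c) : D.expect f ≤ D.expect g + c := by
  rw [← expect_const D c, ← expect_add]
  exact expect_mono h

theorem expect_le_one {D : PMF α} {f : α → ℝ≥0∞} (h : ∀ a ∈ D.support, f a ≤ 1) :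
    D.expect f ≤ 1 :=
  (expect_mono h).trans (D.expect_const 1).le

theorem expect_sum {ι : Type} (D : PMF α) (s : Finset ι) (f : ι → α → ℝ≥0∞) :
    (D.expect fun a => ∑ i ∈ s, f i a) = ∑ i ∈ s, D.expect (f i) := by
  simp only [expect, Finset.mul_sum]
  exact Summable.tsum_finsetSum fun _ _ => ENNReal.summable

/-- Jensen's inequality: `2 f(a) f(b) ≤ f(a)² + f(b)²` is averaged over two independent samples. No
subtraction occurs, so infinite values do no harm. -/
theorem sq_expect_le (D : PMF α) (f : α → ℝ≥0∞) :
    D.expect f ^ 2 ≤ D.expect fun a => f a ^ 2 := by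
  have h2 : ∀ a b : ℝ≥0∞, 2 * (a * b) ≤ a ^ 2 + b ^ 2 := by
    intro a b
    rcases le_total a b with h | h
    all_goals
      obtain ⟨c, rfl⟩ := exists_add_of_le h
      calc _ ≤ _ + c ^ 2 := le_self_add
        _ = _ := by ring
  have key : 2 * D.expect f ^ 2 ≤ 2 * D.expect fun a => f a ^ 2 := by
    calc 2 * D.expect f ^ 2 = D.expect fun a => D.expect fun b => 2 * (f a * f b) := by
          rw [sq, ← expect_const_mul, ← expect_const_mul]
          refine expect_congr fun a _ => ?_
          rw [expect_const_mul, expect_const_mul]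
          ring
      _ ≤ D.expect fun a => D.expect fun b => f a ^ 2 + f b ^ 2 :=
          expect_mono fun a _ => expect_mono fun b _ => h2 _ _
      _ = 2 * D.expect fun a => f a ^ 2 := by
          simp only [expect_add, expect_const]
          rw [two_mul]
  exact (ENNReal.mul_le_mul_iff_right two_ne_zero ENNReal.ofNat_ne_top).1 key

theorem expect_unif {p : ℕ} (hp : 0 < p) (f : ℕ → ℝ≥0∞) :
    (unif p).expect f = (p : ℝ≥0∞)⁻¹ * ∑ b ∈ Finset.range p, f b := by
  have hu : ∀ r, unif p r = if r ∈ Finset.range p then (p : ℝ≥0∞)⁻¹ else 0 := fun r => by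
    have h : p - 1 + 1 = p := by omega
    refine (PMF.uniformOfFinset_apply _ r).trans ?_
    rw [h, Finset.card_range]
    congr
  unfold expect
  rw [tsum_eq_sum (s := Finset.range p) fun b hb => by rw [hu, if_neg hb, zero_mul], Finset.mul_sum]
  exact Finset.sum_congr rfl fun b hb => by rw [hu, if_pos hb]

/-- The quadratic inequality of the forking lemma is preserved by mixtures. -/
theorem sq_expect_bind_le {D : PMF α} {K : α → PMF β} {f g : β → ℝ≥0∞} {c : ℝ≥0∞}
    (h : ∀ a ∈ D.support, (K a).expect f ^ 2 ≤ (K a).expect g + c * (K a).expect f) :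
    (D.bind K).expect f ^ 2 ≤ (D.bind K).expect g + c * (D.bind K).expect f := by
  simp only [expect_bind]
  refine (sq_expect_le _ _).trans ((expect_mono h).trans ?_)
  rw [expect_add, expect_const_mul]

end PMF

theorem prob_eq_expect {α : Type} (D : PMF α) (E : Set α) [DecidablePred (· ∈ E)] :
    prob D E = (D.expect fun a => if a ∈ E then 1 else 0).toReal := by
  rw [prob, PMF.toOuterMeasure_apply, PMF.expect]
  congr 1
  refine tsum_congr fun a => ?_
  by_cases h : a ∈ E <;> simp [h]

/-! ## Simulated attacks -/

/-- The first component of a pair, as computed by the elementary instruction. -/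
def Val.fst (v : Val) : Val := Instr.fst.apply v

/-- The second component of a pair, as computed by the elementary instruction. -/
def Val.snd (v : Val) : Val := Instr.snd.apply v

/-- An entry of the list representing the random oracle: the point `y`, the value `β`, whether the value
was sampled because of a random oracle query, and the state of the adversary at this query. -/
structure Entry where
  y : Val
  β : ℕ
  hsh : Bool
  st : Val

/-- The part of a list of entries starting with the entry for `y`. -/
def lookup : List Entry → Val → List Entry
  | [], _ => []
  | e :: L, y => if e.y = y then e :: L else lookup L y

theorem lookup_suffix (L : List Entry) (y : Val) : lookup L y <:+ L := by
  induction L with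
  | nil => exact List.suffix_rfl
  | cons e L ih =>
    unfold lookup
    split_ifs
    exacts [List.suffix_rfl, ih.trans (List.suffix_cons e L)]

theorem y_eq_of_lookup {L L' : List Entry} {y : Val} {e : Entry} (h : lookup L y = e :: L') :
    e.y = y := by
  induction L with
  | nil => simp [lookup] at h
  | cons e L ih =>
    unfold lookup at h
    split_ifs at h with hy
    · obtain ⟨rfl, rfl⟩ := List.cons.inj h
      exact hy
    · exact ih h

/-- The number of entries caused by random oracle queries. -/
def hashCount (L : List Entry) : ℕ := L.countP fun e => e.hsh

theorem hashCount_le_of_suffix {L L' : List Entry} (h : L <:+ L') : hashCount L ≤ hashCount L' :=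
  h.sublist.countP_le

theorem hashCount_cons (e : Entry) (L : List Entry) :
    hashCount (e :: L) = hashCount L + if e.hsh then 1 else 0 := by
  simp [hashCount, List.countP_cons]

/-- Suffixes of one list are nested, and a strictly longer one has the whole shorter one, including
its hash entry, in its tail. So the number of earlier hash entries identifies a hash query. -/
theorem suffix_unique {L t₁ t₂ : List Entry} {e₁ e₂ : Entry} (h₁ : e₁ :: t₁ <:+ L)
    (h₂ : e₂ :: t₂ <:+ L) (he₁ : e₁.hsh = true) (he₂ : e₂.hsh = true)
    (h : hashCount t₁ = hashCount t₂) : e₁ :: t₁ = e₂ :: t₂ := by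
  rcases List.suffix_or_suffix_of_suffix h₁ h₂ with h' | h'
  · rcases List.suffix_cons_iff.1 h' with h' | h'
    · exact h'
    · have := hashCount_le_of_suffix h'
      simp [hashCount_cons, he₁] at this
      omega
  · rcases List.suffix_cons_iff.1 h' with h' | h'
    · exact h'.symm
    · have := hashCount_le_of_suffix h'
      simp [hashCount_cons, he₂] at this
      omega

/-- State of a simulated attack: whether the adversary is still running, its next input (or its final
output), and the random oracle. -/
structure SimState where
  run : Bool
  msg : Val
  L : List Entry

/-- Data of a simulated attack: the adversary `prog` (with iteration limit `n`), the range `p` of the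
random oracle, the error distribution, and for an error `x` the sketch `ct x` in a simulated signature
and the point `point x M β z` at which the random oracle is programmed; `target out` is the point at which
the random oracle is queried when the forgery `out` is verified. -/
structure Simulation where
  prog : Prog
  n : ℕ
  p : ℕ
  X : Type
  err : PMF X
  ct : X → Val
  point : X → Val → ℕ → ℕ → Val
  target : Val → Val

/-- The hash value contained in a forgery `(M, (β, (z, c)))`. -/
def forgedHash (out : Val) : ℕ := out.snd.fst.toNat

namespace Simulation

variable (S : Simulation)

/-- Simulated answer to the query `q` of an adversary in state `st`. The simulation is stopped when the
random oracle cannot be programmed. -/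
noncomputable def answer (q st : Val) (L : List Entry) : PMF SimState :=
  match q with
  | .pair (.nat 0) y =>
    match lookup L y with
    | e :: _ => PMF.pure ⟨true, .pair st (.nat e.β), L⟩
    | [] => (unif S.p).bind fun b => PMF.pure ⟨true, .pair st (.nat b), ⟨y, b, true, st⟩ :: L⟩
  | .pair (.nat 1) M =>
    S.err.bind fun e => (unif S.p).bind fun β => (unif S.p).bind fun z =>
      match lookup L (S.point e M β z) with
      | _ :: _ => PMF.pure ⟨false, .nat 0, L⟩
      | [] => PMF.pure ⟨true, .pair st (.pair (.nat β) (.pair (.nat z) (S.ct e))),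
          ⟨S.point e M β z, β, false, .nat 0⟩ :: L⟩
  | _ => PMF.pure ⟨true, .pair st (.nat 0), L⟩

/-- Reaction of the simulation to the result of an activation of the adversary. -/
noncomputable def react (r : Val) (L : List Entry) : PMF SimState :=
  match r with
  | .pair (.nat 1) (.pair q st) => S.answer q st L
  | r => PMF.pure ⟨false, r.snd, L⟩

/-- One activation of the adversary. -/
noncomputable def step (s : SimState) : PMF SimState :=
  (S.prog.exec S.n s.msg).bind fun r => S.react r.1 s.L

/-- The simulated attack, with at most the given number of activations. -/
noncomputable def exec : ℕ → SimState → PMF SimState := iterWhile SimState.run S.step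

/-- The attack is taken back to the point where the random oracle was queried at the target of the
forgery, and the answer is changed to `b`. -/
def rewind (s : SimState) (b : ℕ) : SimState :=
  match lookup s.L (S.target s.msg) with
  | e :: L => ⟨e.hsh, .pair e.st (.nat b), ⟨S.target s.msg, b, true, e.st⟩ :: L⟩
  | [] => ⟨false, .pair (.nat 0) (.nat b), [⟨S.target s.msg, b, true, .nat 0⟩]⟩

/-- The final state contains a forgery whose target is the fresh random oracle query number `i`. -/
def Accepts (i : ℕ) (s : SimState) : Prop :=
  s.run = false ∧ ∃ e L, lookup s.L (S.target s.msg) = e :: L ∧ e.hsh = true ∧ hashCount L = i ∧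
    e.β = forgedHash s.msg ∧ e.β < S.p

theorem Accepts.index_unique {S : Simulation} {i j : ℕ} {s : SimState} (hi : S.Accepts i s)
    (hj : S.Accepts j s) : i = j := by
  obtain ⟨-, e, L, h, -, rfl, -⟩ := hi
  obtain ⟨-, e', L', h', -, rfl, -⟩ := hj
  rw [h] at h'
  rw [(List.cons.inj h').2]

open Classical in
/-- Indicator function of `Accepts`. -/
noncomputable def acc (i : ℕ) (s : SimState) : ℝ≥0∞ := if S.Accepts i s then 1 else 0

theorem acc_le_one (i : ℕ) (s : SimState) : S.acc i s ≤ 1 := by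
  unfold acc; split_ifs <;> simp

theorem sum_acc_le_one (t : Finset ℕ) (s : SimState) : ∑ i ∈ t, S.acc i s ≤ 1 := by
  classical
  by_cases h : ∃ i, S.Accepts i s
  · obtain ⟨i, hi⟩ := h
    calc ∑ j ∈ t, S.acc j s ≤ ∑ j ∈ t, if j = i then 1 else 0 := by
          refine Finset.sum_le_sum fun j _ => ?_
          unfold acc
          split_ifs with h1 h2 <;> simp
          exact h2 (h1.index_unique hi)
      _ ≤ 1 := by rw [Finset.sum_ite_eq']; split_ifs <;> simp
  · rw [Finset.sum_eq_zero]
    · simp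
    · intro j _
      exact if_neg fun hj => h ⟨j, hj⟩

theorem exec_succ {s : SimState} (hs : s.run = true) (k : ℕ) :
    S.exec (k + 1) s = (S.prog.exec S.n s.msg).bind fun r => (S.react r.1 s.L).bind (S.exec k) := by
  simp only [exec, iterWhile, hs, if_true, step, PMF.bind_bind]

theorem exec_of_not_run {s : SimState} (hs : s.run = false) (k : ℕ) :
    S.exec k s = PMF.pure s := iterWhile_of_not hs k

theorem exec_zero (s : SimState) : S.exec 0 s = PMF.pure s := rfl

/-- More activations only continue the runs that are unfinished, and these contribute nothing to
`f`. Consequently a rerun may be given the full number of activations instead of the number left at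
the rewound query. -/
theorem expect_exec_mono {f : SimState → ℝ≥0∞} (hf : ∀ s, s.run = true → f s = 0) {k m : ℕ}
    (hkm : k ≤ m) (s : SimState) : (S.exec k s).expect f ≤ (S.exec m s).expect f := by
  induction k generalizing m s with
  | zero =>
    cases hs : s.run with
    | true => rw [exec_zero, PMF.expect_pure, hf s hs]; exact zero_le
    | false => rw [exec_of_not_run _ hs, exec_of_not_run _ hs]
  | succ k ih =>
    obtain ⟨m, rfl⟩ : ∃ m', m = m' + 1 := ⟨m - 1, by omega⟩
    cases hs : s.run with
    | true =>
      rw [exec_succ _ hs, exec_succ _ hs]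
      simp only [PMF.expect_bind]
      exact PMF.expect_mono fun r _ => PMF.expect_mono fun s' _ => ih (by omega) s'
    | false => rw [exec_of_not_run _ hs, exec_of_not_run _ hs]

theorem acc_of_run (i : ℕ) {s : SimState} (hs : s.run = true) : S.acc i s = 0 :=
  if_neg fun h => by simp [h.1] at hs

/-- An answer extends the list of entries; it extends it by an entry caused by a random oracle query only
if it answers a fresh random oracle query. -/
theorem answer_cases {q st : Val} {L : List Entry} {s : SimState}
    (hs : s ∈ (S.answer q st L).support) :
    L <:+ s.L ∧ (hashCount s.L ≤ hashCount L ∨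
      hashCount s.L = hashCount L + 1 ∧ ∃ y, q = .pair (.nat 0) y ∧ lookup L y = []) := by
  unfold answer at hs
  split at hs
  · split at hs
    · simp only [PMF.support_pure, Set.mem_singleton_iff] at hs
      subst hs
      exact ⟨List.suffix_rfl, .inl le_rfl⟩
    · rename_i y _ h
      simp only [PMF.mem_support_bind_iff, PMF.support_pure, Set.mem_singleton_iff] at hs
      obtain ⟨b, -, rfl⟩ := hs
      exact ⟨List.suffix_cons _ _, .inr ⟨by simp [hashCount_cons], y, rfl, h⟩⟩
  · simp only [PMF.mem_support_bind_iff] at hs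
    obtain ⟨e, -, β, -, z, -, hs⟩ := hs
    split at hs <;> simp only [PMF.support_pure, Set.mem_singleton_iff] at hs <;> subst hs
    · exact ⟨List.suffix_rfl, .inl le_rfl⟩
    · exact ⟨List.suffix_cons _ _, .inl (by simp [hashCount_cons])⟩
  · simp only [PMF.support_pure, Set.mem_singleton_iff] at hs
    subst hs
    exact ⟨List.suffix_rfl, .inl le_rfl⟩

theorem react_eq (r : Val) (L : List Entry) :
    (∃ q st, r = .pair (.nat 1) (.pair q st) ∧ S.react r L = S.answer q st L) ∨
      (∀ q st, r ≠ .pair (.nat 1) (.pair q st)) ∧ S.react r L = PMF.pure ⟨false, r.snd, L⟩ := by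
  unfold react
  split
  · exact .inl ⟨_, _, rfl, rfl⟩
  · rename_i h
    exact .inr ⟨h, rfl⟩

theorem react_suffix {r : Val} {L : List Entry} {s : SimState}
    (hs : s ∈ (S.react r L).support) : L <:+ s.L := by
  rcases S.react_eq r L with ⟨q, st, -, h⟩ | ⟨-, h⟩ <;> rw [h] at hs
  · exact (S.answer_cases hs).1
  · simp only [PMF.support_pure, Set.mem_singleton_iff] at hs
    subst hs
    exact List.suffix_rfl

theorem exec_suffix {k : ℕ} {s s' : SimState} (hs : s' ∈ (S.exec k s).support) : s.L <:+ s'.L := by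
  induction k generalizing s with
  | zero =>
    simp only [exec_zero, PMF.support_pure, Set.mem_singleton_iff] at hs
    subst hs
    exact List.suffix_rfl
  | succ k ih =>
    cases hr : s.run with
    | true =>
      rw [exec_succ _ hr] at hs
      simp only [PMF.mem_support_bind_iff] at hs
      obtain ⟨r, -, s₁, hs₁, hs⟩ := hs
      exact (S.react_suffix hs₁).trans (ih hs)
    | false =>
      rw [exec_of_not_run _ hr] at hs
      simp only [PMF.support_pure, Set.mem_singleton_iff] at hs
      subst hs
      exact List.suffix_rfl

/-! ### The forking lemma -/

section Forking

open Classical in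
/-- Probability that after a first run ending in `s` the rerun ends in a good state. -/
noncomputable def rerun (good : SimState → SimState → Prop) (s : SimState) : ℝ≥0∞ :=
  (unif S.p).expect fun b => (S.exec S.n (S.rewind s b)).expect fun s' =>
    if good s s' then 1 else 0

variable {S} {good : SimState → SimState → Prop} (hp : 0 < S.p)
  (hgood : ∀ s s', S.target s.msg = S.target s'.msg → forgedHash s.msg ≠ forgedHash s'.msg →
    forgedHash s.msg < S.p → forgedHash s'.msg < S.p → good s s')

include hp hgood in
-- For an accepting run through the given query, the rewound state is exactly the state after this
-- query with a new answer. A rerun that accepts at the same query has the same target, and for `b'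
-- ≠ b` a different hash value; by `hgood` such pairs are good.
theorem le_rerun {y st : Val} {L : List Entry} {k b : ℕ} (hk : k ≤ S.n)
    {s : SimState} (hs : ⟨y, b, true, st⟩ :: L <:+ s.L) (hacc : S.Accepts (hashCount L) s) :
    (S.p : ℝ≥0∞)⁻¹ * ∑ b' ∈ (Finset.range S.p).erase b,
      (S.exec k ⟨true, .pair st (.nat b'), ⟨y, b', true, st⟩ :: L⟩).expect (S.acc (hashCount L)) ≤
    S.rerun good s := by
  obtain ⟨-, e, L', hlook, he, hc, heβ, hlt⟩ := hacc
  -- The entry of the target and the query under consideration are preceded by equally many hash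
  -- entries, so they coincide.
  have h1 : e :: L' = ⟨y, b, true, st⟩ :: L :=
    suffix_unique (hlook ▸ lookup_suffix _ _) hs he rfl hc
  have h2 := y_eq_of_lookup hlook
  obtain ⟨rfl, rfl⟩ := List.cons.inj h1
  simp only at h2 heβ hlt
  rw [rerun, PMF.expect_unif hp]
  gcongr
  refine (Finset.sum_le_sum fun b' hb' => ?_).trans
    (Finset.sum_le_sum_of_subset (Finset.erase_subset b _))
  have h3 : S.rewind s b' = ⟨true, .pair st (.nat b'), ⟨y, b', true, st⟩ :: L'⟩ := by
    simp only [rewind, hlook]; rw [← h2]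
  rw [h3]
  -- `k` activations were left at the query, whereas the rerun is allowed `S.n`.
  refine (S.expect_exec_mono (fun s hs => S.acc_of_run _ hs) hk _).trans
    (PMF.expect_mono fun s' hs' => ?_)
  unfold acc
  split_ifs with ha hg
  · exact le_rfl
  · exfalso
    obtain ⟨-, e, L'', hlook', he', hc', heβ', hlt'⟩ := ha
    have h4 : e :: L'' = ⟨y, b', true, st⟩ :: L' :=
      suffix_unique (hlook' ▸ lookup_suffix _ _) (S.exec_suffix hs') he' rfl hc'
    obtain ⟨rfl, rfl⟩ := List.cons.inj h4
    have h5 := y_eq_of_lookup hlook'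
    simp only at h5 heβ' hlt'
    refine hg (hgood s s' (h2.symm.trans h5) ?_ (heβ ▸ hlt) (heβ' ▸ hlt'))
    rw [← heβ, ← heβ']
    exact (Finset.ne_of_mem_erase hb').symm
  · exact zero_le
  · exact le_rfl

include hp hgood in
/-- The forking inequality at a fresh random oracle query. -/
theorem sq_expect_fresh_le {y st : Val} {L : List Entry} {k : ℕ} (hk : k ≤ S.n) :
    (((unif S.p).bind fun b => PMF.pure
      (⟨true, .pair st (.nat b), ⟨y, b, true, st⟩ :: L⟩ : SimState)).bind (S.exec k)).expect
        (S.acc (hashCount L)) ^ 2 ≤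
    (((unif S.p).bind fun b => PMF.pure
      (⟨true, .pair st (.nat b), ⟨y, b, true, st⟩ :: L⟩ : SimState)).bind (S.exec k)).expect
        (fun s => S.acc (hashCount L) s * S.rerun good s) +
    (S.p : ℝ≥0∞)⁻¹ * (((unif S.p).bind fun b => PMF.pure
      (⟨true, .pair st (.nat b), ⟨y, b, true, st⟩ :: L⟩ : SimState)).bind (S.exec k)).expect
        (S.acc (hashCount L)) := by
  simp only [PMF.bind_bind, PMF.pure_bind, PMF.expect_bind, PMF.expect_unif hp]
  set x : ℕ → ℝ≥0∞ := fun b =>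
    (S.exec k ⟨true, .pair st (.nat b), ⟨y, b, true, st⟩ :: L⟩).expect (S.acc (hashCount L)) with hx
  have hx1 : ∀ b, x b ≤ 1 := fun b => PMF.expect_le_one fun s _ => S.acc_le_one _ _
  set c : ℝ≥0∞ := (S.p : ℝ≥0∞)⁻¹
  have h1 : ∀ b, x b * (c * ∑ b' ∈ (Finset.range S.p).erase b, x b') ≤
      (S.exec k ⟨true, .pair st (.nat b), ⟨y, b, true, st⟩ :: L⟩).expect
        (fun s => S.acc (hashCount L) s * S.rerun good s) := by
    intro b
    rw [mul_comm, hx, ← PMF.expect_const_mul]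
    refine PMF.expect_mono fun s hs => ?_
    by_cases ha : S.Accepts (hashCount L) s
    · rw [mul_comm]
      gcongr
      exact le_rerun hp hgood hk (S.exec_suffix hs) ha
    · simp [acc, ha]
  calc (c * ∑ b ∈ Finset.range S.p, x b) ^ 2
      = c * ∑ b ∈ Finset.range S.p, x b * (c * ∑ b' ∈ Finset.range S.p, x b') := by
        rw [← Finset.sum_mul]; ring
    _ ≤ c * ∑ b ∈ Finset.range S.p,
          (x b * (c * ∑ b' ∈ (Finset.range S.p).erase b, x b') + c * x b) := by
        refine mul_le_mul_right (Finset.sum_le_sum fun b hb => ?_) _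
        -- The term `b' = b`, in which both runs get the same answer, is split off. It is at most `x
        -- b / p` and yields the last summand of the claim.
        rw [← Finset.add_sum_erase _ _ hb, mul_add, mul_add, add_comm]
        refine add_le_add_right ?_ _
        calc x b * (c * x b) ≤ 1 * (c * x b) := mul_le_mul_left (hx1 b) _
          _ = c * x b := one_mul _
    _ ≤ _ := by
        rw [Finset.sum_add_distrib, mul_add, ← Finset.mul_sum]
        gcongr with b hb
        exact h1 b

include hp hgood in
-- Up to the fresh query number `i` the run is a mixture, and mixtures preserve the inequality. At
-- this query `sq_expect_fresh_le` applies and the recursion ends. A run that stops earlier has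
-- acceptance `0`, since it has no hash entry with `i` hash entries before it.
theorem sq_expect_exec_le (i k : ℕ) (hk : k ≤ S.n) (s : SimState) (hs : hashCount s.L ≤ i) :
    (S.exec k s).expect (S.acc i) ^ 2 ≤
      (S.exec k s).expect (fun s => S.acc i s * S.rerun good s) +
        (S.p : ℝ≥0∞)⁻¹ * (S.exec k s).expect (S.acc i) := by
  have hacc0 : ∀ s : SimState, hashCount s.L ≤ i → S.acc i s = 0 := by
    intro s hs
    refine if_neg fun h => ?_
    obtain ⟨-, e, L, hlook, he, hc, -⟩ := h
    have := hashCount_le_of_suffix (hlook ▸ lookup_suffix s.L _)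
    simp only [hashCount_cons, he, if_true] at this
    omega
  induction k generalizing s with
  | zero => simp [exec_zero, PMF.expect_pure, hacc0 s hs]
  | succ k ih =>
    cases hr : s.run with
    | false => simp [exec_of_not_run _ hr, PMF.expect_pure, hacc0 s hs]
    | true =>
      rw [exec_succ _ hr]
      refine PMF.sq_expect_bind_le fun r _ => ?_
      rcases S.react_eq r.1 s.L with ⟨q, st, -, h⟩ | ⟨-, h⟩ <;> rw [h]
      -- Only a fresh hash query raises the number of hash entries, so this is the only case in
      -- which the number passes from `i` to `i + 1`.
      · by_cases hc : ∃ y, q = .pair (.nat 0) y ∧ lookup s.L y = [] ∧ hashCount s.L = i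
        · obtain ⟨y, rfl, hy, rfl⟩ := hc
          have : S.answer (.pair (.nat 0) y) st s.L = (unif S.p).bind fun b =>
              PMF.pure ⟨true, .pair st (.nat b), ⟨y, b, true, st⟩ :: s.L⟩ := by
            simp only [answer, hy]
          rw [this]
          exact sq_expect_fresh_le hp hgood (by omega)
        · refine PMF.sq_expect_bind_le fun s' hs' => ih (by omega) s' ?_
          rcases (S.answer_cases hs').2 with h' | ⟨h', y, hq, hy⟩
          · omega
          · have : hashCount s.L ≠ i := fun h => hc ⟨y, hq, hy, h⟩
            omega
      · rw [PMF.pure_bind]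
        exact ih (by omega) _ hs

include hp hgood in
/-- The forking lemma: `∑ aᵢ² ≤ frk + (∑ aᵢ) / p`, where `aᵢ` is the probability of a forgery for the
fresh random oracle query number `i` and `frk` is the probability of a good pair of runs. -/
theorem sum_sq_expect_le (Q : ℕ) (msg : Val) :
    ∑ i ∈ Finset.range Q, (S.exec S.n ⟨true, msg, []⟩).expect (S.acc i) ^ 2 ≤
      (S.exec S.n ⟨true, msg, []⟩).expect (S.rerun good) +
        (S.p : ℝ≥0∞)⁻¹ *
          ∑ i ∈ Finset.range Q, (S.exec S.n ⟨true, msg, []⟩).expect (S.acc i) := by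
  refine (Finset.sum_le_sum fun i _ =>
    sq_expect_exec_le hp hgood i S.n le_rfl _ (Nat.zero_le _)).trans ?_
  rw [Finset.sum_add_distrib, Finset.mul_sum, ← PMF.expect_sum]
  gcongr
  -- A final state accepts for at most one `i`, so its rerun is counted at most once.
  refine PMF.expect_mono fun s _ => ?_
  rw [← Finset.sum_mul]
  exact mul_le_of_le_one_left zero_le (S.sum_acc_le_one _ s)

end Forking

end Simulation

/-! ## Powers of the generator -/

namespace GroupGen

variable {GG : GroupGen} {κ : ℕ} {d : Val}

theorem fact_prime (hd : d ∈ (GG.desc κ).support) : Fact (GG.order d).Prime :=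
  ⟨GG.prime_order κ d hd⟩

theorem orderOf_gen (hd : d ∈ (GG.desc κ).support) : orderOf (GG.gen d) = GG.order d := by
  rw [← GG.card_eq κ d hd]
  exact orderOf_eq_card_of_zpowers_eq_top (GG.gen_generates κ d hd)

theorem gen_pow_eq_iff (hd : d ∈ (GG.desc κ).support) {m n : ℕ} :
    GG.gen d ^ m = GG.gen d ^ n ↔ (m : ZMod (GG.order d)) = n := by
  rw [pow_eq_pow_iff_modEq, orderOf_gen hd, ZMod.natCast_eq_natCast_iff]

end GroupGen

section Schnorr

variable {F : ℕ → FuzzyKeySetting} (GG : GroupGen) (LS : LinearSketch F GG.orders)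

theorem hashInput_inj {d : Val} {h h' R R' : GG.G d} {M M' : Val}
    (heq : hashInput GG d h R M = hashInput GG d h' R' M') : h = h' ∧ R = R' ∧ M = M' := by
  simp only [hashInput, Val.pair.injEq] at heq
  exact ⟨GG.enc_injective d heq.1, GG.enc_injective d heq.2.1, heq.2.2⟩

/-- The point at which the random oracle is queried when a signature with values `β`, `z` on `M` is
verified; the proxy keys differ by `Δ`. -/
def schnorrPoint (d : Val) (h : GG.G d) (Δ β z : ℕ) (M : Val) : Val :=
  hashInput GG d (h * GG.gen d ^ Δ) (GG.gen d ^ z * ((h * GG.gen d ^ Δ) ^ β)⁻¹) M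

/-- The point at which the random oracle is queried when the forgery `out` is verified. -/
def schnorrTarget (κ : ℕ) (d pp : Val) (h : GG.G d) (c out : Val) : Val :=
  schnorrPoint GG d h (LS.diffRec κ (GG.order d) pp c out.snd.snd.snd).val (forgedHash out)
    out.snd.snd.fst.toNat out.fst

/-- The discrete logarithm computed from two signatures with the same point. -/
def extractLog (p Δ β z β' z' : ℕ) : ℕ :=
  ((z + (p - 1) * z') % p * ((β + (p - 1) * β') % p) ^ (p - 2) + (p - 1) * Δ) % p

variable {GG LS} in
-- The point contains the shifted key, so both signatures belong to the exponent `a + Δ` even if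
-- they come from different sketches. Equality of the commitments reads `z - (a + Δ) β = z' - (a +
-- Δ) β'`, which is solved for `a`. In `extractLog` the factor `p - 1` stands for `-1` and the
-- exponent `p - 2` for inversion.
theorem extractLog_eq {κ : ℕ} {d : Val} (hd : d ∈ (GG.desc κ).support) (a : ZMod (GG.order d))
    {Δ Δ' β z β' z' : ℕ} {M M' : Val} (hβ : β < GG.order d) (hβ' : β' < GG.order d) (hne : β ≠ β')
    (h : schnorrPoint GG d (GG.gen d ^ a.val) Δ β z M =
      schnorrPoint GG d (GG.gen d ^ a.val) Δ' β' z' M') :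
    extractLog (GG.order d) Δ β z β' z' = a.val := by
  have := GroupGen.fact_prime hd
  have hp := (GroupGen.fact_prime hd).out
  obtain ⟨h1, h2, -⟩ := hashInput_inj GG h
  rw [← h1, ← pow_add, ← pow_mul, ← pow_mul] at h2
  -- The equality of commitments with the inverses cleared, so that exponents can be compared modulo
  -- `p`.
  have h3 : GG.gen d ^ (z + (a.val + Δ) * β') = GG.gen d ^ (z' + (a.val + Δ) * β) := by
    have h4 : GG.gen d ^ ((a.val + Δ) * β) * GG.gen d ^ ((a.val + Δ) * β') =
        GG.gen d ^ ((a.val + Δ) * β') * GG.gen d ^ ((a.val + Δ) * β) := by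
      rw [← pow_add, ← pow_add, add_comm]
    rw [mul_inv_eq_iff_eq_mul] at h2
    rw [pow_add, pow_add, h2, mul_assoc, mul_assoc, h4, inv_mul_cancel_left]
  rw [GroupGen.gen_pow_eq_iff hd] at h3
  push_cast at h3
  rw [ZMod.natCast_rightInverse a] at h3
  have hp1 : ((GG.order d - 1 : ℕ) : ZMod (GG.order d)) = -1 := by
    rw [Nat.cast_sub hp.one_le]; simp
  have hx : (β : ZMod (GG.order d)) - β' ≠ 0 := by
    rw [sub_ne_zero]
    intro h5
    rw [ZMod.natCast_eq_natCast_iff] at h5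
    exact hne (Nat.ModEq.eq_of_lt_of_lt h5 hβ hβ')
  have h6 : ((β : ZMod (GG.order d)) - β') * (β - β') ^ (GG.order d - 2) = 1 := by
    rw [← pow_succ', show GG.order d - 2 + 1 = GG.order d - 1 by have := hp.two_le; omega]
    exact ZMod.pow_card_sub_one_eq_one hx
  have h7 : ((((z + (GG.order d - 1) * z') % GG.order d *
      ((β + (GG.order d - 1) * β') % GG.order d) ^ (GG.order d - 2) +
        (GG.order d - 1) * Δ : ℕ)) : ZMod (GG.order d)) = a := by
    push_cast
    simp only [ZMod.natCast_mod]
    push_cast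
    rw [hp1]
    calc _ = ((z : ZMod (GG.order d)) - z') * (β - β') ^ (GG.order d - 2) - Δ := by ring
      _ = (a + Δ) * (((β : ZMod (GG.order d)) - β') * (β - β') ^ (GG.order d - 2)) - Δ := by
          rw [show (z : ZMod (GG.order d)) - z' = (a + Δ) * (β - β') by linear_combination h3]
          ring
      _ = a := by rw [h6]; ring
  rw [extractLog, ← ZMod.val_natCast, h7]

variable {GG} in
-- The programmed point is the one that an honest signer with key `a + Δ` would hash with nonce `z -
-- β (a + Δ)`. This links simulated signatures to real ones.
theorem schnorrPoint_eq {κ : ℕ} {d : Val} (hd : d ∈ (GG.desc κ).support)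
    (a Δ : ZMod (GG.order d)) (β z : ℕ) (M : Val) :
    schnorrPoint GG d (GG.gen d ^ a.val) Δ.val β z M =
      hashInput GG d (GG.gen d ^ (a + Δ).val) 
        (GG.gen d ^ ((z : ZMod (GG.order d)) - β * (a + Δ)).val) M := by
  have := GroupGen.fact_prime hd
  have h1 : GG.gen d ^ a.val * GG.gen d ^ Δ.val = GG.gen d ^ (a + Δ).val := by
    rw [← pow_add, GroupGen.gen_pow_eq_iff hd]
    simp
  rw [schnorrPoint, h1]
  congr 1
  rw [mul_inv_eq_iff_eq_mul, ← pow_mul, ← pow_add, GroupGen.gen_pow_eq_iff hd]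
  push_cast
  simp only [ZMod.natCast_val, ZMod.cast_id', id_eq]
  ring

/-- The simulated attack of `A` on the scheme, for a fixed group, fixed sketch parameters and fixed fuzzy
data. -/
noncomputable def schnorrSim
    (mc : (κ p : ℕ) → (pp c : Val) → (F κ).X → Val × ZMod p) (A : Machine) (κ : ℕ) (d pp : Val)
    (x : (F κ).X) : Simulation where
  prog := A.prog
  n := A.time.eval κ
  p := GG.order d
  X := (F κ).X
  err := (F κ).err
  ct e := (mc κ (GG.order d) pp (LS.sketch κ (GG.order d) pp x).1 e).1
  point e M β z := schnorrPoint GG d (GG.gen d ^ (LS.sketch κ (GG.order d) pp x).2.val)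
    (mc κ (GG.order d) pp (LS.sketch κ (GG.order d) pp x).1 e).2.val β z M
  target := schnorrTarget GG LS κ d pp (GG.gen d ^ (LS.sketch κ (GG.order d) pp x).2.val)
    (LS.sketch κ (GG.order d) pp x).1

/-! ## The real attack -/

/-- The list of entries `L` represents the random oracle of the challenger. -/
structure Represents {p : ℕ} (cs : ChallengerState p) (L : List Entry) : Prop where
  table : ∀ y, cs.table y = (lookup L y).head?.map fun e => (e.β : ZMod p)
  lt : ∀ e ∈ L, e.β < p
  hashes : hashCount L ≤ cs.hashes
  length : L.length ≤ cs.hashes + cs.signed.length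
  signed : ∀ e ∈ L, e.hsh = false → ∃ a b M, e.y = .pair a (.pair b M) ∧ M ∈ cs.signed

namespace Represents

variable {p : ℕ} {cs : ChallengerState p} {L : List Entry}

theorem empty : Represents (p := p) ⟨fun _ => none, [], 0⟩ [] :=
  ⟨fun _ => rfl, by simp, by simp [hashCount], by simp, by simp⟩

theorem table_eq_some (h : Represents cs L) {y : Val} {e : Entry} {L' : List Entry}
    (hy : lookup L y = e :: L') : cs.table y = some (e.β : ZMod p) := by
  rw [h.table, hy]; rfl

theorem table_eq_none_iff (h : Represents cs L) {y : Val} :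
    cs.table y = none ↔ lookup L y = [] := by
  rw [h.table]
  cases lookup L y <;> simp

theorem lt_of_lookup (h : Represents cs L) {y : Val} {e : Entry} {L' : List Entry}
    (hy : lookup L y = e :: L') : e.β < p :=
  h.lt e ((hy ▸ lookup_suffix L y).mem (List.mem_cons_self ..))

theorem query_again (h : Represents cs L) :
    Represents ⟨cs.table, cs.signed, cs.hashes + 1⟩ L :=
  ⟨h.table, h.lt, by have := h.hashes; simp only; omega, by have := h.length; simp only; omega,
    h.signed⟩

theorem table_cons (h : Represents cs L) (e : Entry) (y : Val) :
    Function.update cs.table e.y (some (e.β : ZMod p)) y =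
      (lookup (e :: L) y).head?.map fun e => (e.β : ZMod p) := by
  unfold lookup
  by_cases hy : e.y = y
  · subst hy; simp
  · rw [if_neg hy, Function.update_of_ne (Ne.symm hy), h.table]

theorem query_fresh (h : Represents cs L) {b : ℕ} (hb : b < p) (y st : Val) :
    Represents ⟨Function.update cs.table y (some (b : ZMod p)), cs.signed, cs.hashes + 1⟩
      (⟨y, b, true, st⟩ :: L) where
  table := h.table_cons ⟨y, b, true, st⟩
  lt := by simpa using ⟨hb, h.lt⟩
  hashes := by have := h.hashes; simp [hashCount_cons]; omega
  length := by have := h.length; simp only [List.length_cons]; omega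
  signed := by simpa using h.signed

theorem sign_fresh (h : Represents cs L) {b : ℕ} (hb : b < p) {y st M : Val}
    (hy : ∃ a b, y = .pair a (.pair b M)) :
    Represents ⟨Function.update cs.table y (some (b : ZMod p)), M :: cs.signed, cs.hashes⟩
      (⟨y, b, false, st⟩ :: L) where
  table := h.table_cons ⟨y, b, false, st⟩
  lt := by simpa using ⟨hb, h.lt⟩
  hashes := by have := h.hashes; simpa [hashCount_cons]
  length := by have := h.length; simp only [List.length_cons]; omega
  signed := by
    intro e he hh
    rcases List.mem_cons.1 he with rfl | he
    · obtain ⟨a, b, rfl⟩ := hy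
      exact ⟨a, b, M, rfl, List.mem_cons_self ..⟩
    · obtain ⟨a, b, M', h1, h2⟩ := h.signed e he hh
      exact ⟨a, b, M', h1, List.mem_cons_of_mem _ h2⟩

end Represents

section Attack

variable {GG LS} {mc : (κ p : ℕ) → (pp c : Val) → (F κ).X → Val × ZMod p} {A : Machine} {κ : ℕ}
  {d pp : Val} {x : (F κ).X}

/-- The expected success of a final output in a final state of the challenger. -/
noncomputable def winProb (GG : GroupGen) (LS : LinearSketch F GG.orders) {κ : ℕ} {d : Val}
    (pp : Val) (x : (F κ).X) (out : Val) (cs : ChallengerState (GG.order d)) : ℝ≥0∞ :=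
  match out with
  | .pair M σ => ((schnorrFS GG LS).vrfy κ (d, pp)
      (GG.gen d ^ (LS.sketch κ (GG.order d) pp x).2.val, (LS.sketch κ (GG.order d) pp x).1) M σ
        cs.table).expect fun b => if (b.1 && decide (M ∉ cs.signed)) = true then 1 else 0
  | _ => 0

open Classical in
/-- The value of a final state of the simulated attack: a forgery whose target was a fresh random oracle
query, or, with probability `1 / p`, a forgery whose target was not queried. -/
noncomputable def Simulation.value (S : Simulation) (Q : ℕ) (s : SimState) : ℝ≥0∞ :=
  ∑ i ∈ Finset.range Q, S.acc i s +
    (S.p : ℝ≥0∞)⁻¹ * if lookup s.L (S.target s.msg) = [] then 1 else 0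

/-- If the target has a recorded value, a winning forgery must match it, and the entry comes from a
hash query because the message is unsigned. If it has none, the value drawn during verification is
right with probability at most `1/p`. -/
theorem winProb_le (hd : d ∈ (GG.desc κ).support) {Q : ℕ} {out : Val}
    {cs : ChallengerState (GG.order d)} {L : List Entry} (hrep : Represents cs L)
    (hQ : cs.hashes ≤ Q) :
    winProb GG LS pp x out cs ≤ (schnorrSim GG LS mc A κ d pp x).value Q ⟨false, out, L⟩ := by
  have := GroupGen.fact_prime hd
  have hpos : 0 < GG.order d := (GroupGen.fact_prime hd).out.pos
  unfold winProb
  split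
  swap
  · exact zero_le
  rename_i M σ
  simp only [schnorrFS]
  split
  swap
  · simp [PMF.expect_pure]
  rename_i β z c'
  split_ifs with hβz
  swap
  · simp [PMF.expect_pure]
  set y := hashInput GG d (GG.gen d ^ (LS.sketch κ (GG.order d) pp x).2.val *
      GG.gen d ^ (LS.diffRec κ (GG.order d) pp (LS.sketch κ (GG.order d) pp x).1 c').val)
      (GG.gen d ^ z * ((GG.gen d ^ (LS.sketch κ (GG.order d) pp x).2.val *
      GG.gen d ^ (LS.diffRec κ (GG.order d) pp (LS.sketch κ (GG.order d) pp x).1 c').val) ^ β)⁻¹) M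
    with hy
  have htarget : (schnorrSim GG LS mc A κ d pp x).target
      (.pair M (.pair (.nat β) (.pair (.nat z) c'))) = y := rfl
  simp only [hashQuery, PMF.expect_bind, PMF.expect_pure]
  cases hlook : lookup L y with
  | nil =>
    rw [hrep.table_eq_none_iff.2 hlook]
    simp only [PMF.expect_bind, PMF.expect_pure]
    -- Target without value: only the second summand of `value` is used.
    refine le_trans ?_ le_add_self
    simp only [htarget, hlook, if_true, mul_one]
    rw [PMF.expect_unif hpos]
    refine mul_le_of_le_one_right zero_le ?_
    calc _ ≤ ∑ b ∈ Finset.range (GG.order d), if b = β then (1 : ℝ≥0∞) else 0 := by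
          refine Finset.sum_le_sum fun b hb => ?_
          rw [ZMod.val_natCast_of_lt (Finset.mem_range.1 hb)]
          by_cases h : b = β <;> simp [h]
          split_ifs <;> simp
      _ ≤ 1 := by rw [Finset.sum_ite_eq']; split_ifs <;> simp
  | cons e L' =>
    rw [hrep.table_eq_some hlook]
    simp only [PMF.expect_pure]
    rw [ZMod.val_natCast_of_lt (hrep.lt_of_lookup hlook)]
    split_ifs with h
    swap
    · exact zero_le
    simp only [Bool.and_eq_true, decide_eq_true_eq] at h
    have hmem : e ∈ L := (hlook ▸ lookup_suffix L y).mem (List.mem_cons_self ..)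
    -- A programmed entry has a signed message in its point, but this point contains the new message
    -- `M`.
    have hh : e.hsh = true := by
      by_contra hh
      obtain ⟨a, b, M', h1, h2⟩ := hrep.signed e hmem (by simpa using hh)
      rw [y_eq_of_lookup hlook, hy, hashInput] at h1
      simp only [Val.pair.injEq] at h1
      exact h.2 (h1.2.2 ▸ h2)
    have hc : hashCount L' < Q := by
      have h1 := hashCount_le_of_suffix (hlook ▸ lookup_suffix L y)
      simp only [hashCount_cons, hh, if_true] at h1
      have := hrep.hashes
      omega
    refine le_trans ?_ le_self_add
    refine le_trans ?_ (Finset.single_le_sum (fun i _ => zero_le)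
      (Finset.mem_range.2 hc))
    have hacc : (schnorrSim GG LS mc A κ d pp x).Accepts (hashCount L')
        ⟨false, .pair M (.pair (.nat β) (.pair (.nat z) c')), L⟩ :=
      ⟨rfl, e, L', by rw [htarget, hlook], hh, rfl, h.1, h.1 ▸ hβz.1⟩
    simp [Simulation.acc, hacc]

end Attack

end Schnorr

/-! ### Simulated signatures compared with real ones -/

theorem PMF.expect_unif_val {p : ℕ} [NeZero p] (f : ℕ → ℝ≥0∞) :
    (unif p).expect f = (p : ℝ≥0∞)⁻¹ * ∑ u : ZMod p, f u.val := by
  rw [PMF.expect_unif (NeZero.pos p)]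
  congr 1
  refine Finset.sum_nbij' (fun b => (b : ZMod p)) ZMod.val (by simp)
    (fun u _ => Finset.mem_range.2 u.val_lt) (fun b hb => ?_) (fun u _ => by simp) fun b hb => ?_
  all_goals rw [ZMod.val_natCast_of_lt (Finset.mem_range.1 hb)]

theorem exists_mem_of_lookup_ne_nil {L : List Entry} {y : Val} (h : lookup L y ≠ []) :
    ∃ e ∈ L, e.y = y := by
  obtain ⟨e, L', he⟩ := List.exists_cons_of_ne_nil h
  exact ⟨e, (he ▸ lookup_suffix L y).mem (List.mem_cons_self ..), y_eq_of_lookup he⟩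

section Schnorr

variable {F : ℕ → FuzzyKeySetting} {GG : GroupGen} {LS : LinearSketch F GG.orders} {κ : ℕ}
  {d pp : Val}

/-- Different nonces give different points, so a list of recorded points blocks at most as many
nonces as it has entries. -/
theorem hashInput_gen_injective (hd : d ∈ (GG.desc κ).support) (h : GG.G d) (M : Val) :
    Function.Injective fun u : ZMod (GG.order d) => hashInput GG d h (GG.gen d ^ u.val) M := by
  have := GroupGen.fact_prime hd
  intro u u' huu
  have h1 := (GroupGen.gen_pow_eq_iff hd).1 (hashInput_inj GG huu).2.1
  simpa using h1

variable (GG LS κ d pp) in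
/-- The signing algorithm of the scheme. -/
noncomputable def schnorrSign (x : (F κ).X) (M : Val) (T : HashTable (GG.order d)) :
    PMF (Val × HashTable (GG.order d)) :=
  (unif (GG.order d)).bind fun r =>
    (hashQuery (hashInput GG d (GG.gen d ^ (LS.sketch κ (GG.order d) pp x).2.val)
      (GG.gen d ^ r) M) T).bind fun β =>
        PMF.pure (.pair (.nat β.1.val)
          (.pair (.nat (β.1 * (LS.sketch κ (GG.order d) pp x).2 + (r : ZMod (GG.order d))).val)
            (LS.sketch κ (GG.order d) pp x).1), β.2)

/-- Up to the event that the random oracle was already queried, a signature can be simulated by choosing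
`β` and `z` first. -/
theorem expect_sign_le (hd : d ∈ (GG.desc κ).support) (x : (F κ).X) (M : Val)
    {T : HashTable (GG.order d)} {L : List Entry} (hT : ∀ y, T y = none ↔ lookup L y = [])
    {f : Val × HashTable (GG.order d) → ℝ≥0∞} (hf : ∀ a, f a ≤ 1) (G : ZMod (GG.order d) → Val)
    (hG : G = fun u => hashInput GG d (GG.gen d ^ (LS.sketch κ (GG.order d) pp x).2.val)
      (GG.gen d ^ u.val) M) :
    (schnorrSign GG LS κ d pp x M T).expect f ≤
      (GG.order d : ℝ≥0∞)⁻¹ * L.length + (unif (GG.order d)).expect fun β =>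
        (unif (GG.order d)).expect fun z =>
          if lookup L (G (z - β * (LS.sketch κ (GG.order d) pp x).2)) = [] then
            f (.pair (.nat β) (.pair (.nat z) (LS.sketch κ (GG.order d) pp x).1),
              Function.update T (G (z - β * (LS.sketch κ (GG.order d) pp x).2))
                (some (β : ZMod (GG.order d)))) else 0 := by
  have := GroupGen.fact_prime hd
  have hinj : Function.Injective G := hG ▸ hashInput_gen_injective hd _ M
  set t := (LS.sketch κ (GG.order d) pp x).2
  set c := (LS.sketch κ (GG.order d) pp x).1
  rw [schnorrSign]
  simp only [PMF.expect_bind, PMF.expect_pure, PMF.expect_unif_val]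
  set ι : ℝ≥0∞ := (GG.order d : ℝ≥0∞)⁻¹
  simp only [ZMod.natCast_val, ZMod.cast_id', id_eq]
  -- The nonce `u` is fixed. If its point is already recorded, the outcome is estimated by `1`;
  -- otherwise the hash value `β` is fresh and uniform.
  have h1 : ∀ u : ZMod (GG.order d),
      ((hashQuery (hashInput GG d (GG.gen d ^ t.val) (GG.gen d ^ u.val) M) T).expect fun a =>
        f (.pair (.nat a.1.val) (.pair (.nat (a.1 * t + u).val) c), a.2)) ≤
      (if lookup L (G u) = [] then 0 else 1) + ι * ∑ β : ZMod (GG.order d),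
        if lookup L (G u) = [] then f (.pair (.nat β.val) (.pair (.nat (β * t + u).val) c),
          Function.update T (G u) (some β)) else 0 := by
    intro u
    by_cases hu : lookup L (G u) = []
    · have h2 := (hT _).2 hu
      rw [hG] at h2
      simp only at h2
      simp only [hu, if_true, hashQuery, h2, PMF.expect_bind, PMF.expect_pure, zero_add,
        PMF.expect_unif_val]
      simp only [ZMod.natCast_val, ZMod.cast_id', id_eq, hG]
      exact le_rfl
    · refine le_trans (PMF.expect_le_one fun a _ => hf _) ?_
      simp [hu]
  refine (mul_le_mul_right (Finset.sum_le_sum fun u _ => h1 u) ι).trans ?_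
  rw [Finset.sum_add_distrib, mul_add]
  refine add_le_add (mul_le_mul_right ?_ ι) (le_of_eq ?_)
  · calc (∑ u : ZMod (GG.order d), if lookup L (G u) = [] then (0 : ℝ≥0∞) else 1)
        = ((Finset.univ.filter fun u => ¬ lookup L (G u) = []).card : ℝ≥0∞) := by
          rw [Finset.card_filter]
          push_cast
          exact Finset.sum_congr rfl fun u _ => by split_ifs <;> simp_all
      _ ≤ (L.length : ℝ≥0∞) := by
          rw [Nat.cast_le]
          refine (Finset.card_le_card_of_injOn (t := (L.map Entry.y).toFinset) G (fun u hu => ?_)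
            hinj.injOn).trans ((List.toFinset_card_le _).trans (by simp))
          simp only [Finset.coe_filter, Finset.mem_univ, true_and, Set.mem_ofPred_eq] at hu
          obtain ⟨e, he, hy⟩ := exists_mem_of_lookup_ne_nil hu
          simp only [List.coe_toFinset, List.mem_map, Set.mem_ofPred_eq]
          exact ⟨e, he, hy⟩
  · congr 1
    rw [← Finset.mul_sum, Finset.sum_comm, Finset.mul_sum]
    refine Finset.sum_congr rfl fun β _ => ?_
    congr 1
    -- For fixed `β` the nonce `u` and the response `z = β t + u` determine each other, so summing
    -- over `z` is the same as summing over `u`.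
    rw [← Equiv.sum_comp (Equiv.subRight (β * t))]
    refine Finset.sum_congr rfl fun z _ => ?_
    simp only [Equiv.subRight_apply, add_sub_cancel]

/-- The nonce `z - β t` and the hash value `β` produce exactly this signature. Simulated answers are
thus possible real answers, which allows the time bound of the adversary to be used in the
simulation. -/
theorem mem_support_sign (hd : d ∈ (GG.desc κ).support) (x : (F κ).X) (M : Val)
    {T : HashTable (GG.order d)} {β z : ℕ} (hβ : β < GG.order d) (hz : z < GG.order d)
    (y : Val) (hy : y = hashInput GG d (GG.gen d ^ (LS.sketch κ (GG.order d) pp x).2.val)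
      (GG.gen d ^ ((z : ZMod (GG.order d)) - β * (LS.sketch κ (GG.order d) pp x).2).val) M)
    (hT : T y = none) :
    (Val.pair (.nat β) (.pair (.nat z) (LS.sketch κ (GG.order d) pp x).1),
      Function.update T y (some (β : ZMod (GG.order d)))) ∈
      (schnorrSign GG LS κ d pp x M T).support := by
  have := GroupGen.fact_prime hd
  set t := (LS.sketch κ (GG.order d) pp x).2 with ht
  simp only [schnorrSign, PMF.mem_support_bind_iff]
  refine ⟨((z : ZMod (GG.order d)) - β * t).val, ?_, ((β : ZMod (GG.order d)),
    Function.update T y (some (β : ZMod (GG.order d)))), ?_, ?_⟩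
  · rw [mem_support_unif]
    have := ((z : ZMod (GG.order d)) - β * t).val_lt
    omega
  · rw [← hy]
    simp only [hashQuery, hT, PMF.mem_support_bind_iff]
    exact ⟨β, by rw [mem_support_unif]; omega, by simp⟩
  · rw [PMF.mem_support_pure_iff, ZMod.val_natCast_of_lt hβ]
    have : (β : ZMod (GG.order d)) * t + ((((z : ZMod (GG.order d)) - β * t).val : ℕ) : ZMod (GG.order d)) = z := by
      simp
    simp only [t] at this ⊢
    rw [this, ZMod.val_natCast_of_lt hz]

end Schnorr

/-! ### Time bounds of interactive runs -/

section Interact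

variable {σ : Type} (O : Val → σ → PMF (Val × σ)) (c : Prog) (n : ℕ)

/-- Continuation of an interaction after an activation with the given result. -/
noncomputable def interactAfter (k : ℕ) (r : Val × ℕ) (s : σ) : PMF (Val × ℕ × σ) :=
  match r.1 with
  | .pair (.nat 1) (.pair q st) =>
    (O q s).bind fun a => (interact O c n k (.pair st a.1) a.2).bind fun u =>
      PMF.pure (u.1, r.2 + u.2.1, u.2.2)
  | .pair (.nat 0) out => PMF.pure (out, r.2, s)
  | _ => PMF.pure (.nat 0, r.2, s)

theorem interact_succ (k : ℕ) (v : Val) (s : σ) :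
    interact O c n (k + 1) v s = (c.exec n v).bind fun r => interactAfter O c n k r s := rfl

theorem interactAfter_query (k : ℕ) {r : Val × ℕ} (s : σ) {q st : Val}
    (hr : r.1 = .pair (.nat 1) (.pair q st)) :
    interactAfter O c n k r s = (O q s).bind fun a =>
      (interact O c n k (.pair st a.1) a.2).bind fun u => PMF.pure (u.1, r.2 + u.2.1, u.2.2) := by
  obtain ⟨w, m⟩ := r
  simp only at hr
  subst hr
  rfl

theorem interactAfter_of_not_query (k : ℕ) {r : Val × ℕ} (s : σ)
    (hr : ∀ q st, r.1 ≠ .pair (.nat 1) (.pair q st)) :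
    ∃ out, interactAfter O c n k r s = PMF.pure (out, r.2, s) ∧ (out = .nat 0 ∨ out = r.1.snd) := by
  unfold interactAfter
  split
  · rename_i q st h
    exact absurd h (hr q st)
  · rename_i out h
    exact ⟨out, rfl, .inr (by rw [h]; rfl)⟩
  · exact ⟨_, rfl, .inl rfl⟩

/-- The steps of the runs of an interaction with `k` activations are at most `k`. -/
def InteractSafe (k : ℕ) (v : Val) (s : σ) : Prop :=
  ∀ u ∈ (interact O c n k v s).support, u.2.1 ≤ k

theorem mem_support_interact_query {k : ℕ} {v : Val} {s : σ} {r : Val × ℕ}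
    (hr : r ∈ (c.exec n v).support) {q st : Val} (hq : r.1 = .pair (.nat 1) (.pair q st))
    {a : Val × σ} (ha : a ∈ (O q s).support) {u : Val × ℕ × σ}
    (hu : u ∈ (interact O c n k (.pair st a.1) a.2).support) :
    (u.1, r.2 + u.2.1, u.2.2) ∈ (interact O c n (k + 1) v s).support := by
  rw [interact_succ, PMF.mem_support_bind_iff]
  refine ⟨r, hr, ?_⟩
  rw [interactAfter_query O c n k s hq]
  simp only [PMF.mem_support_bind_iff]
  exact ⟨a, ha, u, hu, by simp⟩

variable {O c n} in
-- An activation takes at least one step. Hence the number of activations left can serve as the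
-- bound on the steps left, and both drop together.
theorem InteractSafe.query {k : ℕ} {v : Val} {s : σ} (h : InteractSafe O c n (k + 1) v s)
    {r : Val × ℕ} (hr : r ∈ (c.exec n v).support) {q st : Val}
    (hq : r.1 = .pair (.nat 1) (.pair q st)) {a : Val × σ} (ha : a ∈ (O q s).support) :
    InteractSafe O c n k (.pair st a.1) a.2 := fun u hu => by
  have h1 := h _ (mem_support_interact_query O c n hr hq ha hu)
  have h2 := Prog.one_le_steps hr
  simp only at h1
  omega

variable {O c n} in
theorem InteractSafe.pos {k : ℕ} {v : Val} {s : σ} (h : InteractSafe O c n k v s) : 0 < k := by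
  by_contra hk
  obtain rfl : k = 0 := by omega
  have := h (.nat 0, 1, s) (by simp [interact])
  simp at this

variable {O c n} in
-- An activation is part of some complete run, whose total is bounded.
theorem InteractSafe.steps_le {k : ℕ} {v : Val} {s : σ} (h : InteractSafe O c n k v s) :
    ∀ r ∈ (c.exec n v).support, r.2 ≤ k := by
  intro r hr
  obtain ⟨k, rfl⟩ : ∃ m, k = m + 1 := ⟨k - 1, by have := h.pos; omega⟩
  by_cases hq : ∃ q st, r.1 = .pair (.nat 1) (.pair q st)
  · obtain ⟨q, st, hq⟩ := hq
    obtain ⟨a, ha⟩ := (O q s).support_nonempty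
    obtain ⟨u, hu⟩ := (interact O c n k (.pair st a.1) a.2).support_nonempty
    have := h _ (mem_support_interact_query O c n hr hq ha hu)
    simp only at this
    omega
  · push Not at hq
    obtain ⟨out, ho, -⟩ := interactAfter_of_not_query O c n k s hq
    refine h (out, r.2, s) ?_
    rw [interact_succ, PMF.mem_support_bind_iff]
    exact ⟨r, hr, by rw [ho]; simp⟩

end Interact

/-! ### The real attack bounded by the simulated attack -/

section Schnorr

variable {F : ℕ → FuzzyKeySetting} (GG : GroupGen) (LS : LinearSketch F GG.orders) (κ : ℕ)
  (d pp : Val) (x : (F κ).X)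

/-- The oracles of the adversary in the attack on the scheme. -/
noncomputable def schnorrOracle :
    Val → ChallengerState (GG.order d) → PMF (Val × ChallengerState (GG.order d))
  | .pair (.nat 0) y, cs => (hashQuery y cs.table).bind fun r =>
    PMF.pure (.nat r.1.val, ⟨r.2, cs.signed, cs.hashes + 1⟩)
  | .pair (.nat 1) M, cs => (F κ).err.bind fun e =>
    (schnorrSign GG LS κ d pp (x + e) M cs.table).bind fun r =>
      PMF.pure (r.1, ⟨r.2, M :: cs.signed, cs.hashes⟩)
  | _, cs => PMF.pure (.nat 0, cs)

theorem schnorrOracle_eq :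
    schnorrOracle GG LS κ d pp x = (schnorrFS GG LS).oracle κ (d, pp) x := by
  funext q cs
  rcases q with n | ⟨⟨_ | _ | n⟩ | ⟨a, b⟩, y⟩ <;> rfl

theorem schnorrOracle_hash (y : Val) (cs : ChallengerState (GG.order d)) :
    schnorrOracle GG LS κ d pp x (.pair (.nat 0) y) cs = (hashQuery y cs.table).bind fun r =>
      PMF.pure (.nat r.1.val, ⟨r.2, cs.signed, cs.hashes + 1⟩) := rfl

theorem schnorrOracle_sign (M : Val) (cs : ChallengerState (GG.order d)) :
    schnorrOracle GG LS κ d pp x (.pair (.nat 1) M) cs = (F κ).err.bind fun e =>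
      (schnorrSign GG LS κ d pp (x + e) M cs.table).bind fun r =>
        PMF.pure (r.1, ⟨r.2, M :: cs.signed, cs.hashes⟩) := rfl

variable {GG LS κ d pp x} {mc : (κ p : ℕ) → (pp c : Val) → (F κ).X → Val × ZMod p} {A : Machine}
  (hd : d ∈ (GG.desc κ).support)
  (hlin : ∀ e, LS.sketch κ (GG.order d) pp (x + e) =
    ((mc κ (GG.order d) pp (LS.sketch κ (GG.order d) pp x).1 e).1,
      (LS.sketch κ (GG.order d) pp x).2 + (mc κ (GG.order d) pp (LS.sketch κ (GG.order d) pp x).1 e).2))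

theorem schnorrOracle_counters {q : Val} {cs : ChallengerState (GG.order d)}
    {a : Val × ChallengerState (GG.order d)} (ha : a ∈ (schnorrOracle GG LS κ d pp x q cs).support) :
    cs.signed.length ≤ a.2.signed.length ∧ cs.hashes ≤ a.2.hashes ∧
      a.2.signed.length + a.2.hashes ≤ cs.signed.length + cs.hashes + 1 := by
  unfold schnorrOracle at ha
  split at ha <;> simp only [PMF.mem_support_bind_iff, PMF.mem_support_pure_iff] at ha
  · obtain ⟨r, -, rfl⟩ := ha
    simp only
    omega
  · obtain ⟨e, -, r, -, rfl⟩ := ha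
    simp only [List.length_cons]
    omega
  · subst ha
    simp only
    omega

/-- Each query belongs to an activation, which costs a step. The time bound of an adversary is
therefore also a bound on its queries. -/
theorem interact_counters {n k : ℕ} {v : Val} {cs : ChallengerState (GG.order d)}
    {u : Val × ℕ × ChallengerState (GG.order d)}
    (hu : u ∈ (interact (schnorrOracle GG LS κ d pp x) A.prog n k v cs).support) :
    cs.signed.length ≤ u.2.2.signed.length ∧ cs.hashes ≤ u.2.2.hashes ∧
      u.2.2.signed.length + u.2.2.hashes ≤ cs.signed.length + cs.hashes + u.2.1 := by
  induction k generalizing v cs u with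
  | zero =>
    simp only [interact, PMF.mem_support_pure_iff] at hu
    subst hu
    simp
  | succ k ih =>
    rw [interact_succ, PMF.mem_support_bind_iff] at hu
    obtain ⟨r, hr, hu⟩ := hu
    by_cases hq : ∃ q st, r.1 = .pair (.nat 1) (.pair q st)
    · obtain ⟨q, st, hq⟩ := hq
      rw [interactAfter_query _ _ _ _ _ hq] at hu
      simp only [PMF.mem_support_bind_iff, PMF.mem_support_pure_iff] at hu
      obtain ⟨a, ha, u', hu', rfl⟩ := hu
      have h1 := schnorrOracle_counters ha
      have h2 := ih hu'
      have h3 := Prog.one_le_steps hr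
      simp only
      omega
    · push Not at hq
      obtain ⟨out, ho, -⟩ := interactAfter_of_not_query (schnorrOracle GG LS κ d pp x) A.prog n k cs hq
      rw [ho, PMF.mem_support_pure_iff] at hu
      subst hu
      simp

include hlin in
-- Linearity identifies the shifted key used by the simulation with the true proxy key of `x + e`.
theorem schnorrSim_point [Fact (GG.order d).Prime] (hd : d ∈ (GG.desc κ).support) (e : (F κ).X)
    (M : Val) (β z : ℕ) : (schnorrSim GG LS mc A κ d pp x).point e M β z =
      hashInput GG d (GG.gen d ^ (LS.sketch κ (GG.order d) pp (x + e)).2.val)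
        (GG.gen d ^ ((z : ZMod (GG.order d)) -
          β * (LS.sketch κ (GG.order d) pp (x + e)).2).val) M := by
  rw [hlin e]
  exact schnorrPoint_eq hd _ _ _ _ _

include hd hlin in
/-- Every simulated answer is a possible real answer, unless the simulation stops. -/
theorem answer_real {q st : Val} {L : List Entry} {cs : ChallengerState (GG.order d)}
    (hrep : Represents cs L) {s : SimState}
    (hs : s ∈ ((schnorrSim GG LS mc A κ d pp x).answer q st L).support) :
    s = ⟨false, .nat 0, L⟩ ∨ s.run = true ∧
      ∃ a ∈ (schnorrOracle GG LS κ d pp x q cs).support, s.msg = .pair st a.1 ∧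
        Represents a.2 s.L ∧ (s.L = L ∨ ∃ e, s.L = e :: L ∧ (e.hsh = true →
          e.st = st ∧ (∃ y, q = .pair (.nat 0) y ∧ e.y = y) ∧ ∀ b < GG.order d,
            ∃ a ∈ (schnorrOracle GG LS κ d pp x q cs).support, a.1 = .nat b ∧
              Represents a.2 (⟨e.y, b, true, st⟩ :: L)) ∧
          (e.hsh = false → e.st = .nat 0 ∧ ∃ M ε β z, q = .pair (.nat 1) M ∧
            e.y = (schnorrSim GG LS mc A κ d pp x).point ε M β z)) := by
  have := GroupGen.fact_prime hd
  have hpos : 0 < GG.order d := this.out.pos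
  unfold Simulation.answer at hs
  split at hs
  · rename_i y
    split at hs
    · rename_i e L' hlook
      rw [PMF.mem_support_pure_iff] at hs
      subst hs
      refine .inr ⟨rfl, (.nat e.β, ⟨cs.table, cs.signed, cs.hashes + 1⟩), ?_, rfl,
        hrep.query_again, .inl rfl⟩
      rw [schnorrOracle_hash]
      simp only [hashQuery, hrep.table_eq_some hlook, PMF.mem_support_bind_iff,
        PMF.mem_support_pure_iff]
      exact ⟨_, rfl, by rw [ZMod.val_natCast_of_lt (hrep.lt_of_lookup hlook)]⟩
    · rename_i _ hlook
      simp only [PMF.mem_support_bind_iff, PMF.mem_support_pure_iff, mem_support_unif] at hs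
      obtain ⟨b, hb, rfl⟩ := hs
      -- Stated for every value and not only for the sampled one, since rewinding replaces the
      -- answer by an arbitrary `b`.
      have key : ∀ b < GG.order d, (Val.nat b, (⟨Function.update cs.table y
          (some (b : ZMod (GG.order d))), cs.signed, cs.hashes + 1⟩ :
            ChallengerState (GG.order d))) ∈
          (schnorrOracle GG LS κ d pp x (.pair (.nat 0) y) cs).support := by
        intro b hb
        rw [schnorrOracle_hash]
        simp only [hashQuery, hrep.table_eq_none_iff.2 hlook, PMF.mem_support_bind_iff,
          PMF.mem_support_pure_iff, mem_support_unif]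
        exact ⟨_, ⟨b, by omega, rfl⟩, by simp only; rw [ZMod.val_natCast_of_lt hb]⟩
      have hb' : b < GG.order d := by
        change b ≤ GG.order d - 1 at hb
        omega
      refine .inr ⟨rfl, _, key b hb', rfl, hrep.query_fresh hb' _ _, .inr ⟨_, rfl, fun _ =>
        ⟨rfl, ⟨y, rfl, rfl⟩, fun b hb => ⟨_, key b hb, rfl, hrep.query_fresh hb _ _⟩⟩,
        fun h => by simp at h⟩⟩
  · rename_i M
    simp only [PMF.mem_support_bind_iff, mem_support_unif] at hs
    obtain ⟨(e : (F κ).X), he, β, hβ, z, hz, hs⟩ := hs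
    split at hs <;> rw [PMF.mem_support_pure_iff] at hs <;> subst hs
    · exact .inl rfl
    · rename_i _ hlook
      have hβ' : β < GG.order d := by
        change β ≤ GG.order d - 1 at hβ
        omega
      have hz' : z < GG.order d := by
        change z ≤ GG.order d - 1 at hz
        omega
      have h1 := mem_support_sign (LS := LS) hd (x + e) M hβ' hz' _
        (schnorrSim_point (A := A) hlin hd e M β z) (hrep.table_eq_none_iff.2 hlook)
      refine .inr ⟨rfl, (.pair (.nat β) (.pair (.nat z) (LS.sketch κ (GG.order d) pp (x + e)).1),
        ⟨Function.update cs.table ((schnorrSim GG LS mc A κ d pp x).point e M β z)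
          (some (β : ZMod (GG.order d))), M :: cs.signed, cs.hashes⟩), ?_, ?_,
          hrep.sign_fresh hβ' ⟨_, _, rfl⟩, .inr ⟨_, rfl, fun h => by simp at h,
            fun _ => ⟨rfl, M, e, β, z, rfl, rfl⟩⟩⟩
      · rw [schnorrOracle_sign]
        simp only [PMF.mem_support_bind_iff, PMF.mem_support_pure_iff]
        exact ⟨e, he, _, h1, rfl⟩
      · rw [hlin e]
        rfl
  · rename_i h1 h2
    rw [PMF.mem_support_pure_iff] at hs
    subst hs
    refine .inr ⟨rfl, (.nat 0, cs), ?_, rfl, hrep, .inl rfl⟩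
    unfold schnorrOracle
    split
    · exact absurd rfl (h1 _)
    · exact absurd rfl (h2 _)
    · simp

theorem winProb_le_one (out : Val) (cs : ChallengerState (GG.order d)) :
    winProb GG LS pp x out cs ≤ 1 := by
  unfold winProb
  split
  · exact PMF.expect_le_one fun b _ => by split_ifs <;> simp
  · exact zero_le

include hd hlin in
/-- The real success probability is bounded by the value of the simulated attack and the probability that
the simulation stops. -/
theorem expect_winProb_le {Q QH k : ℕ} {v : Val} {L : List Entry}
    {cs : ChallengerState (GG.order d)} (hrep : Represents cs L)
    (hb : ∀ u ∈ (interact (schnorrOracle GG LS κ d pp x) A.prog (A.time.eval κ) k v cs).support,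
      u.2.2.signed.length ≤ Q ∧ u.2.2.hashes ≤ QH) :
    (interact (schnorrOracle GG LS κ d pp x) A.prog (A.time.eval κ) k v cs).expect
        (fun u => winProb GG LS pp x u.1 u.2.2) ≤
      ((schnorrSim GG LS mc A κ d pp x).exec k ⟨true, v, L⟩).expect
        ((schnorrSim GG LS mc A κ d pp x).value QH) +
      ((Q - cs.signed.length : ℕ) : ℝ≥0∞) * ((GG.order d : ℝ≥0∞)⁻¹ * (Q + QH : ℕ)) := by
  have := GroupGen.fact_prime hd
  have hpos : 0 < GG.order d := this.out.pos
  set S := schnorrSim GG LS mc A κ d pp x with hS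
  induction k generalizing v L cs with
  | zero => simp [interact, PMF.expect_pure, winProb]
  | succ k ih =>
    rw [interact_succ, Simulation.exec_succ _ rfl]
    simp only [PMF.expect_bind]
    refine PMF.expect_le_expect_add fun r hr => ?_
    by_cases hq : ∃ q st, r.1 = .pair (.nat 1) (.pair q st)
    swap
    · push Not at hq
      obtain ⟨out, ho, hout⟩ := interactAfter_of_not_query (schnorrOracle GG LS κ d pp x) A.prog
        (A.time.eval κ) k cs hq
      rcases S.react_eq r.1 L with ⟨q, st, h, -⟩ | ⟨-, h⟩
      · exact absurd h (hq q st)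
      refine le_trans ?_ le_self_add
      simp only [h, ho, PMF.expect_pure, Simulation.exec_of_not_run]
      -- A malformed result counts as output `0` in the real game, where it cannot win, so it does
      -- not matter that the simulation keeps its second component. A proper output is the same on
      -- both sides.
      rcases hout with rfl | rfl
      · exact zero_le
      · refine winProb_le hd hrep (hb (r.1.snd, r.2, cs) ?_).2
        rw [interact_succ, PMF.mem_support_bind_iff]
        exact ⟨r, hr, by rw [ho]; simp⟩
    obtain ⟨q, st, hq⟩ := hq
    have hreact : S.react r.1 L = S.answer q st L := by rw [hq]; rfl
    rw [interactAfter_query _ _ _ _ _ hq, hreact]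
    simp only [PMF.expect_bind, PMF.expect_pure]
    have hbnext : ∀ a ∈ (schnorrOracle GG LS κ d pp x q cs).support, ∀ u ∈
        (interact (schnorrOracle GG LS κ d pp x) A.prog (A.time.eval κ) k (.pair st a.1)
          a.2).support, u.2.2.signed.length ≤ Q ∧ u.2.2.hashes ≤ QH := fun a ha u hu => by
      have := hb _ (mem_support_interact_query _ _ _ hr hq ha hu)
      exact this
    have hcs : ∀ a ∈ (schnorrOracle GG LS κ d pp x q cs).support,
        a.2.signed.length ≤ Q ∧ a.2.hashes ≤ QH := fun a ha => by
      obtain ⟨u, hu⟩ := (interact (schnorrOracle GG LS κ d pp x) A.prog (A.time.eval κ) k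
        (.pair st a.1) a.2).support_nonempty
      have h1 := hbnext a ha u hu
      have h2 := interact_counters hu
      exact ⟨h2.1.trans h1.1, h2.2.1.trans h1.2⟩
    -- Common treatment of the answers without randomness: repeated hash queries and malformed
    -- queries. No signature is used up here.
    have hother : ∀ s', S.answer q st L = PMF.pure s' → s'.run = true → ∀ a,
        schnorrOracle GG LS κ d pp x q cs = PMF.pure a → s'.msg = .pair st a.1 →
        Represents a.2 s'.L → a.2.signed = cs.signed →
        ((schnorrOracle GG LS κ d pp x q cs).expect fun a =>
          (interact (schnorrOracle GG LS κ d pp x) A.prog (A.time.eval κ) k (.pair st a.1)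
            a.2).expect fun u => winProb GG LS pp x u.1 u.2.2) ≤
        ((S.answer q st L).expect fun s => (S.exec k s).expect (S.value QH)) +
          ((Q - cs.signed.length : ℕ) : ℝ≥0∞) * ((GG.order d : ℝ≥0∞)⁻¹ * (Q + QH : ℕ)) := by
      intro s' hs' hrun a ha hmsg hrep' hsig
      have h1 := ih hrep' (hbnext a (by rw [ha]; simp))
      rw [hs', ha, PMF.expect_pure, PMF.expect_pure]
      rw [hsig] at h1
      obtain ⟨run, msg, L'⟩ := s'
      simp only at hrun hmsg
      subst hrun hmsg
      exact h1
    by_cases hh : ∃ y, q = .pair (.nat 0) y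
    · obtain ⟨y, rfl⟩ := hh
      cases hlook : lookup L y with
      | cons e L' =>
        refine hother ⟨true, .pair st (.nat e.β), L⟩ (by simp only [Simulation.answer, hlook]) rfl
          (.nat e.β, ⟨cs.table, cs.signed, cs.hashes + 1⟩) ?_ rfl hrep.query_again rfl
        rw [schnorrOracle_hash]
        simp only [hashQuery, hrep.table_eq_some hlook, PMF.pure_bind]
        rw [ZMod.val_natCast_of_lt (hrep.lt_of_lookup hlook)]
      | nil =>
        have e1 : schnorrOracle GG LS κ d pp x (.pair (.nat 0) y) cs =
            (unif (GG.order d)).bind fun b => PMF.pure (.nat (b : ZMod (GG.order d)).val,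
              ⟨Function.update cs.table y (some (b : ZMod (GG.order d))), cs.signed,
                cs.hashes + 1⟩) := by
          rw [schnorrOracle_hash]
          simp only [hashQuery, hrep.table_eq_none_iff.2 hlook, PMF.bind_bind, PMF.pure_bind]
        have e2 : S.answer (.pair (.nat 0) y) st L = (unif (GG.order d)).bind fun b =>
            PMF.pure ⟨true, .pair st (.nat b), ⟨y, b, true, st⟩ :: L⟩ := by
          simp only [Simulation.answer, hlook]
          rfl
        rw [e1] at hbnext ⊢
        rw [e2]
        simp only [PMF.expect_bind, PMF.expect_pure]
        refine PMF.expect_le_expect_add fun b hb => ?_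
        have hb' : b < GG.order d := by
          rw [mem_support_unif] at hb
          omega
        have h1 := ih (hrep.query_fresh hb' y st) (v := .pair st (.nat b)) fun u hu => by
          refine hbnext (.nat b, ⟨Function.update cs.table y (some (b : ZMod (GG.order d))),
            cs.signed, cs.hashes + 1⟩) ?_ u hu
          simp only [PMF.mem_support_bind_iff, PMF.mem_support_pure_iff]
          exact ⟨b, hb, by rw [ZMod.val_natCast_of_lt hb']⟩
        rw [ZMod.val_natCast_of_lt hb']
        exact h1
    by_cases hM : ∃ M, q = .pair (.nat 1) M
    · obtain ⟨M, rfl⟩ := hM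
      have hsucc : cs.signed.length + 1 ≤ Q := by
        obtain ⟨a, ha⟩ := (schnorrOracle GG LS κ d pp x (.pair (.nat 1) M) cs).support_nonempty
        have h1 := (hcs a ha).1
        rw [schnorrOracle_sign] at ha
        simp only [PMF.mem_support_bind_iff, PMF.mem_support_pure_iff] at ha
        obtain ⟨_, _, _, _, rfl⟩ := ha
        exact h1
      have hhash : cs.hashes ≤ QH := by
        obtain ⟨a, ha⟩ := (schnorrOracle GG LS κ d pp x (.pair (.nat 1) M) cs).support_nonempty
        exact (schnorrOracle_counters ha).2.1.trans (hcs a ha).2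
      -- One of the remaining signing queries is spent now. Its share of the error term pays for a
      -- collision, and the other `m` shares are left to the induction hypothesis.
      obtain ⟨m, hm⟩ : ∃ m, Q - cs.signed.length = m + 1 := ⟨Q - cs.signed.length - 1, by omega⟩
      have hm' : Q - (cs.signed.length + 1) = m := by omega
      rw [schnorrOracle_sign, hm]
      simp only [Simulation.answer, PMF.expect_bind, PMF.expect_pure]
      refine PMF.expect_le_expect_add (D := (F κ).err) fun e he => ?_
      refine (expect_sign_le hd (x + e) M (fun y => hrep.table_eq_none_iff)
        (f := fun r => (interact (schnorrOracle GG LS κ d pp x) A.prog (A.time.eval κ) k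
          (.pair st r.1) ⟨r.2, M :: cs.signed, cs.hashes⟩).expect
            fun u => winProb GG LS pp x u.1 u.2.2)
        (fun r => PMF.expect_le_one fun u _ => winProb_le_one u.1 u.2.2) _ rfl).trans ?_
      rw [Nat.cast_add, Nat.cast_one, add_mul, one_mul, ← add_assoc, add_comm _ (_ * _)]
      refine add_le_add (mul_le_mul_right (Nat.cast_le.2 ?_) _) ?_
      -- The list has at most one entry for each query so far, hence at most `Q + QH` entries.
      · have := hrep.length
        omega
      refine PMF.expect_le_expect_add (D := unif (GG.order d)) fun β hβ => ?_
      refine PMF.expect_le_expect_add (D := unif (GG.order d)) fun z hz => ?_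
      rw [mem_support_unif] at hβ hz
      have hpt := schnorrSim_point (A := A) hlin hd e M β z
      have hct : (LS.sketch κ (GG.order d) pp (x + e)).1 = S.ct e := by rw [hlin e]; rfl
      -- The point and the sketch are expressed through `mc` in the simulation and through the
      -- sketch of `x + e` in the real game. Abstract names for them avoid rewriting inside
      -- dependent terms.
      suffices key : ∀ Y c, Y = hashInput GG d (GG.gen d ^ (LS.sketch κ (GG.order d) pp (x + e)).2.val)
          (GG.gen d ^ ((z : ZMod (GG.order d)) -
            β * (LS.sketch κ (GG.order d) pp (x + e)).2).val) M →
          (LS.sketch κ (GG.order d) pp (x + e)).1 = c →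
          (if lookup L Y = [] then
            (interact (schnorrOracle GG LS κ d pp x) A.prog (A.time.eval κ) k
              (.pair st (.pair (.nat β) (.pair (.nat z) c)))
              ⟨Function.update cs.table Y (some (β : ZMod (GG.order d))), M :: cs.signed,
                cs.hashes⟩).expect fun u => winProb GG LS pp x u.1 u.2.2
            else 0) ≤
          (match lookup L Y with
            | _ :: _ => PMF.pure (⟨false, .nat 0, L⟩ : SimState)
            | [] => PMF.pure (⟨true, .pair st (.pair (.nat β) (.pair (.nat z) c)),
                ⟨Y, β, false, .nat 0⟩ :: L⟩ : SimState)).expect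
              (fun s => (S.exec k s).expect (S.value QH)) +
            (m : ℝ≥0∞) * ((GG.order d : ℝ≥0∞)⁻¹ * (Q + QH : ℕ)) by
        refine le_trans (le_of_eq ?_) (key _ _ hpt hct)
        rw [hpt, ← hct]
      rintro Y c hY rfl
      split_ifs with hlook
      swap
      · exact zero_le
      simp only [hlook, PMF.expect_pure]
      have hmem : (Val.pair (.nat β) (.pair (.nat z) (LS.sketch κ (GG.order d) pp (x + e)).1),
          (⟨Function.update cs.table Y (some (β : ZMod (GG.order d))),
            M :: cs.signed, cs.hashes⟩ : ChallengerState (GG.order d))) ∈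
          (schnorrOracle GG LS κ d pp x (.pair (.nat 1) M) cs).support := by
        rw [schnorrOracle_sign]
        simp only [PMF.mem_support_bind_iff, PMF.mem_support_pure_iff]
        exact ⟨e, he, _, mem_support_sign (LS := LS) hd (x + e) M (by omega) (by omega) Y hY
          (hrep.table_eq_none_iff.2 hlook), rfl⟩
      have h1 := ih (hrep.sign_fresh (st := .nat 0) (M := M) (b := β) (y := Y)
        (by omega) (by rw [hY]; exact ⟨_, _, rfl⟩)) (hbnext _ hmem)
      simp only [List.length_cons, hm'] at h1
      exact h1
    · have e1 : S.answer q st L = PMF.pure ⟨true, .pair st (.nat 0), L⟩ := by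
        unfold Simulation.answer
        split
        · exact absurd ⟨_, rfl⟩ hh
        · exact absurd ⟨_, rfl⟩ hM
        · rfl
      have e2 : schnorrOracle GG LS κ d pp x q cs = PMF.pure (.nat 0, cs) := by
        unfold schnorrOracle
        split
        · exact absurd ⟨_, rfl⟩ hh
        · exact absurd ⟨_, rfl⟩ hM
        · rfl
      exact hother _ e1 rfl _ e2 rfl hrep rfl

end Schnorr

/-! ## Subprograms -/

namespace Prog

/-- The component of a value at the given position (`false` for the first, `true` for the second component
of a pair). -/
def get : List Bool → Prog
  | [] => .instr .id
  | false :: l => .seq (.instr .fst) (get l)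
  | true :: l => .seq (.instr .snd) (get l)

/-- A binary instruction applied to the results of two programs. -/
def op (i : Instr) (f g : Prog) : Prog := .seq (.fork f g) (.instr i)

/-- A constant. -/
def lit (n : ℕ) : Prog := .instr (.const n)

/-- Search in a list of entries: `(y, L)` is mapped to `lookup L y`. -/
def search : Prog :=
  .seq (.loop
      (.cond (.seq (get [true]) (.instr .isPair))
        (.cond (op .eq (get [true, false, false]) (get [false])) (lit 0) (lit 1)) (lit 0))
      (.fork (get [false]) (get [true, true])))
    (get [true])

/-- Square-and-multiply: `(ctx, (a, (b, m)))` is mapped to `a * b ^ m`. -/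
def mulPow (mul : Prog) : Prog :=
  .seq (.loop (get [true, true, true])
    (.fork (get [false])
      (.fork
        (.cond (op .mod (get [true, true, true]) (lit 2))
          (.seq (.fork (get [false]) (.fork (get [true, false]) (get [true, true, false]))) mul)
          (get [true, false]))
        (.fork
          (.seq (.fork (get [false]) (.fork (get [true, true, false]) (get [true, true, false]))) mul)
          (op .div (get [true, true, true]) (lit 2))))))
    (get [true, false])

end Prog

/-- Encoding of an entry. -/
def Entry.enc (e : Entry) : Val :=
  .pair e.y (.pair (.nat e.β) (.pair (.nat (if e.hsh then 1 else 0)) e.st))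

/-- Encoding of a list of entries. -/
def encList : List Entry → Val
  | [] => .nat 0
  | e :: L => .pair e.enc (encList L)

theorem length_le_size_encList (L : List Entry) : L.length ≤ (encList L).size := by
  induction L with
  | nil => simp
  | cons e L ih => simp only [encList, Val.size, List.length_cons]; omega

theorem size_encList_le_of_suffix {L L' : List Entry} (h : L <:+ L') :
    (encList L).size ≤ (encList L').size := by
  obtain ⟨l, rfl⟩ := h
  induction l with
  | nil => exact le_rfl
  | cons e l ih => simp only [List.cons_append, encList, Val.size]; omega

theorem iterWhile_lookup (y : Val) (k : ℕ) (L : List Entry) (hk : L.length ≤ k) :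
    iterWhile (fun L => match L with | [] => false | e :: _ => decide (e.y ≠ y))
      (fun L => PMF.pure L.tail) k L = PMF.pure (lookup L y) := by
  induction k generalizing L with
  | zero =>
    obtain rfl : L = [] := by simpa using hk
    rfl
  | succ k ih =>
    cases L with
    | nil => rfl
    | cons e L =>
      simp only [iterWhile, PMF.pure_bind, List.tail_cons, lookup]
      by_cases h : e.y = y
      · simp [h]
      · simp only [h, ne_eq, not_false_eq_true, decide_true, if_true, if_false]
        exact ih L (by simpa using hk)

namespace Impl

variable {J : Type} {κ : J → ℕ}

/-- The loop drops entries from the front. Every store therefore contains a suffix of the original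
list and stays short, and the number of iterations is at most the length of the list. -/
theorem search {y : J → Val} {L : J → List Entry} (hy : PolySized κ y)
    (hL : PolySized κ fun j => encList (L j)) :
    Impl κ Prog.search (fun j => .pair (y j) (encList (L j)))
      fun j => PMF.pure (encList (lookup (L j) (y j))) := by
  have hlen : PolyBdd κ fun j => (L j).length := PolyBdd.mono hL fun j => length_le_size_encList _
  have hsz : ∀ (C : (j : J) → ℕ × List Entry → Prop),
      PolySized (J := Σ j, {x : ℕ × List Entry // x.1 ≤ (L j).length ∧
        (x.2.length ≤ x.1 ∧ x.2 <:+ L j) ∧ C j x}) (fun x => κ x.1)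
        fun x => .pair (y x.1) (encList x.2.1.2) := fun C => by
    refine (hy.reindex Sigma.fst).pair ((hL.reindex Sigma.fst).mono fun x => ?_)
    exact size_encList_le_of_suffix x.2.2.2.1.2
  have h := Impl.loop (κ := κ) (σ := fun _ => List Entry)
    (fun j L => .pair (y j) (encList L))
    (fun j L => match L with | [] => false | e :: _ => decide (e.y ≠ y j))
    (fun _ L => PMF.pure L.tail) (fun j k L' => L'.length ≤ k ∧ L' <:+ L j)
    (fun j => (L j).length) hlen
    (fun j L => match L with | [] => .nat 0 | e :: _ => if e.y = y j then .nat 0 else .nat 1)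
    (fun j L => by cases L <;> simp)
    (b := .cond (.seq (.get [true]) (.instr .isPair))
        (.cond (.op .eq (.get [true, false, false]) (.get [false])) (.lit 0) (.lit 1)) (.lit 0))
    (f := .fork (.get [false]) (.get [true, true]))
    (Impl.straight rfl (by
      obtain ⟨t, ht⟩ := hsz fun _ _ => True
      exact ⟨t, fun x => ht ⟨x.1, x.2.1, x.2.2.1, x.2.2.2, trivial⟩⟩) ?_) ?_ ?_ L ?_
  · refine Impl.congr (Impl.seq h (E := fun _ L' => PMF.pure (encList L')) ?_) (fun _ => rfl) ?_
    · exact fun h' => Impl.straight rfl h' fun _ => rfl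
    · intro j
      rw [iterWhile_lookup _ _ _ le_rfl, PMF.pure_bind]
  · rintro ⟨j, ⟨k, L'⟩, hx⟩
    cases L' with
    | nil => simp [Prog.denote, Prog.get, Prog.lit, Instr.apply, encList]
    | cons e L' =>
      by_cases he : e.y = y j <;>
        simp [Prog.denote, Prog.get, Prog.op, Prog.lit, Instr.apply, encList, Entry.enc, he]
  · simp only [PMF.pure_map]
    refine Impl.straight rfl (by
      obtain ⟨t, ht⟩ := hsz fun _ _ => True
      exact ⟨t, fun x => ht ⟨x.1, x.2.1, x.2.2.1, x.2.2.2.1, trivial⟩⟩) ?_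
    rintro ⟨j, ⟨k, L'⟩, hx⟩
    cases L' with
    | nil => simp at hx
    | cons e L' => simp [Prog.denote, Prog.get, Instr.apply, encList]
  · rintro j k L' - ⟨h1, h2⟩ ht
    cases L' with
    | nil => simp at ht
    | cons e L' =>
      simp only [List.length_cons] at h1
      refine ⟨by omega, fun s' hs' => ?_⟩
      simp only [List.tail_cons, PMF.mem_support_pure_iff] at hs'
      subst hs'
      exact ⟨by omega, (List.suffix_cons _ _).trans h2⟩
  · exact fun j => ⟨le_rfl, List.suffix_rfl⟩

end Impl

/-- Each step preserves `a * b ^ m` and halves `m`, so the bit length of the exponent suffices as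
the number of iterations. -/
theorem iterWhile_mulPow {M : Type} [Monoid M] (k : ℕ) (a b : M) (m : ℕ) (hm : m < 2 ^ k) :
    (iterWhile (fun s : M × M × ℕ => decide (s.2.2 ≠ 0))
      (fun s => PMF.pure (if s.2.2 % 2 = 0 then s.1 else s.1 * s.2.1, s.2.1 * s.2.1, s.2.2 / 2))
      k (a, b, m)).map (fun s => s.1) = PMF.pure (a * b ^ m) := by
  induction k generalizing a b m with
  | zero =>
    obtain rfl : m = 0 := by simpa using hm
    simp [iterWhile, PMF.pure_map]
  | succ k ih =>
    by_cases h : m = 0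
    · subst h
      simp [iterWhile, PMF.pure_map]
    · simp only [iterWhile, h, ne_eq, not_false_eq_true, decide_true, if_true, PMF.pure_bind]
      rw [ih _ _ _ (by rw [pow_succ] at hm; omega), ← pow_two, ← pow_mul]
      congr 1
      have h2 := Nat.mod_add_div m 2
      split_ifs with h0
      · rw [h0, zero_add] at h2
        rw [h2]
      · have h1 : m % 2 = 1 := by omega
        rw [h1] at h2
        rw [mul_assoc, ← pow_succ', add_comm, h2]

namespace Impl

variable {J : Type} {κ : J → ℕ}

/-- All intermediate elements have short encodings, because `mul` handles arbitrary pairs of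
elements in polynomial time and has to read them. The statement is for monoids, as it serves both
the group and `ZMod p`. -/
theorem mulPow {M : J → Type} [∀ j, Monoid (M j)] {ctx : J → Val} {enc : ∀ j, M j → Val}
    {mul : Prog} (hmul : Impl (J := Σ j, M j × M j) (fun x => κ x.1) mul
      (fun x => .pair (ctx x.1) (.pair (enc x.1 x.2.1) (enc x.1 x.2.2)))
      fun x => PMF.pure (enc x.1 (x.2.1 * x.2.2)))
    (a b : ∀ j, M j) {m : J → ℕ} (hm : PolySized κ fun j => .nat (m j)) :
    Impl κ (Prog.mulPow mul)
      (fun j => .pair (ctx j) (.pair (enc j (a j)) (.pair (enc j (b j)) (.nat (m j)))))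
      fun j => PMF.pure (enc j (a j * b j ^ m j)) := by
  have hsz : ∀ (C : (j : J) → ℕ × (M j × M j × ℕ) → Prop),
      PolySized (J := Σ j, {x : ℕ × (M j × M j × ℕ) // x.1 ≤ (m j).size ∧
        (x.2.2.2 < 2 ^ x.1 ∧ x.2.2.2 ≤ m j) ∧ C j x}) (fun x => κ x.1)
        fun x => .pair (ctx x.1) (.pair (enc x.1 x.2.1.2.1) (.pair (enc x.1 x.2.1.2.2.1)
          (.nat x.2.1.2.2.2))) := fun C => by
    have h0 := hmul.sized.reindex (J' := Σ j, {x : ℕ × (M j × M j × ℕ) // x.1 ≤ (m j).size ∧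
        (x.2.2.2 < 2 ^ x.1 ∧ x.2.2.2 ≤ m j) ∧ C j x})
      fun x => ⟨x.1, x.2.1.2.1, x.2.1.2.2.1⟩
    refine h0.of_pair_left.pair (h0.of_pair_right.of_pair_left.pair
      (h0.of_pair_right.of_pair_right.pair ((hm.reindex Sigma.fst).nat_mono fun x => ?_)))
    exact x.2.2.2.1.2
  have h := Impl.loop (κ := κ) (σ := fun j => M j × M j × ℕ)
    (fun j s => .pair (ctx j) (.pair (enc j s.1) (.pair (enc j s.2.1) (.nat s.2.2))))
    (fun _ s => decide (s.2.2 ≠ 0))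
    (fun _ s => PMF.pure (if s.2.2 % 2 = 0 then s.1 else s.1 * s.2.1, s.2.1 * s.2.1, s.2.2 / 2))
    (fun j k s => s.2.2 < 2 ^ k ∧ s.2.2 ≤ m j)
    (fun j => (m j).size) hm.size_nat (fun _ s => .nat s.2.2) (fun j s => by simp)
    (b := .get [true, true, true])
    (f := .fork (.get [false])
      (.fork
        (.cond (.op .mod (.get [true, true, true]) (.lit 2))
          (.seq (.fork (.get [false]) (.fork (.get [true, false]) (.get [true, true, false]))) mul)
          (.get [true, false]))
        (.fork
          (.seq (.fork (.get [false]) (.fork (.get [true, true, false])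
            (.get [true, true, false]))) mul)
          (.op .div (.get [true, true, true]) (.lit 2)))))
    (Impl.straight rfl (by
      obtain ⟨t, ht⟩ := hsz fun _ _ => True
      exact ⟨t, fun x => ht ⟨x.1, x.2.1, x.2.2.1, x.2.2.2, trivial⟩⟩) (fun _ => rfl)) ?_ ?_
    (fun j => (a j, b j, m j)) ?_
  · refine Impl.congr (Impl.seq h (E := fun j s => PMF.pure (enc j s.1)) ?_) (fun _ => rfl) ?_
    · exact fun h' => Impl.straight rfl h' fun _ => rfl
    · intro j
      have h1 := congrArg (PMF.map (enc j))
        (iterWhile_mulPow (m j).size (a j) (b j) (m j) (Nat.lt_size_self _))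
      rw [PMF.map_comp, PMF.pure_map] at h1
      exact h1.symm
  · simp only [PMF.pure_map]
    have hsz' := (hsz fun j x => decide (x.2.2.2 ≠ 0) = true).reindex
      (J' := Σ j, {x : ℕ × (M j × M j × ℕ) // x.1 ≤ (m j).size ∧
        (x.2.2.2 < 2 ^ x.1 ∧ x.2.2.2 ≤ m j) ∧ decide (x.2.2.2 ≠ 0) = true}) fun x => x
    refine Impl.forkDet (Impl.straight rfl hsz' fun _ => rfl) (Impl.forkDet ?_
      (Impl.forkDet ?_ (Impl.straight rfl hsz' fun _ => rfl)))
    · refine Impl.cond (w := fun x => .nat (x.2.1.2.2.2 % 2))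
        (Impl.straight rfl hsz' fun _ => rfl) ?_ ?_
      · refine Impl.straightSeq rfl (hsz'.reindex Subtype.val) ?_
        obtain ⟨t, ht⟩ := hmul
        refine ⟨t, fun x => ?_⟩
        have hx := x.2
        simp only [ne_eq, Val.nat.injEq] at hx
        beta_reduce
        rw [if_neg hx]
        exact ht ⟨x.1.1, x.1.2.1.2.1, x.1.2.1.2.2.1⟩
      · refine Impl.straight rfl (hsz'.reindex Subtype.val) fun x => ?_
        have hx := x.2
        simp only [Val.nat.injEq] at hx
        rw [if_pos hx]
        rfl
    · refine Impl.straightSeq rfl hsz' ?_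
      obtain ⟨t, ht⟩ := hmul
      exact ⟨t, fun x => ht ⟨x.1, x.2.1.2.2.1, x.2.1.2.2.1⟩⟩
  · rintro j k ⟨a', b', m'⟩ - ⟨h1, h2⟩ ht
    simp only [ne_eq, decide_eq_true_eq] at ht h1 h2
    have hk : 0 < k := by
      by_contra hk
      obtain rfl : k = 0 := by omega
      simp at h1
      omega
    refine ⟨hk, fun s' hs' => ?_⟩
    rw [PMF.mem_support_pure_iff] at hs'
    subst hs'
    obtain ⟨k, rfl⟩ : ∃ k', k = k' + 1 := ⟨k - 1, by omega⟩
    rw [pow_succ] at h1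
    simp only [Nat.add_sub_cancel]
    omega
  · exact fun j => ⟨Nat.lt_size_self _, le_rfl⟩

end Impl

/-! ## The reduction -/

section Reduction

variable {F : ℕ → FuzzyKeySetting} (GG : GroupGen) (LS : LinearSketch F GG.orders)

/-- The choices of the challenger at the beginning of an experiment. -/
structure Setup where
  κ : ℕ
  d : Val
  pp : Val
  x : (F κ).X
  hd : d ∈ (GG.desc κ).support
  hpp : pp ∈ (LS.setup κ (GG.order d)).support
  hx : x ∈ (F κ).dist.support

namespace Setup

variable {GG LS} (i : Setup GG LS)

/-- The proxy key. -/
def key : ZMod (GG.order i.d) := (LS.sketch i.κ (GG.order i.d) i.pp i.x).2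

/-- The sketch. -/
def c : Val := (LS.sketch i.κ (GG.order i.d) i.pp i.x).1

/-- The public group element. -/
def h : GG.G i.d := GG.gen i.d ^ i.key.val

/-- The input of an adversary against the discrete logarithm problem with sketch. -/
def inp : Val :=
  .pair (ones i.κ) (.pair (.pair (GG.triple i.d) i.pp) (.pair (GG.enc i.d i.h) i.c))

theorem order_mem : GG.order i.d ∈ GG.orders i.κ := ⟨i.d, i.hd, rfl⟩

end Setup

namespace Prog

/-- Run a program on the component that remains after taking the first component `k` times. -/
def up (k : ℕ) (f : Prog) : Prog := .seq (get (List.replicate k false)) f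

/-- The string `1^κ` in the input of the reduction. -/
def inpOnes : Prog := get [false]

/-- The group in the input of the reduction. -/
def inpTriple : Prog := get [true, false, false]

/-- The group order in the input of the reduction. -/
def inpOrder : Prog := get [true, false, false, true, false]

/-- The generator in the input of the reduction. -/
def inpGen : Prog := get [true, false, false, true, true]

/-- The sketch parameter in the input of the reduction. -/
def inpPP : Prog := get [true, false, true]

/-- The group element in the input of the reduction. -/
def inpKey : Prog := get [true, true, false]

/-- The sketch in the input of the reduction. -/
def inpSketch : Prog := get [true, true, true]

/-- The number in a leaf, and `0` on a pair. -/
def num (f : Prog) : Prog := op .add f (lit 0)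

/-- Multiplication in the group, in the form required by `mulPow`. -/
def groupMul (Smul : Machine) : Prog :=
  .seq (.fork (get [false, false]) (.fork (get [false, true]) (get [true]))) Smul.prog

/-- The description of the group used by `groupMul`. -/
def groupCtx : Prog := .fork inpOnes inpTriple

/-- `(inp, (Δ, (β, (z, M))))` is mapped to the point at which the random oracle is queried. -/
def point (Smul : Machine) : Prog :=
  call (.fork (up 1 groupCtx) (.fork (up 1 inpKey) (.fork (up 1 inpGen) (get [true, false]))))
    (mulPow (groupMul Smul)) <|
  call (.fork (up 2 groupCtx) (.fork (up 2 inpGen) (.fork (up 2 inpGen)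
      (op .sub (op .add (num (up 1 (get [true, true, true, false]))) (up 2 inpOrder)) (lit 1)))))
    (mulPow (groupMul Smul)) <|
  call (.fork (up 3 groupCtx) (.fork (get [true]) (.fork (up 1 (get [true]))
      (op .mul (op .sub (up 3 inpOrder) (lit 1)) (num (up 2 (get [true, true, false])))))))
    (mulPow (groupMul Smul)) <|
  .fork (up 2 (get [true])) (.fork (get [true]) (up 3 (get [true, true, true, true])))

/-- Composition of a state of the simulated attack from its parts. -/
def state (inp run msg L : Prog) : Prog := .fork inp (.fork run (.fork msg L))

/-- Answer to a random oracle query `q`; the input is `(inp, (st, (L, q)))`. -/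
def answerHash : Prog :=
  call (.fork (get [true, true, true, true]) (get [true, true, false])) search <|
  .cond (.seq (get [true]) (.instr .isPair))
    (state (up 2 (.instr .id)) (lit 1)
      (.fork (up 1 (get [true, false])) (get [true, false, true, false]))
      (up 1 (get [true, true, false])))
    (call (up 2 inpOrder) .rand <|
      state (up 3 (.instr .id)) (lit 1) (.fork (up 2 (get [true, false])) (get [true]))
        (.fork (.fork (up 2 (get [true, true, true, true]))
          (.fork (get [true]) (.fork (lit 1) (up 2 (get [true, false])))))
          (up 2 (get [true, true, false]))))

/-- Final part of the answer to a signing query: the point is computed and the random oracle is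
programmed. The input is `((((inp, (st, (L, q))), e), (c, Δ)), β), z)`. -/
def signEnd (Smul : Machine) : Prog :=
  call (.fork (up 5 (.instr .id)) (.fork (up 2 (get [true, true])) (.fork (up 1 (get [true]))
    (.fork (get [true]) (up 4 (get [true, true, true, true])))))) (point Smul) <|
  call (.fork (get [true]) (up 5 (get [true, true, false]))) search <|
  .cond (.seq (get [true]) (.instr .isPair))
    (state (up 7 (.instr .id)) (lit 0) (lit 0) (up 6 (get [true, true, false])))
    (state (up 7 (.instr .id)) (lit 1)
      (.fork (up 6 (get [true, false])) (.fork (up 3 (get [true]))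
        (.fork (up 2 (get [true])) (up 4 (get [true, false])))))
      (.fork (.fork (up 1 (get [true])) (.fork (up 3 (get [true])) (.fork (lit 0) (lit 0))))
        (up 6 (get [true, true, false]))))

/-- Middle part of the answer to a signing query; the input is `((inp, (st, (L, q))), e)`. -/
def signMid (Smc Smul : Machine) : Prog :=
  call (.fork (.fork (up 2 inpOnes) (up 2 inpOrder))
    (.fork (up 2 inpPP) (.fork (up 2 inpSketch) (get [true])))) Smc.prog <|
  call (up 3 inpOrder) .rand <|
  call (up 4 inpOrder) .rand (signEnd Smul)

/-- Answer to a signing query `q`; the input is `(inp, (st, (L, q)))`. -/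
def answerSign (Serr Smc Smul : Machine) : Prog :=
  call (up 1 inpOnes) Serr.prog (signMid Smc Smul)

/-- Answer to a malformed query; the input is `(inp, (st, (L, q)))`. -/
def answerOther : Prog :=
  state (get [false]) (lit 1) (.fork (get [true, false]) (lit 0)) (get [true, true, false])

/-- Answer to a query `q`; the input is `(inp, (st, (L, q)))`. -/
def answer (Serr Smc Smul : Machine) : Prog :=
  .cond (.seq (get [true, true, true]) (.instr .isPair))
    (.cond (op .eq (get [true, true, true, false]) (lit 0)) answerHash
      (.cond (op .eq (get [true, true, true, false]) (lit 1)) (answerSign Serr Smc Smul)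
        answerOther))
    answerOther

end Prog

/-- Encoding of a state of the simulated attack, together with the input of the reduction. -/
def SimState.enc (inp : Val) (s : SimState) : Val :=
  .pair inp (.pair (.nat (if s.run then 1 else 0)) (.pair s.msg (encList s.L)))

theorem Val.add_zero_apply (v : Val) : Instr.add.apply (.pair v (.nat 0)) = .nat v.toNat := by
  cases v <;> rfl

variable {GG LS}

/-- The form in which the point is computed by `mulPow`. The inverse becomes the power with exponent
`p - 1`. Writing `g ^ z` as `g * g ^ (z + p - 1)` lets the accumulator start at `g`, so that no
string for the neutral element is needed. -/
theorem Setup.point_eq (i : Setup GG LS) (h : GG.G i.d) (Δ β z : ℕ) (M : Val) :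
    schnorrPoint GG i.d h Δ β z M = .pair (GG.enc i.d (h * GG.gen i.d ^ Δ))
      (.pair (GG.enc i.d (GG.gen i.d * GG.gen i.d ^ (z + GG.order i.d - 1) *
        (h * GG.gen i.d ^ Δ) ^ ((GG.order i.d - 1) * β))) M) := by
  have hp := (GroupGen.fact_prime i.hd).out.one_le
  have hcard : ∀ a : GG.G i.d, a ^ GG.order i.d = 1 := fun a => by
    rw [← GG.card_eq i.κ i.d i.hd]
    exact pow_card_eq_one'
  have h1 : GG.gen i.d * GG.gen i.d ^ (z + GG.order i.d - 1) = GG.gen i.d ^ z := by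
    rw [← pow_succ', show z + GG.order i.d - 1 + 1 = z + GG.order i.d by omega, pow_add, hcard,
      mul_one]
  have h2 : ∀ a : GG.G i.d, (a ^ β)⁻¹ = a ^ ((GG.order i.d - 1) * β) := fun a => by
    have h3 : β + (GG.order i.d - 1) * β = GG.order i.d * β := by
      obtain ⟨m, hm⟩ : ∃ m, GG.order i.d = m + 1 := ⟨GG.order i.d - 1, by omega⟩
      rw [hm, Nat.add_sub_cancel]
      ring
    rw [inv_eq_iff_mul_eq_one, ← pow_add, h3, pow_mul, hcard, one_pow]
  rw [schnorrPoint, hashInput, h1, h2]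

section Programs

variable (hinp : PolySized (Setup.κ (GG := GG) (LS := LS)) Setup.inp)

theorem Setup.sized_order (hinp : PolySized (Setup.κ (GG := GG) (LS := LS)) Setup.inp) :
    PolySized (Setup.κ (GG := GG) (LS := LS)) fun i => .nat (GG.order i.d) :=
  hinp.of_pair_right.of_pair_left.of_pair_left.of_pair_right.of_pair_left

include hinp in
theorem Impl.groupMul {Smul : Machine}
    (hSmul : ∀ κ, ∀ d ∈ (GG.desc κ).support, ∀ a b : GG.G d, Smul.Computes
      (.pair (ones κ) (.pair (GG.triple d) (.pair (GG.enc d a) (GG.enc d b)))) (GG.enc d (a * b))) :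
    Impl (J := Σ i : Setup GG LS, GG.G i.d × GG.G i.d) (fun x => x.1.κ) (Prog.groupMul Smul)
      (fun x => .pair (.pair (ones x.1.κ) (GG.triple x.1.d))
        (.pair (GG.enc x.1.d x.2.1) (GG.enc x.1.d x.2.2)))
      fun x => PMF.pure (GG.enc x.1.d (x.2.1 * x.2.2)) := by
  obtain ⟨P, hP⟩ := GG.enc_size
  have h1 := hinp.of_pair_left.reindex (J' := Σ i : Setup GG LS, GG.G i.d × GG.G i.d) Sigma.fst
  have h2 := hinp.of_pair_right.of_pair_left.of_pair_left.reindex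
    (J' := Σ i : Setup GG LS, GG.G i.d × GG.G i.d) Sigma.fst
  have h3 : PolySized (J := Σ i : Setup GG LS, GG.G i.d × GG.G i.d) (fun x => x.1.κ)
    fun x => GG.enc x.1.d x.2.1 := ⟨P, fun x => hP _ _ x.1.hd _⟩
  have h4 : PolySized (J := Σ i : Setup GG LS, GG.G i.d × GG.G i.d) (fun x => x.1.κ)
    fun x => GG.enc x.1.d x.2.2 := ⟨P, fun x => hP _ _ x.1.hd _⟩
  refine Impl.straightSeq rfl ((h1.pair h2).pair (h3.pair h4)) ?_
  exact Impl.machine (h1.pair (h2.pair (h3.pair h4))) fun x => hSmul _ _ x.1.hd _ _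

variable {J : Type} (i : J → Setup GG LS)

include hinp in
-- `β` and `z` are arbitrary values read through `toNat`, since they may stem from a forgery of the
-- wrong shape.
theorem Impl.point {Smul : Machine}
    (hSmul : ∀ κ, ∀ d ∈ (GG.desc κ).support, ∀ a b : GG.G d, Smul.Computes
      (.pair (ones κ) (.pair (GG.triple d) (.pair (GG.enc d a) (GG.enc d b)))) (GG.enc d (a * b)))
    {Δ : J → ℕ} {β z M : J → Val} (hv : PolySized (fun j => (i j).κ) fun j =>
      .pair (i j).inp (.pair (.nat (Δ j)) (.pair (β j) (.pair (z j) (M j))))) :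
    Impl (fun j => (i j).κ) (Prog.point Smul)
      (fun j => .pair (i j).inp (.pair (.nat (Δ j)) (.pair (β j) (.pair (z j) (M j)))))
      fun j => PMF.pure
        (schnorrPoint GG (i j).d (i j).h (Δ j) (β j).toNat (z j).toNat (M j)) := by
  have hmul : Impl (J := Σ j : J, GG.G (i j).d × GG.G (i j).d) (fun x => (i x.1).κ)
      (Prog.groupMul Smul)
      (fun x => .pair (.pair (ones (i x.1).κ) (GG.triple (i x.1).d))
        (.pair (GG.enc (i x.1).d x.2.1) (GG.enc (i x.1).d x.2.2)))
      fun x => PMF.pure (GG.enc (i x.1).d (x.2.1 * x.2.2)) := by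
    obtain ⟨t, ht⟩ := Impl.groupMul hinp hSmul
    exact ⟨t, fun x => ht ⟨i x.1, x.2⟩⟩
  have hp := (Setup.sized_order hinp).reindex i
  have hnum : ∀ {f : J → Val}, PolySized (fun j => (i j).κ) f →
      PolySized (fun j => (i j).κ) fun j => .nat (f j).toNat := fun {f} hf => hf.mono fun j => by
    cases f j <;> simp [Val.toNat, Val.size]
  refine Impl.callDet (w := fun j => .pair (.pair (ones (i j).κ) (GG.triple (i j).d))
      (.pair (GG.enc (i j).d (i j).h) (.pair (GG.enc (i j).d (GG.gen (i j).d)) (.nat (Δ j)))))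
    rfl hv (fun _ => rfl)
    (Impl.mulPow (M := fun j => GG.G (i j).d) (enc := fun j => GG.enc (i j).d) hmul
      (fun j => (i j).h) (fun j => GG.gen (i j).d) hv.of_pair_right.of_pair_left) fun hv₁ => ?_
  refine Impl.callDet (w := fun j => .pair (.pair (ones (i j).κ) (GG.triple (i j).d))
      (.pair (GG.enc (i j).d (GG.gen (i j).d)) (.pair (GG.enc (i j).d (GG.gen (i j).d))
        (.nat ((z j).toNat + GG.order (i j).d - 1)))))
    rfl hv₁ (fun j => ?_)
    (Impl.mulPow (M := fun j => GG.G (i j).d) (enc := fun j => GG.enc (i j).d) hmul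
      (fun j => GG.gen (i j).d) (fun j => GG.gen (i j).d) ?_) fun hv₂ => ?_
  -- Adding the constant `0` keeps a number and turns a pair into `0`, which is how the program
  -- evaluates `toNat`.
  · change Val.pair _ (.pair _ (.pair _ (Instr.sub.apply (.pair (Instr.add.apply
      (.pair (Instr.add.apply (.pair (z j) (.nat 0))) _)) _)))) = _
    rw [Val.add_zero_apply]
    rfl
  · exact ((hnum hv.of_pair_right.of_pair_right.of_pair_right.of_pair_left).nat_add hp).nat_mono
      fun j => Nat.sub_le _ _
  refine Impl.callDet (w := fun j => .pair (.pair (ones (i j).κ) (GG.triple (i j).d))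
      (.pair (GG.enc (i j).d (GG.gen (i j).d * GG.gen (i j).d ^
          ((z j).toNat + GG.order (i j).d - 1)))
        (.pair (GG.enc (i j).d ((i j).h * GG.gen (i j).d ^ Δ j))
          (.nat ((GG.order (i j).d - 1) * (β j).toNat)))))
    rfl hv₂ (fun j => ?_)
    (Impl.mulPow (M := fun j => GG.G (i j).d) (enc := fun j => GG.enc (i j).d) hmul
      (fun j => GG.gen (i j).d * GG.gen (i j).d ^ ((z j).toNat + GG.order (i j).d - 1))
      (fun j => (i j).h * GG.gen (i j).d ^ Δ j) ?_) fun hv₃ => ?_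
  · change Val.pair _ (.pair _ (.pair _ (Instr.mul.apply (.pair _ (Instr.add.apply
      (.pair (β j) (.nat 0))))))) = _
    rw [Val.add_zero_apply]
    rfl
  · exact (hp.nat_mono fun j => Nat.sub_le _ _).nat_mul
      (hnum hv.of_pair_right.of_pair_right.of_pair_left)
  exact Impl.straight rfl hv₃ fun j => by rw [Setup.point_eq]; rfl

end Programs

end Reduction

/-! ### Programs that answer the oracle queries -/

section Reduction

variable {F : ℕ → FuzzyKeySetting} {GG : GroupGen} {LS : LinearSketch F GG.orders}
  (mc : (κ p : ℕ) → (pp c : Val) → (F κ).X → Val × ZMod p) (A : Machine)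

/-- The simulated attack for the given choices of the challenger. -/
noncomputable def Setup.sim (i : Setup GG LS) : Simulation := schnorrSim GG LS mc A i.κ i.d i.pp i.x

variable {mc A}
variable (hinp : PolySized (Setup.κ (GG := GG) (LS := LS)) Setup.inp)
variable {J : Type} (i : J → Setup GG LS)

include hinp in
theorem Impl.answerHash {y st : J → Val} {L : J → List Entry}
    (hv : PolySized (fun j => (i j).κ) fun j =>
      .pair (i j).inp (.pair (st j) (.pair (encList (L j)) (.pair (.nat 0) (y j))))) :
    Impl (fun j => (i j).κ) Prog.answerHash
      (fun j => .pair (i j).inp (.pair (st j) (.pair (encList (L j)) (.pair (.nat 0) (y j)))))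
      fun j => (((i j).sim mc A).answer (.pair (.nat 0) (y j)) (st j) (L j)).map
        (SimState.enc (i j).inp) := by
  refine Impl.callDet (w := fun j => .pair (y j) (encList (L j))) rfl hv (fun _ => rfl)
    (Impl.search hv.of_pair_right.of_pair_right.of_pair_right.of_pair_right
      hv.of_pair_right.of_pair_right.of_pair_left) fun hv₁ => ?_
  have hc : ∀ j, (Prog.seq (.get [true]) (.instr .isPair)).denote
      (.pair (.pair (i j).inp (.pair (st j) (.pair (encList (L j)) (.pair (.nat 0) (y j)))))
        (encList (lookup (L j) (y j)))) = .nat 0 ↔ ¬ lookup (L j) (y j) ≠ [] := fun j => by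
    cases lookup (L j) (y j) <;> simp [Prog.denote, Prog.get, Instr.apply, encList]
  refine Impl.ite rfl hv₁ hc ?_ ?_
  · refine Impl.straight_denote rfl (hv₁.reindex Subtype.val) ?_
    rintro ⟨j, hj⟩
    simp only
    obtain ⟨e, L', hlook⟩ := List.exists_cons_of_ne_nil hj
    simp only [Simulation.answer, hlook, PMF.pure_map]
    rfl
  · refine (Impl.call (J := {j // ¬ lookup (L j) (y j) ≠ []}) (α := fun _ => ℕ)
      (D := fun j => unif (GG.order (i j.1).d))
      (w := fun j => .nat (GG.order (i j.1).d)) (φ := fun _ b => .nat b)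
      (E := fun j b => PMF.pure (SimState.enc (i j.1).inp ⟨true, .pair (st j.1) (.nat b),
        ⟨y j.1, b, true, st j.1⟩ :: L j.1⟩))
      rfl (hv₁.reindex Subtype.val) (fun _ => rfl)
      (Impl.rand (((Setup.sized_order hinp).reindex i).reindex Subtype.val))
      fun hv₂ => Impl.straight rfl hv₂ fun _ => rfl).congr (fun _ => rfl) ?_
    rintro ⟨j, hj⟩
    simp only [ne_eq, not_not] at hj ⊢
    simp only [Simulation.answer, hj, PMF.map_bind, PMF.pure_map]
    rfl

/-- The state after a simulated signature. -/
noncomputable def Simulation.signed (S : Simulation) (M st : Val) (L : List Entry) (e : S.X)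
    (β z : ℕ) : SimState :=
  match lookup L (S.point e M β z) with
  | _ :: _ => ⟨false, .nat 0, L⟩
  | [] => ⟨true, .pair st (.pair (.nat β) (.pair (.nat z) (S.ct e))),
      ⟨S.point e M β z, β, false, .nat 0⟩ :: L⟩

theorem Simulation.answer_sign (S : Simulation) (M st : Val) (L : List Entry) :
    S.answer (.pair (.nat 1) M) st L = S.err.bind fun e => (unif S.p).bind fun β =>
      (unif S.p).bind fun z => PMF.pure (S.signed M st L e β z) := by
  simp only [answer, signed]
  refine PMF.bind_congr_support fun e _ => PMF.bind_congr_support fun β _ =>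
    PMF.bind_congr_support fun z _ => ?_
  cases lookup L (S.point e M β z) <;> rfl

include hinp in
-- At this stage the error, `β` and `z` have been sampled, so the remaining work is deterministic:
-- find the point, look it up, and either stop or program the oracle.
theorem Impl.signEnd {Smul : Machine}
    (hSmul : ∀ κ, ∀ d ∈ (GG.desc κ).support, ∀ a b : GG.G d, Smul.Computes
      (.pair (ones κ) (.pair (GG.triple d) (.pair (GG.enc d a) (GG.enc d b)))) (GG.enc d (a * b)))
    {M st ev : J → Val} {L : J → List Entry} {e : ∀ j, (F (i j).κ).X} {β z : J → ℕ}
    (hv : PolySized (fun j => (i j).κ) fun j => .pair (.pair (.pair (.pair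
      (.pair (i j).inp (.pair (st j) (.pair (encList (L j)) (.pair (.nat 1) (M j))))) (ev j))
      (.pair (mc (i j).κ (GG.order (i j).d) (i j).pp (i j).c (e j)).1
        (.nat (mc (i j).κ (GG.order (i j).d) (i j).pp (i j).c (e j)).2.val)))
      (.nat (β j))) (.nat (z j))) :
    Impl (fun j => (i j).κ) (Prog.signEnd Smul)
      (fun j => .pair (.pair (.pair (.pair
        (.pair (i j).inp (.pair (st j) (.pair (encList (L j)) (.pair (.nat 1) (M j))))) (ev j))
        (.pair (mc (i j).κ (GG.order (i j).d) (i j).pp (i j).c (e j)).1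
          (.nat (mc (i j).κ (GG.order (i j).d) (i j).pp (i j).c (e j)).2.val)))
        (.nat (β j))) (.nat (z j)))
      fun j => PMF.pure (SimState.enc (i j).inp
        (((i j).sim mc A).signed (M j) (st j) (L j) (e j) (β j) (z j))) := by
  have hv₀ := hv.of_pair_left.of_pair_left.of_pair_left.of_pair_left
  have hpt : PolySized (fun j => (i j).κ) fun j => .pair (i j).inp
      (.pair (.nat (mc (i j).κ (GG.order (i j).d) (i j).pp (i j).c (e j)).2.val)
        (.pair (.nat (β j)) (.pair (.nat (z j)) (M j)))) :=
    hv₀.of_pair_left.pair (hv.of_pair_left.of_pair_left.of_pair_right.of_pair_right.pair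
        (hv.of_pair_left.of_pair_right.pair (hv.of_pair_right.pair
          hv₀.of_pair_right.of_pair_right.of_pair_right.of_pair_right)))
  refine Impl.callDet (w := fun j => .pair (i j).inp
      (.pair (.nat (mc (i j).κ (GG.order (i j).d) (i j).pp (i j).c (e j)).2.val)
        (.pair (.nat (β j)) (.pair (.nat (z j)) (M j)))))
    (u := fun j => ((i j).sim mc A).point (e j) (M j) (β j) (z j)) rfl hv (fun _ => rfl)
    (Impl.point hinp i hSmul hpt) fun hv₅ => ?_
  refine Impl.callDet
    (w := fun j => .pair (((i j).sim mc A).point (e j) (M j) (β j) (z j)) (encList (L j)))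
    (u := fun j => encList (lookup (L j) (((i j).sim mc A).point (e j) (M j) (β j) (z j))))
    rfl hv₅ (fun _ => rfl)
    (Impl.search hv₅.of_pair_right hv₀.of_pair_right.of_pair_right.of_pair_left) fun hv₆ => ?_
  refine Impl.ite
    (c := fun j => lookup (L j) (((i j).sim mc A).point (e j) (M j) (β j) (z j)) ≠ [])
    rfl hv₆ (fun j => ?_) ?_ ?_
  · cases lookup (L j) (((i j).sim mc A).point (e j) (M j) (β j) (z j)) <;>
      simp [Prog.denote, Prog.get, Instr.apply, encList]
  · refine Impl.straight_denote rfl (hv₆.reindex Subtype.val) ?_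
    rintro ⟨j, hj⟩
    obtain ⟨e, L', hlook⟩ := List.exists_cons_of_ne_nil hj
    simp only [Simulation.signed, hlook]
    rfl
  · refine Impl.straight_denote rfl (hv₆.reindex Subtype.val) ?_
    rintro ⟨j, hj⟩
    simp only [ne_eq, not_not] at hj
    simp only [Simulation.signed, hj]
    rfl

include hinp in
-- This is where linearity is used algorithmically: the new sketch and the shift are computed from
-- `c` and `e` only, without `x`.
theorem Impl.signMid {Smc Smul : Machine}
    (hSmc : ∀ κ, ∀ p ∈ GG.orders κ, ∀ pp ∈ (LS.setup κ p).support, ∀ x e : (F κ).X,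
      Smc.Computes
        (.pair (.pair (ones κ) (.nat p)) (.pair pp (.pair (LS.sketch κ p pp x).1 ((F κ).enc e))))
        (.pair (mc κ p pp (LS.sketch κ p pp x).1 e).1
          (.nat (mc κ p pp (LS.sketch κ p pp x).1 e).2.val)))
    (hSmul : ∀ κ, ∀ d ∈ (GG.desc κ).support, ∀ a b : GG.G d, Smul.Computes
      (.pair (ones κ) (.pair (GG.triple d) (.pair (GG.enc d a) (GG.enc d b)))) (GG.enc d (a * b)))
    {M st : J → Val} {L : J → List Entry} {e : ∀ j, (F (i j).κ).X}
    (hv : PolySized (fun j => (i j).κ) fun j =>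
      .pair (.pair (i j).inp (.pair (st j) (.pair (encList (L j)) (.pair (.nat 1) (M j)))))
        ((F (i j).κ).enc (e j))) :
    Impl (fun j => (i j).κ) (Prog.signMid Smc Smul)
      (fun j => .pair (.pair (i j).inp (.pair (st j) (.pair (encList (L j)) (.pair (.nat 1) (M j)))))
        ((F (i j).κ).enc (e j)))
      fun j => (unif (GG.order (i j).d)).bind fun β => (unif (GG.order (i j).d)).bind fun z =>
        PMF.pure (SimState.enc (i j).inp (((i j).sim mc A).signed (M j) (st j) (L j) (e j) β z)) := by
  have hp := (Setup.sized_order hinp).reindex i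
  have hi := hv.of_pair_left.of_pair_left
  refine Impl.callDet
    (w := fun j => .pair (.pair (ones (i j).κ) (.nat (GG.order (i j).d)))
      (.pair (i j).pp (.pair (i j).c ((F (i j).κ).enc (e j)))))
    (u := fun j => (.pair (mc (i j).κ (GG.order (i j).d) (i j).pp (i j).c (e j)).1
        (.nat (mc (i j).κ (GG.order (i j).d) (i j).pp (i j).c (e j)).2.val))) rfl hv (fun _ => rfl)
    (Impl.machine ((hi.of_pair_left.pair hp).pair
      (hi.of_pair_right.of_pair_left.of_pair_right.pair
        (hi.of_pair_right.of_pair_right.of_pair_right.pair hv.of_pair_right)))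
      fun j => hSmc _ _ (i j).order_mem _ (i j).hpp _ _) fun hv₂ => ?_
  refine Impl.call (α := fun _ => ℕ) (D := fun j => unif (GG.order (i j).d))
      (w := fun j => .nat (GG.order (i j).d)) (φ := fun _ b => .nat b)
      rfl hv₂ (fun _ => rfl) (Impl.rand hp) fun hv₃ => ?_
  refine Impl.call (J := Σ j, {b // b ∈ (unif (GG.order (i j).d)).support}) (α := fun _ => ℕ)
      (D := fun x => unif (GG.order (i x.1).d))
      (w := fun x => .nat (GG.order (i x.1).d)) (φ := fun _ b => .nat b)
      rfl hv₃ (fun _ => rfl) (Impl.rand (hp.reindex Sigma.fst)) fun hv₄ => ?_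
  exact Impl.signEnd hinp (J := Σ x : (Σ j, {b // b ∈ (unif (GG.order (i j).d)).support}),
    {b // b ∈ (unif (GG.order (i x.1).d)).support}) (fun x => i x.1.1) hSmul
    (ev := fun x => (F (i x.1.1).κ).enc (e x.1.1)) (e := fun x => e x.1.1) hv₄

include hinp in
theorem Impl.answerSign {Serr Smc Smul : Machine}
    (hSerr : ∀ κ, Serr.Samples (ones κ) ((F κ).err.map (F κ).enc))
    (hSmc : ∀ κ, ∀ p ∈ GG.orders κ, ∀ pp ∈ (LS.setup κ p).support, ∀ x e : (F κ).X,
      Smc.Computes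
        (.pair (.pair (ones κ) (.nat p)) (.pair pp (.pair (LS.sketch κ p pp x).1 ((F κ).enc e))))
        (.pair (mc κ p pp (LS.sketch κ p pp x).1 e).1
          (.nat (mc κ p pp (LS.sketch κ p pp x).1 e).2.val)))
    (hSmul : ∀ κ, ∀ d ∈ (GG.desc κ).support, ∀ a b : GG.G d, Smul.Computes
      (.pair (ones κ) (.pair (GG.triple d) (.pair (GG.enc d a) (GG.enc d b)))) (GG.enc d (a * b)))
    {M st : J → Val} {L : J → List Entry}
    (hv : PolySized (fun j => (i j).κ) fun j =>
      .pair (i j).inp (.pair (st j) (.pair (encList (L j)) (.pair (.nat 1) (M j))))) :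
    Impl (fun j => (i j).κ) (Prog.answerSign Serr Smc Smul)
      (fun j => .pair (i j).inp (.pair (st j) (.pair (encList (L j)) (.pair (.nat 1) (M j)))))
      fun j => (((i j).sim mc A).answer (.pair (.nat 1) (M j)) (st j) (L j)).map
        (SimState.enc (i j).inp) := by
  refine (Impl.call (α := fun j => (F (i j).κ).X) (D := fun j => (F (i j).κ).err)
    (w := fun j => ones (i j).κ) (φ := fun j e => (F (i j).κ).enc e)
    (E := fun j e => (unif (GG.order (i j).d)).bind fun β => (unif (GG.order (i j).d)).bind fun z =>
      PMF.pure (SimState.enc (i j).inp (((i j).sim mc A).signed (M j) (st j) (L j) e β z)))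
    rfl hv (fun _ => rfl) (Impl.machine hv.of_pair_left.of_pair_left fun j => hSerr _)
    fun hv₁ => ?_).congr (fun _ => rfl) ?_
  · exact Impl.signMid hinp (J := Σ j, {e // e ∈ (F (i j).κ).err.support}) (fun x => i x.1) hSmc
      hSmul (e := fun x => x.2.1) hv₁
  · intro j
    simp only [Simulation.answer_sign, PMF.map_bind, PMF.pure_map]
    rfl

include hinp in
theorem Impl.answerHash_of_eq 
    {q st : J → Val} {L : J → List Entry} (hq : ∀ j, ∃ y, q j = .pair (.nat 0) y)
    (hv : PolySized (fun j => (i j).κ) fun j =>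
      .pair (i j).inp (.pair (st j) (.pair (encList (L j)) (q j)))) :
    Impl (fun j => (i j).κ) Prog.answerHash
      (fun j => .pair (i j).inp (.pair (st j) (.pair (encList (L j)) (q j))))
      fun j => (((i j).sim mc A).answer (q j) (st j) (L j)).map (SimState.enc (i j).inp) := by
  choose y hy using hq
  obtain rfl : q = fun j => .pair (.nat 0) (y j) := funext hy
  exact Impl.answerHash hinp i hv

include hinp in
theorem Impl.answerSign_of_eq {Serr Smc Smul : Machine}
    (hSerr : ∀ κ, Serr.Samples (ones κ) ((F κ).err.map (F κ).enc))
    (hSmc : ∀ κ, ∀ p ∈ GG.orders κ, ∀ pp ∈ (LS.setup κ p).support, ∀ x e : (F κ).X,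
      Smc.Computes
        (.pair (.pair (ones κ) (.nat p)) (.pair pp (.pair (LS.sketch κ p pp x).1 ((F κ).enc e))))
        (.pair (mc κ p pp (LS.sketch κ p pp x).1 e).1
          (.nat (mc κ p pp (LS.sketch κ p pp x).1 e).2.val)))
    (hSmul : ∀ κ, ∀ d ∈ (GG.desc κ).support, ∀ a b : GG.G d, Smul.Computes
      (.pair (ones κ) (.pair (GG.triple d) (.pair (GG.enc d a) (GG.enc d b)))) (GG.enc d (a * b)))
    {q st : J → Val} {L : J → List Entry} (hq : ∀ j, ∃ y, q j = .pair (.nat 1) y)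
    (hv : PolySized (fun j => (i j).κ) fun j =>
      .pair (i j).inp (.pair (st j) (.pair (encList (L j)) (q j)))) :
    Impl (fun j => (i j).κ) (Prog.answerSign Serr Smc Smul)
      (fun j => .pair (i j).inp (.pair (st j) (.pair (encList (L j)) (q j))))
      fun j => (((i j).sim mc A).answer (q j) (st j) (L j)).map (SimState.enc (i j).inp) := by
  choose y hy using hq
  obtain rfl : q = fun j => .pair (.nat 1) (y j) := funext hy
  exact Impl.answerSign hinp i hSerr hSmc hSmul hv

theorem Simulation.answer_other (S : Simulation) {q : Val} (st : Val) (L : List Entry)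
    (h0 : ∀ y, q ≠ .pair (.nat 0) y) (h1 : ∀ y, q ≠ .pair (.nat 1) y) :
    S.answer q st L = PMF.pure ⟨true, .pair st (.nat 0), L⟩ := by
  unfold Simulation.answer
  split
  · exact absurd rfl (h0 _)
  · exact absurd rfl (h1 _)
  · rfl

theorem Impl.answerOther {q st : J → Val} {L : J → List Entry}
    (h0 : ∀ j y, q j ≠ .pair (.nat 0) y) (h1 : ∀ j y, q j ≠ .pair (.nat 1) y)
    (hv : PolySized (fun j => (i j).κ) fun j =>
      .pair (i j).inp (.pair (st j) (.pair (encList (L j)) (q j)))) :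
    Impl (fun j => (i j).κ) Prog.answerOther
      (fun j => .pair (i j).inp (.pair (st j) (.pair (encList (L j)) (q j))))
      fun j => (((i j).sim mc A).answer (q j) (st j) (L j)).map (SimState.enc (i j).inp) := by
  refine Impl.straight_denote rfl hv fun j => ?_
  rw [Simulation.answer_other _ _ _ (h0 j) (h1 j), PMF.pure_map]
  rfl

include hinp in
theorem Impl.answerNonHash {Serr Smc Smul : Machine}
    (hSerr : ∀ κ, Serr.Samples (ones κ) ((F κ).err.map (F κ).enc))
    (hSmc : ∀ κ, ∀ p ∈ GG.orders κ, ∀ pp ∈ (LS.setup κ p).support, ∀ x e : (F κ).X,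
      Smc.Computes
        (.pair (.pair (ones κ) (.nat p)) (.pair pp (.pair (LS.sketch κ p pp x).1 ((F κ).enc e))))
        (.pair (mc κ p pp (LS.sketch κ p pp x).1 e).1
          (.nat (mc κ p pp (LS.sketch κ p pp x).1 e).2.val)))
    (hSmul : ∀ κ, ∀ d ∈ (GG.desc κ).support, ∀ a b : GG.G d, Smul.Computes
      (.pair (ones κ) (.pair (GG.triple d) (.pair (GG.enc d a) (GG.enc d b)))) (GG.enc d (a * b)))
    {q st : J → Val} {L : J → List Entry} (hq : ∀ j, ∃ a b, q j = .pair a b)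
    (h0 : ∀ j y, q j ≠ .pair (.nat 0) y)
    (hv : PolySized (fun j => (i j).κ) fun j =>
      .pair (i j).inp (.pair (st j) (.pair (encList (L j)) (q j)))) :
    Impl (fun j => (i j).κ)
      (.cond (.op .eq (.get [true, true, true, false]) (.lit 1)) (.answerSign Serr Smc Smul)
        .answerOther)
      (fun j => .pair (i j).inp (.pair (st j) (.pair (encList (L j)) (q j))))
      fun j => (((i j).sim mc A).answer (q j) (st j) (L j)).map (SimState.enc (i j).inp) := by
  refine Impl.ite (c := fun j => ∃ y, q j = .pair (.nat 1) y) rfl hv (fun j => ?_) ?_ ?_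
  · obtain ⟨a, b, hj⟩ := hq j
    by_cases ha : a = .nat 1 <;>
      simp [Prog.denote, Prog.get, Prog.op, Prog.lit, Instr.apply, hj, ha]
  · exact Impl.answerSign_of_eq (J := {j // ∃ y, q j = .pair (.nat 1) y}) hinp
      (fun x => i x.1) hSerr hSmc hSmul (q := fun x => q x.1) (st := fun x => st x.1)
      (L := fun x => L x.1) (fun x => x.2) (hv.reindex Subtype.val)
  · exact Impl.answerOther (J := {j // ¬ ∃ y, q j = .pair (.nat 1) y})
      (fun x => i x.1) (q := fun x => q x.1) (st := fun x => st x.1)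
      (L := fun x => L x.1) (fun x => h0 x.1) (fun x y h => x.2 ⟨y, h⟩) (hv.reindex Subtype.val)

include hinp in
theorem Impl.answerPair {Serr Smc Smul : Machine}
    (hSerr : ∀ κ, Serr.Samples (ones κ) ((F κ).err.map (F κ).enc))
    (hSmc : ∀ κ, ∀ p ∈ GG.orders κ, ∀ pp ∈ (LS.setup κ p).support, ∀ x e : (F κ).X,
      Smc.Computes
        (.pair (.pair (ones κ) (.nat p)) (.pair pp (.pair (LS.sketch κ p pp x).1 ((F κ).enc e))))
        (.pair (mc κ p pp (LS.sketch κ p pp x).1 e).1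
          (.nat (mc κ p pp (LS.sketch κ p pp x).1 e).2.val)))
    (hSmul : ∀ κ, ∀ d ∈ (GG.desc κ).support, ∀ a b : GG.G d, Smul.Computes
      (.pair (ones κ) (.pair (GG.triple d) (.pair (GG.enc d a) (GG.enc d b)))) (GG.enc d (a * b)))
    {q st : J → Val} {L : J → List Entry} (hq : ∀ j, ∃ a b, q j = .pair a b)
    (hv : PolySized (fun j => (i j).κ) fun j =>
      .pair (i j).inp (.pair (st j) (.pair (encList (L j)) (q j)))) :
    Impl (fun j => (i j).κ)
      (.cond (.op .eq (.get [true, true, true, false]) (.lit 0)) .answerHash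
        (.cond (.op .eq (.get [true, true, true, false]) (.lit 1)) (.answerSign Serr Smc Smul)
          .answerOther))
      (fun j => .pair (i j).inp (.pair (st j) (.pair (encList (L j)) (q j))))
      fun j => (((i j).sim mc A).answer (q j) (st j) (L j)).map (SimState.enc (i j).inp) := by
  refine Impl.ite (c := fun j => ∃ y, q j = .pair (.nat 0) y) rfl hv (fun j => ?_) ?_ ?_
  · obtain ⟨a, b, hj⟩ := hq j
    by_cases ha : a = .nat 0 <;>
      simp [Prog.denote, Prog.get, Prog.op, Prog.lit, Instr.apply, hj, ha]
  · exact Impl.answerHash_of_eq (J := {j // ∃ y, q j = .pair (.nat 0) y}) hinp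
      (fun x => i x.1) (q := fun x => q x.1) (st := fun x => st x.1)
      (L := fun x => L x.1) (fun x => x.2) (hv.reindex Subtype.val)
  · exact Impl.answerNonHash (J := {j // ¬ ∃ y, q j = .pair (.nat 0) y}) hinp
      (fun x => i x.1) hSerr hSmc hSmul (q := fun x => q x.1) (st := fun x => st x.1)
      (L := fun x => L x.1) (fun x => hq x.1) (fun x y h => x.2 ⟨y, h⟩) (hv.reindex Subtype.val)

include hinp in
theorem Impl.answer {Serr Smc Smul : Machine}
    (hSerr : ∀ κ, Serr.Samples (ones κ) ((F κ).err.map (F κ).enc))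
    (hSmc : ∀ κ, ∀ p ∈ GG.orders κ, ∀ pp ∈ (LS.setup κ p).support, ∀ x e : (F κ).X,
      Smc.Computes
        (.pair (.pair (ones κ) (.nat p)) (.pair pp (.pair (LS.sketch κ p pp x).1 ((F κ).enc e))))
        (.pair (mc κ p pp (LS.sketch κ p pp x).1 e).1
          (.nat (mc κ p pp (LS.sketch κ p pp x).1 e).2.val)))
    (hSmul : ∀ κ, ∀ d ∈ (GG.desc κ).support, ∀ a b : GG.G d, Smul.Computes
      (.pair (ones κ) (.pair (GG.triple d) (.pair (GG.enc d a) (GG.enc d b)))) (GG.enc d (a * b)))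
    {q st : J → Val} {L : J → List Entry}
    (hv : PolySized (fun j => (i j).κ) fun j =>
      .pair (i j).inp (.pair (st j) (.pair (encList (L j)) (q j)))) :
    Impl (fun j => (i j).κ) (Prog.answer Serr Smc Smul)
      (fun j => .pair (i j).inp (.pair (st j) (.pair (encList (L j)) (q j))))
      fun j => (((i j).sim mc A).answer (q j) (st j) (L j)).map (SimState.enc (i j).inp) := by
  refine Impl.ite (c := fun j => ∃ a b, q j = .pair a b) rfl hv (fun j => ?_) ?_ ?_
  · cases h : q j <;> simp [Prog.denote, Prog.get, Instr.apply]
  · exact Impl.answerPair (J := {j // ∃ a b, q j = .pair a b}) hinp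
      (fun x => i x.1) hSerr hSmc hSmul (q := fun x => q x.1) (st := fun x => st x.1)
      (L := fun x => L x.1) (fun x => x.2) (hv.reindex Subtype.val)
  · exact Impl.answerOther (J := {j // ¬ ∃ a b, q j = .pair a b})
      (fun x => i x.1) (q := fun x => q x.1) (st := fun x => st x.1)
      (L := fun x => L x.1) (fun x y h => x.2 ⟨_, y, h⟩) (fun x y h => x.2 ⟨_, y, h⟩)
      (hv.reindex Subtype.val)

end Reduction

/-! ### Programs for one activation of the adversary -/

namespace Prog

/-- Whether the result of an activation of the adversary is a query; the input is `(state, result)`. -/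
def isQuery : Prog :=
  .cond (op .eq (get [true, false]) (lit 1)) (.seq (get [true, true]) (.instr .isPair)) (lit 0)

/-- Reaction to the result of an activation of the adversary; the input is `(state, result)`. -/
def react (Serr Smc Smul : Machine) : Prog :=
  .cond isQuery
    (.seq (.fork (get [false, false]) (.fork (get [true, true, true])
      (.fork (get [false, true, true, true]) (get [true, true, false])))) (answer Serr Smc Smul))
    (state (get [false, false]) (lit 0) (get [true, true]) (get [false, true, true, true]))

/-- One activation of the adversary in a simulated attack. -/
def step (A Serr Smc Smul : Machine) : Prog :=
  call (get [true, true, false]) A.prog (react Serr Smc Smul)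

end Prog

section Reduction

variable {F : ℕ → FuzzyKeySetting} {GG : GroupGen} {LS : LinearSketch F GG.orders}
  {mc : (κ p : ℕ) → (pp c : Val) → (F κ).X → Val × ZMod p} {A : Machine}

variable (hinp : PolySized (Setup.κ (GG := GG) (LS := LS)) Setup.inp)
variable {J : Type} (i : J → Setup GG LS) {Serr Smc Smul : Machine}
    (hSerr : ∀ κ, Serr.Samples (ones κ) ((F κ).err.map (F κ).enc))
    (hSmc : ∀ κ, ∀ p ∈ GG.orders κ, ∀ pp ∈ (LS.setup κ p).support, ∀ x e : (F κ).X,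
      Smc.Computes
        (.pair (.pair (ones κ) (.nat p)) (.pair pp (.pair (LS.sketch κ p pp x).1 ((F κ).enc e))))
        (.pair (mc κ p pp (LS.sketch κ p pp x).1 e).1
          (.nat (mc κ p pp (LS.sketch κ p pp x).1 e).2.val)))
    (hSmul : ∀ κ, ∀ d ∈ (GG.desc κ).support, ∀ a b : GG.G d, Smul.Computes
      (.pair (ones κ) (.pair (GG.triple d) (.pair (GG.enc d a) (GG.enc d b)))) (GG.enc d (a * b)))

include hinp hSerr hSmc hSmul

theorem Impl.reactQuery {s : J → SimState} {r : J → Val}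
    (hr : ∀ j, ∃ q st, r j = .pair (.nat 1) (.pair q st))
    (hv : PolySized (fun j => (i j).κ) fun j => .pair ((s j).enc (i j).inp) (r j)) :
    Impl (fun j => (i j).κ)
      (.seq (.fork (.get [false, false]) (.fork (.get [true, true, true])
        (.fork (.get [false, true, true, true]) (.get [true, true, false]))))
        (.answer Serr Smc Smul))
      (fun j => .pair ((s j).enc (i j).inp) (r j))
      fun j => (((i j).sim mc A).react (r j) (s j).L).map (SimState.enc (i j).inp) := by
  choose q st hr using hr
  obtain rfl : r = fun j => .pair (.nat 1) (.pair (q j) (st j)) := funext hr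
  refine Impl.straightSeq rfl hv ?_
  have hs := hv.of_pair_left
  have hq := hv.of_pair_right.of_pair_right
  exact Impl.answer hinp i hSerr hSmc hSmul (hs.of_pair_left.pair (hq.of_pair_right.pair
    (hs.of_pair_right.of_pair_right.of_pair_right.pair hq.of_pair_left)))

theorem Impl.react {s : J → SimState} {r : J → Val}
    (hv : PolySized (fun j => (i j).κ) fun j => .pair ((s j).enc (i j).inp) (r j)) :
    Impl (fun j => (i j).κ) (Prog.react Serr Smc Smul)
      (fun j => .pair ((s j).enc (i j).inp) (r j))
      fun j => (((i j).sim mc A).react (r j) (s j).L).map (SimState.enc (i j).inp) := by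
  refine Impl.ite (c := fun j => ∃ q st, r j = .pair (.nat 1) (.pair q st)) rfl hv
    (fun j => ?_) ?_ ?_
  · rcases r j with m | ⟨a, m | ⟨b, c⟩⟩
    · simp [Prog.isQuery, Prog.denote, Prog.get, Prog.op, Prog.lit, Instr.apply]
    all_goals
      by_cases ha : a = .nat 1 <;>
        simp [Prog.isQuery, Prog.denote, Prog.get, Prog.op, Prog.lit, Instr.apply, ha]
  · exact Impl.reactQuery (J := {j // ∃ q st, r j = .pair (.nat 1) (.pair q st)}) hinp
      (fun x => i x.1) hSerr hSmc hSmul (s := fun x => s x.1) (r := fun x => r x.1) (fun x => x.2)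
      (hv.reindex Subtype.val)
  · refine Impl.straight_denote rfl (hv.reindex Subtype.val) ?_
    rintro ⟨j, hj⟩
    rcases ((i j).sim mc A).react_eq (r j) (s j).L with ⟨q, st, h, -⟩ | ⟨-, h⟩
    · exact absurd ⟨q, st, h⟩ hj
    · simp only [h, PMF.pure_map]
      rfl

/-- The hypothesis `hA` concerns only the given states. The adversary may be slow on inputs that
never occur, so the bound has to come from the invariant of the attack. -/
theorem Impl.step {s : J → SimState}
    (hs : PolySized (fun j => (i j).κ) fun j => (s j).enc (i j).inp)
    (hA : ∀ j, ∀ r ∈ (A.prog.exec (A.time.eval (i j).κ) (s j).msg).support,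
      r.2 ≤ A.time.eval (i j).κ) :
    Impl (fun j => (i j).κ) (Prog.step A Serr Smc Smul) (fun j => (s j).enc (i j).inp)
      fun j => (((i j).sim mc A).step (s j)).map (SimState.enc (i j).inp) := by
  refine (Impl.call (α := fun _ => Val)
    (D := fun j => (A.prog.exec (A.time.eval (i j).κ) (s j).msg).map Prod.fst) (φ := fun _ r => r)
    (w := fun j => (s j).msg)
    (E := fun j r => (((i j).sim mc A).react r (s j).L).map (SimState.enc (i j).inp))
    rfl hs (fun _ => rfl) ?_ fun hv => ?_).congr (fun _ => rfl) fun j => ?_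
  · refine Impl.of_bdd (T := fun j => A.time.eval (i j).κ) (PolyBdd.self.eval _) fun j => ?_
    have := Runs.of_exec (hA j)
    rwa [← PMF.map_id ((A.prog.exec (A.time.eval (i j).κ) (s j).msg).map Prod.fst)] at this
  · exact Impl.react (J := Σ j, {r // r ∈ ((A.prog.exec (A.time.eval (i j).κ) (s j).msg).map
      Prod.fst).support}) hinp (fun x => i x.1) hSerr hSmc hSmul (s := fun x => s x.1) hv
  · rw [Simulation.step, PMF.map_bind, PMF.bind_map]
    rfl

end Reduction

/-! ## Invariants of the simulated attack -/

section Reduction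

variable {F : ℕ → FuzzyKeySetting} {GG : GroupGen} {LS : LinearSketch F GG.orders}

/-- The oracles in the real attack. -/
noncomputable def Setup.oracle (i : Setup GG LS) :
    Val → ChallengerState (GG.order i.d) → PMF (Val × ChallengerState (GG.order i.d)) :=
  schnorrOracle GG LS i.κ i.d i.pp i.x

theorem Val.size_fst_le (v : Val) : v.fst.size ≤ v.size := by
  cases v <;> simp only [Val.fst, Instr.apply, Val.size, Nat.size_zero] <;> omega

theorem Val.size_snd_le (v : Val) : v.snd.size ≤ v.size := by
  cases v <;> simp only [Val.snd, Instr.apply, Val.size, Nat.size_zero] <;> omega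

variable (A : Machine)

/-- The entries of `L` together with the input `v` of the adversary can occur in a real attack which
respects the time bound with `k` activations to go. -/
def Setup.Possible (i : Setup GG LS) (k : ℕ) (v : Val) (L : List Entry) : Prop :=
  ∃ k' ≤ k, ∃ cs, Represents cs L ∧ InteractSafe i.oracle A.prog (A.time.eval i.κ) k' v cs

/-- Invariant of the simulated attack with at most `k` activations to go; if `c` holds then the attack can
be taken back to every random oracle query. -/
structure Setup.Inv (i : Setup GG LS) (c : Prop) (m bE bM k : ℕ) (s : SimState) : Prop where
  run : s.run = true → i.Possible A k s.msg s.L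
  fork : c → ∀ e L, e :: L <:+ s.L → e.hsh = true → ∀ b < GG.order i.d,
    i.Possible A (A.time.eval i.κ) (.pair e.st (.nat b)) (⟨e.y, b, true, e.st⟩ :: L)
  length : s.L.length + k ≤ m
  entry : ∀ e ∈ s.L, e.enc.size ≤ bE
  msg : s.msg.size ≤ bM

variable {A} {i : Setup GG LS}

theorem Setup.Possible.steps_le {k : ℕ} {v : Val} {L : List Entry} (h : i.Possible A k v L) :
    ∀ r ∈ (A.prog.exec (A.time.eval i.κ) v).support, r.2 ≤ k := by
  obtain ⟨k', hk', cs, -, h⟩ := h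
  exact fun r hr => (h.steps_le r hr).trans hk'

theorem Setup.Possible.size_le {k : ℕ} {v : Val} {L : List Entry} (h : i.Possible A k v L) :
    v.size ≤ k := by
  obtain ⟨r, hr⟩ := (A.prog.exec (A.time.eval i.κ) v).support_nonempty
  exact (Prog.size_le_steps _ _ _ r hr).1.trans (h.steps_le r hr)

theorem Entry.size_enc_le (e : Entry) : e.enc.size ≤ e.y.size + e.β.size + e.st.size + 6 := by
  have h : (if e.hsh = true then 1 else 0 : ℕ).size ≤ 1 := by split_ifs <;> simp
  simp only [Entry.enc, Val.size]
  omega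

theorem size_schnorrPoint_le {P : Polynomial ℕ}
    (hP : ∀ κ, ∀ d ∈ (GG.desc κ).support, ∀ a : GG.G d, (GG.enc d a).size ≤ P.eval κ)
    {κ : ℕ} {d : Val} (hd : d ∈ (GG.desc κ).support) (h : GG.G d) (Δ β z : ℕ) (M : Val) :
    (schnorrPoint GG d h Δ β z M).size ≤ 2 * P.eval κ + M.size + 2 := by
  have h1 := hP κ d hd (h * GG.gen d ^ Δ)
  have h2 := hP κ d hd (GG.gen d ^ z * ((h * GG.gen d ^ Δ) ^ β)⁻¹)
  simp only [schnorrPoint, hashInput, Val.size]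
  omega

variable {mc : (κ p : ℕ) → (pp c : Val) → (F κ).X → Val × ZMod p}

/-- The real game supplies the time bound: unless the simulation stops, its answer can occur there,
so the next state is again possible with one activation less. The length bounds follow, since the
adversary has to write its queries and its state. -/
theorem Setup.Inv.step
    (hlin : ∀ κ, ∀ p ∈ GG.orders κ, ∀ pp ∈ (LS.setup κ p).support, ∀ x e : (F κ).X,
      LS.sketch κ p pp (x + e) = ((mc κ p pp (LS.sketch κ p pp x).1 e).1,
        (LS.sketch κ p pp x).2 + (mc κ p pp (LS.sketch κ p pp x).1 e).2))
    {P : Polynomial ℕ}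
    (hP : ∀ κ, ∀ d ∈ (GG.desc κ).support, ∀ a : GG.G d, (GG.enc d a).size ≤ P.eval κ)
    {c : Prop} {m bE bM k : ℕ} {s : SimState} (h : i.Inv A c m bE bM k s) (hs : s.run = true)
    (hk : k ≤ A.time.eval i.κ) (hM : A.time.eval i.κ + 1 ≤ bM)
    (hE : 2 * P.eval i.κ + 2 * A.time.eval i.κ + (GG.order i.d).size + 8 ≤ bE) :
    0 < k ∧ ∀ s' ∈ ((i.sim mc A).step s).support, i.Inv A c m bE bM (k - 1) s' := by
  obtain ⟨k', hk', cs, hrep, hsafe⟩ := h.run hs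
  have hpos := hsafe.pos
  refine ⟨by omega, fun s' hs' => ?_⟩
  have hlen := h.length
  rw [Simulation.step, PMF.mem_support_bind_iff] at hs'
  obtain ⟨r, hr, hs'⟩ := hs'
  have hr2 := hsafe.steps_le r hr
  have hr1 := (Prog.size_le_steps _ _ _ r hr).2
  rcases (i.sim mc A).react_eq r.1 s.L with ⟨q, st, hq, hreact⟩ | ⟨-, hreact⟩
  · rw [hreact] at hs'
    simp only [hq, Val.size] at hr1
    -- First case: the point to be programmed is already recorded, and the simulation has stopped.
    -- Only length bounds and the old rewinding points are needed then.
    rcases answer_real i.hd (hlin i.κ _ i.order_mem _ i.hpp i.x) hrep hs' with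
      rfl | ⟨hrun, a, ha, hmsg, hrep', hcase⟩
    · exact ⟨fun h => by simp at h, h.fork, by simp only; omega, h.entry,
        by simp only [Val.size, Nat.size_zero]; omega⟩
    obtain ⟨k', rfl⟩ : ∃ m, k' = m + 1 := ⟨k' - 1, by omega⟩
    have hposs : i.Possible A (k - 1) s'.msg s'.L :=
      ⟨k', by omega, a.2, hrep', hmsg ▸ hsafe.query hr hq ha⟩
    refine ⟨fun _ => hposs, ?_, ?_, ?_, ?_⟩
    · rcases hcase with hL | ⟨e, hL, hh, -⟩ <;> rw [hL]
      · exact h.fork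
      · intro hc e' L' hsuf hh' b hb
        rcases List.suffix_cons_iff.1 hsuf with heq | hsuf
        -- The entry just created: the real oracle could have given any other answer `b` here, so
        -- the attack can be resumed with `b`.
        · obtain ⟨rfl, rfl⟩ := List.cons.inj heq
          obtain ⟨rfl, -, hreal⟩ := hh hh'
          obtain ⟨a, ha, ha1, hrep''⟩ := hreal b hb
          exact ⟨k', by omega, a.2, hrep'', ha1 ▸ hsafe.query hr hq ha⟩
        · exact h.fork hc e' L' hsuf hh' b hb
    · rcases hcase with hL | ⟨e, hL, -⟩ <;> rw [hL]
      · omega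
      · simp only [List.length_cons]
        omega
    · rcases hcase with hL | ⟨e, hL, hh, hn⟩
      · rw [hL]
        exact h.entry
      · have hβ := Nat.size_le_size (hrep'.lt e (by rw [hL]; exact List.mem_cons_self ..)).le
        have he := e.size_enc_le
        rw [hL]
        simp only [List.mem_cons, forall_eq_or_imp]
        refine ⟨?_, h.entry⟩
        -- The point of a hash query was written by the adversary. A programmed point consists of
        -- two group elements and a message written by the adversary.
        cases hhsh : e.hsh with
        | true =>
          obtain ⟨rfl, ⟨y, rfl, rfl⟩, -⟩ := hh hhsh
          simp only [Val.size] at hr1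
          omega
        | false =>
          obtain ⟨hst, M, ε, β, z, rfl, hy⟩ := hn hhsh
          have h1 : e.y.size ≤ 2 * P.eval i.κ + M.size + 2 := by
            rw [hy]
            exact size_schnorrPoint_le hP i.hd ..
          simp only [hst, Val.size, Nat.size_zero] at hr1 he
          omega
    · have := hposs.size_le
      omega
  · rw [hreact, PMF.mem_support_pure_iff] at hs'
    subst hs'
    refine ⟨fun h => by simp at h, h.fork, by simp only; omega, h.entry, ?_⟩
    have := Val.size_snd_le r.1
    simp only
    omega

theorem Setup.Inv.exec
    (hlin : ∀ κ, ∀ p ∈ GG.orders κ, ∀ pp ∈ (LS.setup κ p).support, ∀ x e : (F κ).X,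
      LS.sketch κ p pp (x + e) = ((mc κ p pp (LS.sketch κ p pp x).1 e).1,
        (LS.sketch κ p pp x).2 + (mc κ p pp (LS.sketch κ p pp x).1 e).2))
    {P : Polynomial ℕ}
    (hP : ∀ κ, ∀ d ∈ (GG.desc κ).support, ∀ a : GG.G d, (GG.enc d a).size ≤ P.eval κ)
    {c : Prop} {m bE bM k : ℕ} {s s' : SimState} (h : i.Inv A c m bE bM k s)
    (hk : k ≤ A.time.eval i.κ) (hM : A.time.eval i.κ + 1 ≤ bM)
    (hE : 2 * P.eval i.κ + 2 * A.time.eval i.κ + (GG.order i.d).size + 8 ≤ bE)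
    (hs' : s' ∈ ((i.sim mc A).exec k s).support) : ∃ k', i.Inv A c m bE bM k' s' := by
  induction k generalizing s with
  | zero =>
    rw [Simulation.exec_zero, PMF.mem_support_pure_iff] at hs'
    exact hs' ▸ ⟨0, h⟩
  | succ k ih =>
    cases hs : s.run with
    | false =>
      rw [Simulation.exec_of_not_run _ hs, PMF.mem_support_pure_iff] at hs'
      exact hs' ▸ ⟨_, h⟩
    | true =>
      simp only [Simulation.exec, iterWhile, hs, if_true, PMF.mem_support_bind_iff] at hs'
      obtain ⟨s₁, hs₁, hs'⟩ := hs'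
      exact ih ((h.step hlin hP hs hk hM hE).2 s₁ hs₁) (by omega) hs'

theorem Setup.Inv.init {c : Prop} {m bE bM : ℕ}
    (hsafe : InteractSafe i.oracle A.prog (A.time.eval i.κ) (A.time.eval i.κ)
      (.pair (.nat 0) i.inp) ⟨fun _ => none, [], 0⟩)
    (hm : A.time.eval i.κ ≤ m) (hM : A.time.eval i.κ ≤ bM) :
    i.Inv A c m bE bM (A.time.eval i.κ) ⟨true, .pair (.nat 0) i.inp, []⟩ := by
  have h : i.Possible A (A.time.eval i.κ) (.pair (.nat 0) i.inp) [] :=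
    ⟨_, le_rfl, _, Represents.empty, hsafe⟩
  exact ⟨fun _ => h, fun _ e L hsuf => by simpa using hsuf.length_le, by simpa, by simp,
    h.size_le.trans hM⟩

/-- The field `fork` of the first attack says that the rewound state is possible. The second attack
is never rewound, so its invariant is weakened to `c = False`. Its list consists of at most `time +
1` old entries and at most `time` new ones. -/
theorem Setup.Inv.rewind {P : Polynomial ℕ}
    (hP : ∀ κ, ∀ d ∈ (GG.desc κ).support, ∀ a : GG.G d, (GG.enc d a).size ≤ P.eval κ)
    {bE bM k : ℕ} {s : SimState}
    (h : i.Inv A True (A.time.eval i.κ) bE bM k s) {b : ℕ} (hb : b < GG.order i.d) :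
    i.Inv A False (2 * A.time.eval i.κ + 1)
      (bE + bM + 2 * P.eval i.κ + (GG.order i.d).size + 10)
      (bE + bM + (GG.order i.d).size + 5) (A.time.eval i.κ) ((i.sim mc A).rewind s b) := by
  have hbs := Nat.size_le_size hb.le
  have hlen := h.length
  have hmsg := h.msg
  unfold Simulation.rewind
  cases hlook : lookup s.L ((i.sim mc A).target s.msg) with
  | nil =>
    -- The target has no entry: the rewound state is a dummy that does not run, and only its length
    -- matters.
    refine ⟨fun h => by simp at h, False.elim, by simp only [List.length_singleton]; omega, ?_, ?_⟩
    · have h1 : s.msg.fst.size ≤ s.msg.size := Val.size_fst_le _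
      have h2 : ((i.sim mc A).target s.msg).size ≤ 2 * P.eval i.κ + s.msg.fst.size + 2 :=
        size_schnorrPoint_le hP i.hd ..
      simp only [List.mem_singleton, forall_eq]
      refine (Entry.size_enc_le _).trans ?_
      simp only [Val.size, Nat.size_zero]
      omega
    · simp only [Val.size, Nat.size_zero]; omega
  | cons e L =>
    have hsuf := hlook ▸ lookup_suffix s.L ((i.sim mc A).target s.msg)
    have hy := y_eq_of_lookup hlook
    have he := h.entry e (hsuf.mem (List.mem_cons_self ..))
    have hst : e.y.size + e.st.size ≤ e.enc.size := by simp only [Entry.enc, Val.size]; omega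
    have hll := hsuf.length_le
    rw [List.length_cons] at hll
    simp only [← hy]
    refine ⟨fun hh => h.fork trivial e L hsuf hh b hb, False.elim, ?_, ?_, ?_⟩
    · simp only [List.length_cons]
      omega
    · simp only [List.mem_cons, forall_eq_or_imp]
      refine ⟨(Entry.size_enc_le _).trans ?_, fun e' he' => ?_⟩
      · simp only
        omega
      · have := h.entry e' (hsuf.mem (List.mem_cons_of_mem _ he'))
        omega
    · simp only [Val.size]; omega

end Reduction

/-! ### Programs for rewinding and for extracting the logarithm -/

namespace Prog

/-- The simulated attack. -/
def attack (A Serr Smc Smul : Machine) : Prog := .loop (get [true, false]) (step A Serr Smc Smul)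

/-- The forking of a finished attack: its final state is mapped to the data of the forgery and the state
of the attack which is taken back to the random oracle query at the target of the forgery. -/
def refork (Sdiff Smul : Machine) : Prog :=
  call (.fork (.fork (up 1 inpOnes) (up 1 inpOrder)) (.fork (up 1 inpPP)
    (.fork (up 1 inpSketch) (get [true, true, false, true, true, true])))) Sdiff.prog <|
  call (.fork (up 2 (.instr .id)) (.fork (get [true]) (.fork (up 1 (get [true, true, false, true, false]))
    (.fork (up 1 (get [true, true, false, true, true, false]))
      (up 1 (get [true, true, false, false])))))) (point Smul) <|
  call (.fork (get [true]) (up 2 (get [true, true, true]))) search <|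
  call (up 4 inpOrder) .rand <|
  .fork
    (.fork (up 3 (get [true])) (.fork (up 4 (get [true, true, false, true, false]))
      (up 4 (get [true, true, false, true, true, false]))))
    (state (up 5 (.instr .id)) (up 1 (get [true, false, true, true, false]))
      (.fork (up 1 (get [true, false, true, true, true])) (get [true]))
      (.fork (.fork (up 2 (get [true])) (.fork (get [true]) (.fork (lit 1)
        (up 1 (get [true, false, true, true, true]))))) (up 1 (get [true, true]))))

/-- `f + (p - 1) * g` modulo `p`. -/
def subMod (p f g : Prog) : Prog := op .mod (op .add f (op .mul (op .sub p (lit 1)) g)) p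

/-- The group order; the input is the data of a forgery with the final state of an attack. -/
def finalOrder : Prog := .seq (get [true, false]) inpOrder

/-- Multiplication modulo the number given as context. -/
def mulMod : Prog := op .mod (op .mul (get [true, false]) (get [true, true])) (get [false])

/-- The discrete logarithm is computed from the data of a forgery and the final state of an attack. -/
def extract : Prog :=
  call (.fork finalOrder (.fork
      (subMod finalOrder (num (get [false, true, true]))
        (num (get [true, true, true, false, true, true, false])))
      (.fork (subMod finalOrder (num (get [false, true, false]))
        (num (get [true, true, true, false, true, false]))) (op .sub finalOrder (lit 2)))))
    (mulPow mulMod)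
    (subMod (up 1 finalOrder) (get [true]) (up 1 (get [false, false])))

/-- The reduction. -/
def reduction (A Serr Smc Sdiff Smul : Machine) : Prog :=
  .seq (.fork (.instr .id) (.fork (lit 1) (.fork (.fork (lit 0) (.instr .id)) (lit 0)))) <|
  .seq (attack A Serr Smc Smul) <| .seq (refork Sdiff Smul) <|
  .seq (.fork (get [false]) (.seq (get [true]) (attack A Serr Smc Smul))) extract

end Prog

theorem size_encList_le {L : List Entry} {B : ℕ} (h : ∀ e ∈ L, e.enc.size ≤ B) :
    (encList L).size ≤ L.length * (B + 1) + 1 := by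
  induction L with
  | nil => simp [encList, Val.size]
  | cons e L ih =>
    have h1 := ih fun e he => h e (List.mem_cons_of_mem _ he)
    have h2 := h e (List.mem_cons_self ..)
    simp only [encList, Val.size, List.length_cons]
    linarith [add_mul L.length 1 (B + 1)]

section Reduction

variable {F : ℕ → FuzzyKeySetting} {GG : GroupGen} {LS : LinearSketch F GG.orders}
  {mc : (κ p : ℕ) → (pp c : Val) → (F κ).X → Val × ZMod p} {A : Machine}

variable (hinp : PolySized (Setup.κ (GG := GG) (LS := LS)) Setup.inp)
variable {J : Type} (i : J → Setup GG LS) {Serr Smc Sdiff Smul : Machine}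
    (hSerr : ∀ κ, Serr.Samples (ones κ) ((F κ).err.map (F κ).enc))
    (hSmc : ∀ κ, ∀ p ∈ GG.orders κ, ∀ pp ∈ (LS.setup κ p).support, ∀ x e : (F κ).X,
      Smc.Computes
        (.pair (.pair (ones κ) (.nat p)) (.pair pp (.pair (LS.sketch κ p pp x).1 ((F κ).enc e))))
        (.pair (mc κ p pp (LS.sketch κ p pp x).1 e).1
          (.nat (mc κ p pp (LS.sketch κ p pp x).1 e).2.val)))
    (hSdiff : ∀ κ, ∀ p ∈ GG.orders κ, ∀ pp ∈ (LS.setup κ p).support, ∀ c c' : Val,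
      Sdiff.Computes (.pair (.pair (ones κ) (.nat p)) (.pair pp (.pair c c')))
        (.nat (LS.diffRec κ p pp c c').val))
    (hSmul : ∀ κ, ∀ d ∈ (GG.desc κ).support, ∀ a b : GG.G d, Smul.Computes
      (.pair (ones κ) (.pair (GG.triple d) (.pair (GG.enc d a) (GG.enc d b)))) (GG.enc d (a * b)))
    (hlin : ∀ κ, ∀ p ∈ GG.orders κ, ∀ pp ∈ (LS.setup κ p).support, ∀ x e : (F κ).X,
      LS.sketch κ p pp (x + e) = ((mc κ p pp (LS.sketch κ p pp x).1 e).1,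
        (LS.sketch κ p pp x).2 + (mc κ p pp (LS.sketch κ p pp x).1 e).2))
    {P : Polynomial ℕ}
    (hP : ∀ κ, ∀ d ∈ (GG.desc κ).support, ∀ a : GG.G d, (GG.enc d a).size ≤ P.eval κ)

include hinp in
-- The list has at most `m` entries of length at most `bE`, which bounds the encoded state by a
-- product of polynomials.
theorem Setup.Inv.sized {c : J → Prop} {m bE bM k : J → ℕ} (hm : PolyBdd (fun j => (i j).κ) m)
    (hbE : PolyBdd (fun j => (i j).κ) bE) (hbM : PolyBdd (fun j => (i j).κ) bM) {s : J → SimState}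
    (h : ∀ j, (i j).Inv A (c j) (m j) (bE j) (bM j) (k j) (s j)) :
    PolySized (fun j => (i j).κ) fun j => (s j).enc (i j).inp := by
  have hflag : PolySized (fun j => (i j).κ) fun j => .nat (if (s j).run then 1 else 0) :=
    (PolySized.const (.nat 1)).nat_mono fun j => by split_ifs <;> simp
  refine (hinp.reindex i).pair (hflag.pair (PolySized.pair (hbM.mono fun j => (h j).msg) ?_))
  refine ((hm.mul (hbE.add (.const 1))).add (.const 1)).mono fun j =>
    (size_encList_le (h j).entry).trans ?_
  have := (h j).length
  gcongr
  omega

include hinp hSerr hSmc hSmul hlin hP in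
-- The loop tests only the flag `run`. That it stops in time follows from the invariant, in which no
-- running state has zero activations left.
theorem Impl.attack {c : J → Prop} {m bE bM : J → ℕ} (hm : PolyBdd (fun j => (i j).κ) m)
    (hbE : PolyBdd (fun j => (i j).κ) bE) (hbM : PolyBdd (fun j => (i j).κ) bM) {s : J → SimState}
    (h : ∀ j, (i j).Inv A (c j) (m j) (bE j) (bM j) (A.time.eval (i j).κ) (s j))
    (hM : ∀ j, A.time.eval (i j).κ + 1 ≤ bM j)
    (hE : ∀ j, 2 * P.eval (i j).κ + 2 * A.time.eval (i j).κ + (GG.order (i j).d).size + 8 ≤ bE j) :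
    Impl (fun j => (i j).κ) (Prog.attack A Serr Smc Smul) (fun j => (s j).enc (i j).inp)
      fun j => (((i j).sim mc A).exec (A.time.eval (i j).κ) (s j)).map
        (SimState.enc (i j).inp) := by
  refine Impl.loop (σ := fun _ => SimState) (fun j => SimState.enc (i j).inp) (fun _ => SimState.run)
    (fun j => ((i j).sim mc A).step) (fun j => (i j).Inv A (c j) (m j) (bE j) (bM j))
    (fun j => A.time.eval (i j).κ) (PolyBdd.self.eval _)
    (fun _ s => .nat (if s.run then 1 else 0)) (fun j s => by cases s.run <;> simp) ?_ ?_ ?_ s h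
  · have hv := Setup.Inv.sized (A := A) hinp (J := Σ j, {x : ℕ × SimState //
        x.1 ≤ A.time.eval (i j).κ ∧ (i j).Inv A (c j) (m j) (bE j) (bM j) x.1 x.2})
      (fun x => i x.1) (c := fun x => c x.1) (k := fun x => x.2.1.1) (s := fun x => x.2.1.2)
      (hm.reindex Sigma.fst) (hbE.reindex Sigma.fst) (hbM.reindex Sigma.fst) fun x => x.2.2.2
    exact Impl.straight rfl hv fun _ => rfl
  · have hv := Setup.Inv.sized (A := A) hinp (J := Σ j, {x : ℕ × SimState //
        x.1 ≤ A.time.eval (i j).κ ∧ (i j).Inv A (c j) (m j) (bE j) (bM j) x.1 x.2 ∧ x.2.run = true})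
      (fun x => i x.1) (c := fun x => c x.1) (k := fun x => x.2.1.1) (s := fun x => x.2.1.2)
      (hm.reindex Sigma.fst) (hbE.reindex Sigma.fst) (hbM.reindex Sigma.fst) fun x => x.2.2.2.1
    exact Impl.step hinp (J := Σ j, {x : ℕ × SimState // x.1 ≤ A.time.eval (i j).κ ∧
      (i j).Inv A (c j) (m j) (bE j) (bM j) x.1 x.2 ∧ x.2.run = true})
      (fun x => i x.1) hSerr hSmc hSmul (s := fun x => x.2.1.2) hv
      fun x r hr => ((x.2.2.2.1.run x.2.2.2.2).steps_le r hr).trans x.2.2.1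
  · exact fun j k s hk hs ht => hs.step hlin hP ht hk (hM j) (hE j)

/-- The data of a forgery used by the reduction. -/
noncomputable def Setup.info (i : Setup GG LS) (out : Val) : Val :=
  .pair (.nat (LS.diffRec i.κ (GG.order i.d) i.pp i.c out.snd.snd.snd).val)
    (.pair out.snd.fst out.snd.snd.fst)

include hinp hSdiff hSmul in
theorem Impl.refork {s : J → SimState}
    (hs : PolySized (fun j => (i j).κ) fun j => (s j).enc (i j).inp) :
    Impl (fun j => (i j).κ) (Prog.refork Sdiff Smul) (fun j => (s j).enc (i j).inp)
      fun j => (unif (GG.order (i j).d)).map fun b => .pair ((i j).info (s j).msg)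
        ((((i j).sim mc A).rewind (s j) b).enc (i j).inp) := by
  have hp := (Setup.sized_order hinp).reindex i
  have hi := hs.of_pair_left
  have hmsg := hs.of_pair_right.of_pair_right.of_pair_left
  have hsnd : ∀ {v : J → Val}, PolySized (fun j => (i j).κ) v →
      PolySized (fun j => (i j).κ) fun j => (v j).snd := fun h => h.mono fun j => Val.size_snd_le _
  have hfst : ∀ {v : J → Val}, PolySized (fun j => (i j).κ) v →
      PolySized (fun j => (i j).κ) fun j => (v j).fst := fun h => h.mono fun j => Val.size_fst_le _
  refine Impl.callDet
    (w := fun j => .pair (.pair (ones (i j).κ) (.nat (GG.order (i j).d)))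
      (.pair (i j).pp (.pair (i j).c (s j).msg.snd.snd.snd)))
    (u := fun j => .nat (LS.diffRec (i j).κ (GG.order (i j).d) (i j).pp (i j).c
      (s j).msg.snd.snd.snd).val) rfl hs (fun _ => rfl)
    (Impl.machine ((hi.of_pair_left.pair hp).pair
      (hi.of_pair_right.of_pair_left.of_pair_right.pair
        (hi.of_pair_right.of_pair_right.of_pair_right.pair (hsnd (hsnd (hsnd hmsg))))))
      fun j => hSdiff _ _ (i j).order_mem _ (i j).hpp _ _) fun hv₁ => ?_
  refine Impl.callDet (w := fun j => .pair (i j).inp (.pair (.nat (LS.diffRec (i j).κ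
      (GG.order (i j).d) (i j).pp (i j).c (s j).msg.snd.snd.snd).val)
        (.pair (s j).msg.snd.fst (.pair (s j).msg.snd.snd.fst (s j).msg.fst))))
    (u := fun j => ((i j).sim mc A).target (s j).msg) rfl hv₁ (fun _ => rfl)
    (Impl.point hinp i hSmul (hi.pair (hv₁.of_pair_right.pair ((hfst (hsnd hmsg)).pair
      ((hfst (hsnd (hsnd hmsg))).pair (hfst hmsg)))))) fun hv₂ => ?_
  refine Impl.callDet
    (w := fun j => .pair (((i j).sim mc A).target (s j).msg) (encList (s j).L))
    (u := fun j => encList (lookup (s j).L (((i j).sim mc A).target (s j).msg)))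
    rfl hv₂ (fun _ => rfl)
    (Impl.search hv₂.of_pair_right hs.of_pair_right.of_pair_right.of_pair_right) fun hv₃ => ?_
  refine Impl.congr (Impl.call (α := fun _ => ℕ) (D := fun j => unif (GG.order (i j).d))
      (w := fun j => .nat (GG.order (i j).d)) (φ := fun _ b => .nat b)
      (E := fun j b => PMF.pure (.pair ((i j).info (s j).msg)
        ((((i j).sim mc A).rewind (s j) b).enc (i j).inp)))
      rfl hv₃ (fun _ => rfl) (Impl.rand hp) fun hv₄ => ?_) (fun _ => rfl) fun j => rfl
  refine Impl.straight rfl hv₄ fun ⟨j, b⟩ => ?_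
  simp only [Simulation.rewind]
  cases lookup (s j).L (((i j).sim mc A).target (s j).msg) <;> rfl

/-- The discrete logarithm computed by the reduction from two forgeries. -/
noncomputable def Setup.extract (i : Setup GG LS) (out out' : Val) : ℕ :=
  extractLog (GG.order i.d) (LS.diffRec i.κ (GG.order i.d) i.pp i.c out.snd.snd.snd).val
    (forgedHash out) out.snd.snd.fst.toNat (forgedHash out') out'.snd.snd.fst.toNat

theorem Impl.mulMod {κ p : J → ℕ} (hp : PolySized κ fun j => .nat (p j)) [∀ j, NeZero (p j)] :
    Impl (J := Σ j, ZMod (p j) × ZMod (p j)) (fun x => κ x.1) Prog.mulMod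
      (fun x => .pair (.nat (p x.1)) (.pair (.nat x.2.1.val) (.nat x.2.2.val)))
      fun x => PMF.pure (.nat (x.2.1 * x.2.2).val) := by
  have hp' := hp.reindex (J' := Σ j, ZMod (p j) × ZMod (p j)) Sigma.fst
  refine Impl.straight rfl (hp'.pair ((hp'.nat_mono fun x => x.2.1.val_lt.le).pair
    (hp'.nat_mono fun x => x.2.2.val_lt.le))) fun x => ?_
  rw [ZMod.val_mul]
  rfl

include hinp in
-- The power with exponent `p - 2` is computed by square-and-multiply in `ZMod p`, so that all
-- intermediate numbers stay below `p`.
theorem Impl.extract {out : J → Val} {s : J → SimState}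
    (hv : PolySized (fun j => (i j).κ) fun j => .pair ((i j).info (out j)) ((s j).enc (i j).inp)) :
    Impl (fun j => (i j).κ) Prog.extract
      (fun j => .pair ((i j).info (out j)) ((s j).enc (i j).inp))
      fun j => PMF.pure (.nat ((i j).extract (out j) (s j).msg)) := by
  have hp := (Setup.sized_order hinp).reindex i
  have hne : ∀ j, NeZero (GG.order (i j).d) := fun j =>
    ⟨(GG.prime_order _ _ (i j).hd).ne_zero⟩
  set p : J → ℕ := fun j => GG.order (i j).d with hpdef
  set a : J → ℕ := fun j => ((out j).snd.snd.fst.toNat + (p j - 1) * (s j).msg.snd.snd.fst.toNat) % p j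
    with ha
  set b : J → ℕ := fun j => (forgedHash (out j) + (p j - 1) * forgedHash (s j).msg) % p j with hb
  have hval : ∀ (j : J) (x : ℕ), ((x % p j : ℕ) : ZMod (p j)).val = x % p j := fun j x => by
    rw [ZMod.val_natCast, Nat.mod_mod]
  refine Impl.callDet (w := fun j => .pair (.nat (p j)) (.pair (.nat (a j : ZMod (p j)).val)
      (.pair (.nat (b j : ZMod (p j)).val) (.nat (p j - 2)))))
    rfl hv (fun j => ?_)
    (Impl.mulPow (ctx := fun j => .nat (p j)) (M := fun j => ZMod (p j)) (enc := fun _ a => .nat a.val)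
      (Impl.mulMod hp) (fun j => (a j : ZMod (p j))) (fun j => (b j : ZMod (p j)))
      (hp.nat_mono fun j => Nat.sub_le _ _)) fun hv₁ => ?_
  · rw [ha, hb, hval, hval]
    change Val.pair _ (.pair (Instr.mod.apply (.pair (Instr.add.apply (.pair
      (Instr.add.apply (.pair (out j).snd.snd.fst (.nat 0))) (Instr.mul.apply (.pair _
        (Instr.add.apply (.pair (s j).msg.snd.snd.fst (.nat 0))))))) _)) (.pair
      (Instr.mod.apply (.pair (Instr.add.apply (.pair
        (Instr.add.apply (.pair (out j).snd.fst (.nat 0))) (Instr.mul.apply (.pair _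
          (Instr.add.apply (.pair (s j).msg.snd.fst (.nat 0))))))) _)) _)) = _
    simp only [Val.add_zero_apply]
    rfl
  · refine Impl.straight rfl hv₁ fun j => ?_
    have h1 : ((a j : ZMod (p j)) * (b j : ZMod (p j)) ^ (p j - 2)).val =
        (a j * b j ^ (p j - 2)) % p j := by
      rw [← ZMod.val_natCast]
      push_cast
      rfl
    have h2 : (i j).extract (out j) (s j).msg =
        (((a j : ZMod (p j)) * (b j : ZMod (p j)) ^ (p j - 2)).val + (p j - 1) *
          (LS.diffRec (i j).κ (GG.order (i j).d) (i j).pp (i j).c (out j).snd.snd.snd).val) % p j := by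
      rw [h1, Nat.mod_add_mod]
      rfl
    rw [h2]
    rfl

end Reduction

/-! ### The complete reduction -/

section Reduction

variable {F : ℕ → FuzzyKeySetting} {GG : GroupGen} {LS : LinearSketch F GG.orders}
  (mc : (κ p : ℕ) → (pp c : Val) → (F κ).X → Val × ZMod p) (A : Machine)

/-- The state at the beginning of the simulated attack. -/
def Setup.start (i : Setup GG LS) : SimState := ⟨true, .pair (.nat 0) i.inp, []⟩

/-- Output distribution of the reduction. -/
noncomputable def Setup.found (i : Setup GG LS) : PMF ℕ :=
  ((i.sim mc A).exec (A.time.eval i.κ) i.start).bind fun s =>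
    (unif (GG.order i.d)).bind fun b =>
      ((i.sim mc A).exec (A.time.eval i.κ) ((i.sim mc A).rewind s b)).bind fun s' =>
        PMF.pure (i.extract s.msg s'.msg)

/-- The adversary respects its time bound in all real attacks. -/
def Setup.Safe (i : Setup GG LS) : Prop :=
  InteractSafe i.oracle A.prog (A.time.eval i.κ) (A.time.eval i.κ) (.pair (.nat 0) i.inp)
    ⟨fun _ => none, [], 0⟩

variable {mc A}

/-- The adversary reads its input in the first activation, so its time bound is also a bound on the
length of the input. -/
theorem Setup.sized_inp (hsafe : ∀ i : Setup GG LS, i.Safe A) :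
    PolySized (Setup.κ (GG := GG) (LS := LS)) Setup.inp := by
  refine (PolyBdd.self.eval A.time).mono fun i => ?_
  have := (Setup.Inv.init (c := True) (bE := 0) (hsafe i) le_rfl le_rfl).msg
  simp only [Val.size] at this
  omega

variable {Serr Smc Sdiff Smul : Machine}
    (hSerr : ∀ κ, Serr.Samples (ones κ) ((F κ).err.map (F κ).enc))
    (hSmc : ∀ κ, ∀ p ∈ GG.orders κ, ∀ pp ∈ (LS.setup κ p).support, ∀ x e : (F κ).X,
      Smc.Computes
        (.pair (.pair (ones κ) (.nat p)) (.pair pp (.pair (LS.sketch κ p pp x).1 ((F κ).enc e))))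
        (.pair (mc κ p pp (LS.sketch κ p pp x).1 e).1
          (.nat (mc κ p pp (LS.sketch κ p pp x).1 e).2.val)))
    (hSdiff : ∀ κ, ∀ p ∈ GG.orders κ, ∀ pp ∈ (LS.setup κ p).support, ∀ c c' : Val,
      Sdiff.Computes (.pair (.pair (ones κ) (.nat p)) (.pair pp (.pair c c')))
        (.nat (LS.diffRec κ p pp c c').val))
    (hSmul : ∀ κ, ∀ d ∈ (GG.desc κ).support, ∀ a b : GG.G d, Smul.Computes
      (.pair (ones κ) (.pair (GG.triple d) (.pair (GG.enc d a) (GG.enc d b)))) (GG.enc d (a * b)))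
    (hlin : ∀ κ, ∀ p ∈ GG.orders κ, ∀ pp ∈ (LS.setup κ p).support, ∀ x e : (F κ).X,
      LS.sketch κ p pp (x + e) = ((mc κ p pp (LS.sketch κ p pp x).1 e).1,
        (LS.sketch κ p pp x).2 + (mc κ p pp (LS.sketch κ p pp x).1 e).2))

/-- Bound on the lengths of entries in the first attack. -/
def Setup.entryBound (A : Machine) (P : Polynomial ℕ) (i : Setup GG LS) : ℕ :=
  2 * P.eval i.κ + 2 * A.time.eval i.κ + (GG.order i.d).size + 8

section

variable (hinp : PolySized (Setup.κ (GG := GG) (LS := LS)) Setup.inp) {P : Polynomial ℕ}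
    (hP : ∀ κ, ∀ d ∈ (GG.desc κ).support, ∀ a : GG.G d, (GG.enc d a).size ≤ P.eval κ)
    {J : Type} (i : J → Setup GG LS)

include hinp in
theorem Setup.polyBdd_entryBound : PolyBdd (Setup.κ (GG := GG) (LS := LS))
    (Setup.entryBound A P) :=
  ((((PolyBdd.const 2).mul (PolyBdd.self.eval _)).add ((PolyBdd.const 2).mul
    (PolyBdd.self.eval _))).add (Setup.sized_order hinp).size_nat).add (.const 8)

include hinp hSerr hSmc hSmul hlin hP in
theorem Impl.secondAttack {s : J → SimState} {b : J → ℕ} {out : J → Val}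
    (hv : PolySized (fun j => (i j).κ) fun j => .pair ((i j).info (out j))
      ((((i j).sim mc A).rewind (s j) (b j)).enc (i j).inp)) {k : J → ℕ}
    (hinv : ∀ j, (i j).Inv A True (A.time.eval (i j).κ) ((i j).entryBound A P)
      (A.time.eval (i j).κ + 1) (k j) (s j)) (hb : ∀ j, b j < GG.order (i j).d) :
    Impl (fun j => (i j).κ)
      (.seq (.fork (.get [false]) (.seq (.get [true]) (.attack A Serr Smc Smul))) .extract)
      (fun j => .pair ((i j).info (out j)) ((((i j).sim mc A).rewind (s j) (b j)).enc (i j).inp))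
      fun j => (((i j).sim mc A).exec (A.time.eval (i j).κ)
        (((i j).sim mc A).rewind (s j) (b j))).bind fun s' =>
          PMF.pure (.nat ((i j).extract (out j) s'.msg)) := by
  have hn : PolyBdd (fun j => (i j).κ) fun j => A.time.eval (i j).κ := PolyBdd.self.eval _
  have hPκ : PolyBdd (fun j => (i j).κ) fun j => P.eval (i j).κ := PolyBdd.self.eval _
  have hp := (Setup.sized_order hinp).size_nat.reindex i
  have hE := (Setup.polyBdd_entryBound (A := A) (P := P) hinp).reindex i
  refine Impl.seq (α := fun _ => SimState)
    (φ := fun j s' => .pair ((i j).info (out j)) (s'.enc (i j).inp)) ?_ fun hv₁ => ?_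
  -- The three bounds are those given by `Setup.Inv.rewind` when the first attack has entries up to
  -- `entryBound` and messages up to `time + 1`.
  · have hattack := Impl.attack (mc := mc) hinp i hSerr hSmc hSmul hlin hP
      (((PolyBdd.const 2).mul hn).add (.const 1))
      ((((hE.add (hn.add (.const 1))).add ((PolyBdd.const 2).mul hPκ)).add hp).add (.const 10))
      (((hE.add (hn.add (.const 1))).add hp).add (.const 5))
      (fun j => (hinv j).rewind (mc := mc) hP (hb j)) (fun j => by omega)
      (fun j => by simp only [Setup.entryBound]; omega)
    refine ((Impl.straight (w := fun j => (i j).info (out j)) rfl hv fun _ => rfl).fork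
      (Impl.straightSeq rfl hv hattack)).congr (fun _ => rfl) fun j => ?_
    rw [PMF.map_comp]
    rfl
  · exact Impl.extract hinp (J := Σ j, {s' // s' ∈ (((i j).sim mc A).exec (A.time.eval (i j).κ)
      (((i j).sim mc A).rewind (s j) (b j))).support}) (fun x => i x.1) (out := fun x => out x.1)
      (s := fun x => x.2.1) hv₁

include hinp hSerr hSmc hSdiff hSmul hlin hP in
theorem Impl.afterFirstAttack {s : J → SimState}
    (hs : PolySized (fun j => (i j).κ) fun j => (s j).enc (i j).inp) {k : J → ℕ}
    (hinv : ∀ j, (i j).Inv A True (A.time.eval (i j).κ) ((i j).entryBound A P)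
      (A.time.eval (i j).κ + 1) (k j) (s j)) :
    Impl (fun j => (i j).κ) (.seq (.refork Sdiff Smul)
      (.seq (.fork (.get [false]) (.seq (.get [true]) (.attack A Serr Smc Smul))) .extract))
      (fun j => (s j).enc (i j).inp)
      fun j => (unif (GG.order (i j).d)).bind fun b => (((i j).sim mc A).exec (A.time.eval (i j).κ)
        (((i j).sim mc A).rewind (s j) b)).bind fun s' =>
          PMF.pure (.nat ((i j).extract (s j).msg s'.msg)) := by
  refine Impl.seq (α := fun _ => ℕ) (D := fun j => unif (GG.order (i j).d))
    (φ := fun j b => .pair ((i j).info (s j).msg)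
      ((((i j).sim mc A).rewind (s j) b).enc (i j).inp))
    (Impl.refork hinp i hSdiff hSmul hs) fun hv => ?_
  exact Impl.secondAttack (J := Σ j, {b // b ∈ (unif (GG.order (i j).d)).support}) hSerr hSmc
    hSmul hlin hinp hP (fun x => i x.1) (s := fun x => s x.1) (b := fun x => x.2.1)
    (out := fun x => (s x.1).msg) hv (k := fun x => k x.1) (fun x => hinv x.1) fun x => by
      have h1 := (mem_support_unif _ _).1 x.2.2
      have h2 := (GG.prime_order _ _ (i x.1).hd).pos
      omega

end

include hSerr hSmc hSdiff hSmul hlin in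
theorem Impl.reduction (hsafe : ∀ i : Setup GG LS, i.Safe A) :
    Impl (Setup.κ (GG := GG) (LS := LS)) (Prog.reduction A Serr Smc Sdiff Smul) Setup.inp
      fun i => (i.found mc A).map .nat := by
  have hinp := Setup.sized_inp hsafe
  obtain ⟨P, hP⟩ := GG.enc_size
  have hn : PolyBdd (Setup.κ (GG := GG) (LS := LS)) fun i => A.time.eval i.κ := PolyBdd.self.eval _
  have hinv : ∀ i : Setup GG LS, i.Inv A True (A.time.eval i.κ) (i.entryBound A P)
      (A.time.eval i.κ + 1) (A.time.eval i.κ) i.start :=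
    fun i => Setup.Inv.init (hsafe i) le_rfl (Nat.le_succ _)
  have hattack := Impl.attack (mc := mc) hinp id hSerr hSmc hSmul hlin hP
    hn (Setup.polyBdd_entryBound hinp) (hn.add (.const 1)) hinv (fun _ => le_rfl) fun _ => le_rfl
  refine Impl.congr (D := fun i => ((i.sim mc A).exec (A.time.eval i.κ) i.start).bind fun s =>
    (unif (GG.order i.d)).bind fun b =>
      ((i.sim mc A).exec (A.time.eval i.κ) ((i.sim mc A).rewind s b)).bind fun s' =>
        PMF.pure (.nat (i.extract s.msg s'.msg))) ?_ (fun _ => rfl) fun i => by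
    simp only [Setup.found, PMF.map_bind, PMF.pure_map]
  refine Impl.straightSeq rfl hinp ?_
  refine Impl.seq (J := Setup GG LS) (α := fun _ => SimState)
    (D := fun i => (i.sim mc A).exec (A.time.eval i.κ) i.start) (φ := fun i s => s.enc i.inp)
    hattack fun hv => ?_
  -- The number of activations left at the end depends on the run; rewinding only needs that the
  -- invariant holds with some number.
  have hex : ∀ x : (Σ i : Setup GG LS,
      {s // s ∈ ((i.sim mc A).exec (A.time.eval i.κ) i.start).support}), ∃ k,
      x.1.Inv A True (A.time.eval x.1.κ) (x.1.entryBound A P) (A.time.eval x.1.κ + 1) k x.2.1 :=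
    fun x => (hinv x.1).exec hlin hP le_rfl le_rfl le_rfl x.2.2
  choose k hk using hex
  exact Impl.afterFirstAttack (J := Σ i : Setup GG LS,
      {s // s ∈ ((i.sim mc A).exec (A.time.eval i.κ) i.start).support}) hSerr hSmc hSdiff hSmul hlin
    hinp hP (fun x => x.1) (s := fun x => x.2.1) hv hk

end Reduction

/-! ### The two games as mixtures over the choices of the challenger -/

section Games

variable {F : ℕ → FuzzyKeySetting} (GG : GroupGen) (LS : LinearSketch F GG.orders)

/-- Joint distribution of the choices of the challenger. -/
noncomputable def setupDist (κ : ℕ) : PMF (Val × Val × (F κ).X) :=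
  (GG.desc κ).bind fun d => (LS.setup κ (GG.order d)).bind fun pp =>
    (F κ).dist.bind fun x => PMF.pure (d, pp, x)

/-- The proxy key for given choices of the challenger. -/
def setupKey (κ : ℕ) (t : Val × Val × (F κ).X) : ZMod (GG.order t.1) :=
  (LS.sketch κ (GG.order t.1) t.2.1 t.2.2).2

/-- The public information for given choices of the challenger. -/
def setupInput (κ : ℕ) (t : Val × Val × (F κ).X) : Val :=
  .pair (ones κ) (.pair (.pair (GG.triple t.1) t.2.1)
    (.pair (GG.enc t.1 (GG.gen t.1 ^ (setupKey GG LS κ t).val))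
      (LS.sketch κ (GG.order t.1) t.2.1 t.2.2).1))

/-- The part of the game before verification, for given choices of the challenger. -/
noncomputable def attackDist (A : Machine) (κ : ℕ) (t : Val × Val × (F κ).X) :
    PMF (Val × ℕ × ChallengerState (GG.order t.1)) :=
  interact (schnorrOracle GG LS κ t.1 t.2.1 t.2.2) A.prog (A.time.eval κ) (A.time.eval κ)
    (.pair (.nat 0) (setupInput GG LS κ t)) ⟨fun _ => none, [], 0⟩

/-- The verification in the game. -/
noncomputable def finishGame (κ : ℕ) (t : Val × Val × (F κ).X)
    (o : Val × ℕ × ChallengerState (GG.order t.1)) : PMF CMAOutcome :=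
  match o.1 with
  | .pair M σ =>
    ((schnorrFS GG LS).vrfy κ (t.1, t.2.1) (GG.gen t.1 ^ (setupKey GG LS κ t).val,
      (LS.sketch κ (GG.order t.1) t.2.1 t.2.2).1) M σ o.2.2.table).bind fun b =>
        PMF.pure ⟨b.1 && decide (M ∉ o.2.2.signed), o.2.1, o.2.2.signed.length, o.2.2.hashes⟩
  | _ => PMF.pure ⟨false, o.2.1, o.2.2.signed.length, o.2.2.hashes⟩

/-- Both games start with the same triple of choices. Once it is separated, the forking bound can be
proved for each triple and averaged afterwards. -/
theorem cmaGame_eq (A : Machine) (κ : ℕ) : (schnorrFS GG LS).cmaGame A κ =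
    (setupDist GG LS κ).bind fun t => (attackDist GG LS A κ t).bind (finishGame GG LS κ t) := by
  have h : ∀ t : Val × Val × (F κ).X, attackDist GG LS A κ t =
      interact ((schnorrFS GG LS).oracle κ (t.1, t.2.1) t.2.2) A.prog (A.time.eval κ)
        (A.time.eval κ) (.pair (.nat 0) (setupInput GG LS κ t)) ⟨fun _ => none, [], 0⟩ := fun t => by
    rw [attackDist, schnorrOracle_eq]
    rfl
  simp only [h, setupDist, PMF.bind_bind, PMF.pure_bind]
  refine (PMF.bind_bind (GG.desc κ) (fun d => (LS.setup κ (GG.order d)).bind fun pp =>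
    PMF.pure (d, pp)) _).trans (congrArg _ (funext fun d => ?_))
  refine (PMF.bind_bind (LS.setup κ (GG.order d)) (fun pp => PMF.pure (d, pp)) _).trans
    (congrArg _ (funext fun pp => (PMF.pure_bind _ _).trans ?_))
  exact congrArg _ (funext fun x => PMF.pure_bind _ _)

theorem dlSketchGame_eq (B : Machine) (κ : ℕ) : dlSketchGame GG LS B κ =
    (setupDist GG LS κ).bind fun t => (B.prog.exec (B.time.eval κ) (setupInput GG LS κ t)).bind
      fun o => PMF.pure (decide (o.1 = .nat (setupKey GG LS κ t).val), o.2) := by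
  simp only [dlSketchGame, setupDist, PMF.bind_bind, PMF.pure_bind]
  rfl

variable {GG LS}

theorem expect_finishGame {κ : ℕ} (t : Val × Val × (F κ).X)
    (o : Val × ℕ × ChallengerState (GG.order t.1)) :
    ((finishGame GG LS κ t o).expect fun o => if o.win = true then 1 else 0) =
      winProb GG LS t.2.1 t.2.2 o.1 o.2.2 := by
  obtain ⟨m | ⟨M, σ⟩, n, cs⟩ := o
  · simp [finishGame, winProb, PMF.expect_pure]
  · simp only [finishGame, winProb, PMF.expect_bind, PMF.expect_pure]
    rfl

theorem finishGame_counters {κ : ℕ} {t : Val × Val × (F κ).X}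
    {o : Val × ℕ × ChallengerState (GG.order t.1)} {u : CMAOutcome}
    (hu : u ∈ (finishGame GG LS κ t o).support) :
    u.steps = o.2.1 ∧ u.signs = o.2.2.signed.length ∧ u.hashes = o.2.2.hashes := by
  unfold finishGame at hu
  split at hu
  · simp only [PMF.mem_support_bind_iff, PMF.mem_support_pure_iff] at hu
    obtain ⟨b, -, rfl⟩ := hu
    exact ⟨rfl, rfl, rfl⟩
  · rw [PMF.mem_support_pure_iff] at hu
    subst hu
    exact ⟨rfl, rfl, rfl⟩

/-- Verification changes neither the steps nor the counters of the adversary, so bounds for the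
whole game hold for the attack phase. -/
theorem exists_outcome {A : Machine} {κ : ℕ} {t : Val × Val × (F κ).X}
    (ht : t ∈ (setupDist GG LS κ).support) {o : Val × ℕ × ChallengerState (GG.order t.1)}
    (ho : o ∈ (attackDist GG LS A κ t).support) :
    ∃ u ∈ ((schnorrFS GG LS).cmaGame A κ).support,
      u.steps = o.2.1 ∧ u.signs = o.2.2.signed.length ∧ u.hashes = o.2.2.hashes := by
  obtain ⟨u, hu⟩ := (finishGame GG LS κ t o).support_nonempty
  refine ⟨u, ?_, finishGame_counters hu⟩
  rw [cmaGame_eq]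
  simp only [PMF.mem_support_bind_iff]
  exact ⟨t, ht, o, ho, hu⟩

theorem mem_support_setupDist {κ : ℕ} {t : Val × Val × (F κ).X} :
    t ∈ (setupDist GG LS κ).support ↔ t.1 ∈ (GG.desc κ).support ∧
      t.2.1 ∈ (LS.setup κ (GG.order t.1)).support ∧ t.2.2 ∈ (F κ).dist.support := by
  simp only [setupDist, PMF.mem_support_bind_iff, PMF.mem_support_pure_iff]
  constructor
  · rintro ⟨d, hd, pp, hpp, x, hx, rfl⟩
    exact ⟨hd, hpp, hx⟩
  · rintro ⟨hd, hpp, hx⟩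
    exact ⟨_, hd, _, hpp, _, hx, rfl⟩

theorem Setup.mem (i : Setup GG LS) : (i.d, i.pp, i.x) ∈ (setupDist GG LS i.κ).support :=
  mem_support_setupDist.2 ⟨i.hd, i.hpp, i.hx⟩

/-- Every possible choice of the challenger. -/
def Setup.ofMem {κ : ℕ} {t : Val × Val × (F κ).X} (ht : t ∈ (setupDist GG LS κ).support) :
    Setup GG LS where
  κ := κ
  d := t.1
  pp := t.2.1
  x := t.2.2
  hd := (mem_support_setupDist.1 ht).1
  hpp := (mem_support_setupDist.1 ht).2.1
  hx := (mem_support_setupDist.1 ht).2.2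

theorem Setup.safe_of_ppt {A : Machine} (hA : (schnorrFS GG LS).CMAPPT A) (i : Setup GG LS) :
    i.Safe A := fun o ho => by
  obtain ⟨u, hu, h, -⟩ := exists_outcome (A := A) i.mem ho
  exact h ▸ hA i.κ u hu

theorem queryBound_of_ppt {A : Machine} (hA : (schnorrFS GG LS).CMAPPT A) (κ : ℕ) :
    (schnorrFS GG LS).QueryBound A κ (A.time.eval κ) (A.time.eval κ) := fun u hu => by
  have h1 := hA κ u hu
  rw [cmaGame_eq] at hu
  simp only [PMF.mem_support_bind_iff] at hu
  obtain ⟨t, -, o, ho, hu⟩ := hu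
  obtain ⟨h2, h3, h4⟩ := finishGame_counters hu
  obtain ⟨-, -, h5⟩ := interact_counters ho
  simp only [List.length_nil] at h5
  omega

theorem cmaAdv_eq (A : Machine) (κ : ℕ) : (schnorrFS GG LS).cmaAdv A κ =
    ((setupDist GG LS κ).expect fun t => (attackDist GG LS A κ t).expect fun o =>
      winProb GG LS t.2.1 t.2.2 o.1 o.2.2).toReal := by
  classical
  rw [FuzzySignature.cmaAdv, prob_eq_expect, cmaGame_eq]
  simp only [PMF.expect_bind, Set.mem_ofPred_eq]
  simp only [← expect_finishGame]

theorem dlSketchAdv_eq (B : Machine) (κ : ℕ) : dlSketchAdv GG LS B κ =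
    ((setupDist GG LS κ).expect fun t =>
      ((B.prog.exec (B.time.eval κ) (setupInput GG LS κ t)).map Prod.fst).expect fun v =>
        if v = .nat (setupKey GG LS κ t).val then 1 else 0).toReal := by
  classical
  rw [dlSketchAdv, prob_eq_expect, dlSketchGame_eq]
  simp only [PMF.expect_bind, PMF.expect_pure, PMF.expect_map, Set.mem_ofPred_eq, decide_eq_true_eq]

theorem expect_setupDist (κ : ℕ) (f : Val → ℝ≥0∞) :
    ((setupDist GG LS κ).expect fun t => f t.1) = (GG.desc κ).expect f := by
  simp only [setupDist, PMF.expect_bind, PMF.expect_pure, PMF.expect_const]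

variable {κ : ℕ}

/-- Adversaries against the discrete logarithm problem with sketch from implementations. -/
theorem Impl.exists_machine {P : Prog} {D : Setup GG LS → PMF ℕ}
    (h : Impl (Setup.κ (GG := GG) (LS := LS)) P Setup.inp fun i => (D i).map .nat) :
    ∃ B : Machine, DLSketchPPT GG LS B ∧ ∀ (f : ∀ κ, Val × Val × (F κ).X → ℝ≥0∞),
      (∀ κ t, ∀ ht : t ∈ (setupDist GG LS κ).support, f κ t =
        (D (.ofMem ht)).expect fun a => if a = (setupKey GG LS κ t).val then 1 else 0) →
      ∀ κ, dlSketchAdv GG LS B κ = ((setupDist GG LS κ).expect (f κ)).toReal := by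
  obtain ⟨q, hq⟩ := h
  refine ⟨⟨P, q⟩, fun κ o ho => ?_, fun f hf κ => ?_⟩
  · rw [dlSketchGame_eq] at ho
    simp only [PMF.mem_support_bind_iff, PMF.mem_support_pure_iff] at ho
    obtain ⟨t, ht, a, ha, rfl⟩ := ho
    exact (hq (.ofMem ht) _ le_rfl).1 a ha
  · rw [dlSketchAdv_eq]
    congr 1
    refine PMF.expect_congr fun t ht => ?_
    have h1 : (P.exec (q.eval κ) (setupInput GG LS κ t)).map Prod.fst =
        (D (.ofMem ht)).map .nat := (hq (.ofMem ht) _ le_rfl).2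
    rw [hf κ t ht]
    simp only [h1, PMF.expect_map, Val.nat.injEq]

/-- The adversary that guesses. -/
theorem exists_guess (hinp : PolySized (Setup.κ (GG := GG) (LS := LS)) Setup.inp) :
    ∃ B : Machine, DLSketchPPT GG LS B ∧ dlSketchAdv GG LS B = GG.invOrder := by
  obtain ⟨B, hB, h⟩ := (Impl.straightSeq (f := .inpOrder) rfl hinp
    (Impl.rand (Setup.sized_order hinp))).exists_machine
  refine ⟨B, hB, funext fun κ => ?_⟩
  rw [h (fun κ t => (GG.order t.1 : ℝ≥0∞)⁻¹) _ κ, expect_setupDist κ fun d => (GG.order d : ℝ≥0∞)⁻¹]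
  · rfl
  · intro κ t ht
    have hp := GroupGen.fact_prime (mem_support_setupDist.1 ht).1
    have hlt := (setupKey GG LS κ t).val_lt
    change _ = (unif (GG.order t.1)).expect _
    rw [PMF.expect_unif hp.out.pos, Finset.sum_ite_eq' , if_pos (Finset.mem_range.2 hlt), mul_one]

end Games

/-- Cauchy-Schwarz, obtained from Jensen's inequality for the uniform distribution on `n + 1` points
by clearing the factor `1 / (n + 1)`. -/
theorem ENNReal.sq_sum_range_le (n : ℕ) (x : ℕ → ℝ≥0∞) :
    (∑ j ∈ Finset.range (n + 1), x j) ^ 2 ≤ (n + 1) * ∑ j ∈ Finset.range (n + 1), x j ^ 2 := by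
  have h := (unif (n + 1)).sq_expect_le x
  rw [PMF.expect_unif n.succ_pos, PMF.expect_unif n.succ_pos] at h
  set c : ℝ≥0∞ := ((n + 1 : ℕ) : ℝ≥0∞) with hc
  have h0 : c ≠ 0 := by simp [hc]
  have h1 : c ≠ ∞ := ENNReal.natCast_ne_top _
  have h2 : c * c⁻¹ = 1 := ENNReal.mul_inv_cancel h0 h1
  calc _ = (c * c) * (c⁻¹ * ∑ j ∈ Finset.range (n + 1), x j) ^ 2 := by
        rw [mul_pow, ← mul_assoc, show c * c * c⁻¹ ^ 2 = (c * c⁻¹) * (c * c⁻¹) by ring, h2]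
        simp
    _ ≤ (c * c) * (c⁻¹ * ∑ j ∈ Finset.range (n + 1), x j ^ 2) := by gcongr
    _ = (c * c⁻¹) * (c * ∑ j ∈ Finset.range (n + 1), x j ^ 2) := by ring
    _ = _ := by rw [h2, one_mul, hc]; push_cast; rfl

/-! ### The final estimate -/

section Analysis

variable {F : ℕ → FuzzyKeySetting} {GG : GroupGen} {LS : LinearSketch F GG.orders}
  {mc : (κ p : ℕ) → (pp c : Val) → (F κ).X → Val × ZMod p} {A : Machine}

open Classical in
theorem Simulation.sum_acc_add_le_one (S : Simulation) (Q : ℕ) (s : SimState) :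
    ∑ j ∈ Finset.range Q, S.acc j s + (if lookup s.L (S.target s.msg) = [] then 1 else 0) ≤ 1 := by
  split_ifs with h
  · have h0 : ∑ j ∈ Finset.range Q, S.acc j s = 0 := Finset.sum_eq_zero fun j _ => if_neg <| by
      rintro ⟨-, e, L, h', -⟩
      rw [h] at h'
      cases h'
    rw [h0, zero_add]
  · rw [add_zero]
    exact S.sum_acc_le_one _ s

/-- The success probability of the reduction is at least the quadratic expression from the forking
lemma. -/
theorem Setup.sq_value_le (i : Setup GG LS) (Q : ℕ) :
    ((i.sim mc A).exec (A.time.eval i.κ) i.start).expect ((i.sim mc A).value Q) ^ 2 ≤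
      (Q + 1) * (((i.found mc A).expect fun a => if a = i.key.val then 1 else 0) +
        (GG.order i.d : ℝ≥0∞)⁻¹) := by
  classical
  have hprime := GroupGen.fact_prime i.hd
  have hpos : 0 < (i.sim mc A).p := hprime.out.pos
  set S := i.sim mc A with hS
  set D := S.exec (A.time.eval i.κ) i.start with hD
  set c : ℝ≥0∞ := (GG.order i.d : ℝ≥0∞)⁻¹ with hc
  have hc1 : c ≤ 1 := ENNReal.inv_le_one.2 (by exact_mod_cast hprime.out.one_le)
  set a : ℕ → ℝ≥0∞ := fun j => D.expect (S.acc j) with ha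
  set f : ℝ≥0∞ := D.expect fun s => if lookup s.L (S.target s.msg) = [] then 1 else 0 with hf
  -- A forgery at a recorded query and a forgery at a target without entry exclude each other.
  have hsum : ∑ j ∈ Finset.range Q, a j + f ≤ 1 := by
    rw [ha, ← PMF.expect_sum, hf, ← PMF.expect_add]
    exact PMF.expect_le_one fun s _ => S.sum_acc_add_le_one Q s
  have hfork := S.sum_sq_expect_le (good := fun s s' => i.extract s.msg s'.msg = i.key.val) hpos
    (fun s s' htgt hne h1 h2 => extractLog_eq i.hd i.key h1 h2 hne htgt) Q (.pair (.nat 0) i.inp)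
  have hfound : D.expect (S.rerun fun s s' => i.extract s.msg s'.msg = i.key.val) =
      (i.found mc A).expect fun a => if a = i.key.val then 1 else 0 := by
    simp only [Setup.found, PMF.expect_bind, PMF.expect_pure]
    refine PMF.expect_congr fun s _ => PMF.expect_congr fun b _ => PMF.expect_congr fun s' _ => ?_
    split_ifs <;> rfl
  have hvalue : D.expect (S.value Q) = ∑ j ∈ Finset.range Q, a j + c * f := by
    rw [ha, ← PMF.expect_sum, hf, ← PMF.expect_const_mul, ← PMF.expect_add]
    refine PMF.expect_congr fun s _ => ?_
    unfold Simulation.value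
    congr!
  rw [hvalue, ← hfound]
  -- The index `Q` is used for the extra term `f / p`; this gives `Q + 1` terms without an
  -- additional hash query for the verification.
  have h1 := ENNReal.sq_sum_range_le Q fun j => if j = Q then c * f else a j
  simp only [Finset.sum_range_succ, if_true] at h1
  have h2 : ∀ g : ℝ≥0∞ → ℝ≥0∞, ∑ j ∈ Finset.range Q, g (if j = Q then c * f else a j) =
      ∑ j ∈ Finset.range Q, g (a j) := fun g => Finset.sum_congr rfl fun j hj => by
    rw [if_neg (Finset.mem_range.1 hj).ne]
  rw [h2 fun x => x, h2 fun x => x ^ 2] at h1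
  refine h1.trans (mul_le_mul' le_rfl ?_)
  have hf1 : f ≤ 1 := le_add_self.trans hsum
  calc ∑ j ∈ Finset.range Q, a j ^ 2 + (c * f) ^ 2
      ≤ (D.expect (S.rerun fun s s' => i.extract s.msg s'.msg = i.key.val) +
          c * ∑ j ∈ Finset.range Q, a j) + c * f := by
        refine add_le_add hfork ?_
        -- A crude bound suffices: `f / p` is exactly what completes `(∑ a_j) / p` to at most `1 /
        -- p`.
        calc (c * f) ^ 2 = (c * f) * (c * f) := sq _
          _ ≤ (c * f) * (1 * 1) := by gcongr
          _ = c * f := by simp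
    _ = D.expect (S.rerun fun s s' => i.extract s.msg s'.msg = i.key.val) +
          c * (∑ j ∈ Finset.range Q, a j + f) := by ring
    _ ≤ _ := by
        gcongr
        exact mul_le_of_le_one_right zero_le hsum

/-- The success probability in the real attack. -/
theorem Setup.expect_attack_le (i : Setup GG LS)
    (hlin : ∀ κ, ∀ p ∈ GG.orders κ, ∀ pp ∈ (LS.setup κ p).support, ∀ x e : (F κ).X,
      LS.sketch κ p pp (x + e) = ((mc κ p pp (LS.sketch κ p pp x).1 e).1,
        (LS.sketch κ p pp x).2 + (mc κ p pp (LS.sketch κ p pp x).1 e).2))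
    {Q QH : ℕ} (hQ : (schnorrFS GG LS).QueryBound A i.κ Q QH) :
    ((attackDist GG LS A i.κ (i.d, i.pp, i.x)).expect fun o =>
        winProb GG LS i.pp i.x o.1 o.2.2) ≤
      ((i.sim mc A).exec (A.time.eval i.κ) i.start).expect ((i.sim mc A).value QH) +
        Q * (Q + QH) * (GG.order i.d : ℝ≥0∞)⁻¹ := by
  refine (expect_winProb_le (mc := mc) (Q := Q) (QH := QH) i.hd (hlin _ _ i.order_mem _ i.hpp i.x) Represents.empty
    fun u hu => ?_).trans ?_
  · obtain ⟨o, ho, -, h2, h3⟩ := exists_outcome (A := A) i.mem hu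
    rw [← h2, ← h3]
    exact hQ o ho
  · refine add_le_add le_rfl (le_of_eq ?_)
    simp only [List.length_nil, Nat.sub_zero]
    push_cast
    ring

/-- The passage from extended nonnegative reals to reals; `v` is the averaged value of the simulated
attack, `q` the advantage of the reduction and `r` the expectation of `1/p`. -/
theorem toReal_expect_le {p q r v : ℝ≥0∞} {Q QH : ℕ} (h1 : p ≤ v + Q * (Q + QH) * r)
    (h2 : v ^ 2 ≤ (QH + 1) * (q + r)) (hq : q ≤ 1) (hr : r ≤ 1) :
    p.toReal ≤ Real.sqrt ((QH + 1 : ℝ) * (q.toReal + r.toReal)) +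
      (Q : ℝ) * (Q + QH) * r.toReal := by
  have hq' : q ≠ ∞ := ne_top_of_le_ne_top ENNReal.one_ne_top hq
  have hr' : r ≠ ∞ := ne_top_of_le_ne_top ENNReal.one_ne_top hr
  have h3 : ((QH + 1 : ℝ≥0∞)) * (q + r) ≠ ∞ := ENNReal.mul_ne_top (by finiteness) (by finiteness)
  -- Finiteness of `v` comes from the bound on its square.
  have hv : v ≠ ∞ := fun h => by
    rw [h] at h2
    exact h3 (top_le_iff.1 (by simpa using h2))
  have h4 := ENNReal.toReal_mono h3 h2
  have h5 := ENNReal.toReal_mono (by finiteness) h1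
  rw [ENNReal.toReal_add hv (by finiteness)] at h5
  have hQH : ((QH : ℝ≥0∞) + 1).toReal = QH + 1 := by
    rw [ENNReal.toReal_add (by finiteness) (by finiteness)]; simp
  have hQQ : ((Q : ℝ≥0∞) + QH).toReal = Q + QH := by
    rw [ENNReal.toReal_add (by finiteness) (by finiteness)]; simp
  rw [ENNReal.toReal_mul, ENNReal.toReal_add hq' hr', hQH, ENNReal.toReal_pow] at h4
  rw [ENNReal.toReal_mul, ENNReal.toReal_mul, hQQ, ENNReal.toReal_natCast] at h5
  have := Real.le_sqrt_of_sq_le h4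
  linarith

theorem exists_reduction (hF : ErrSamplable F) (hLS : LS.Linearity)
    (hA : (schnorrFS GG LS).CMAPPT A) :
    ∃ B : Machine, DLSketchPPT GG LS B ∧
      ∀ κ Q QH : ℕ, (schnorrFS GG LS).QueryBound A κ Q QH →
        (schnorrFS GG LS).cmaAdv A κ ≤
          Real.sqrt ((QH + 1 : ℝ) * (dlSketchAdv GG LS B κ + GG.invOrder κ)) +
            (Q : ℝ) * (Q + QH) * GG.invOrder κ := by
  classical
  obtain ⟨mc, ⟨Smc, hSmc⟩, hlin⟩ := hLS
  obtain ⟨Serr, hSerr⟩ := hF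
  obtain ⟨Sdiff, hSdiff⟩ := LS.diffRec_polytime
  obtain ⟨Smul, hSmul⟩ := GG.mul_polytime
  obtain ⟨B, hB, hadv⟩ := (Impl.reduction hSerr hSmc hSdiff hSmul hlin
    fun i => i.safe_of_ppt hA).exists_machine
  refine ⟨B, hB, fun κ Q QH hQ => ?_⟩
  -- The output distribution of the reduction is defined only for choices in the support; elsewhere
  -- the value is irrelevant and set to `0`.
  set f : ∀ κ, Val × Val × (F κ).X → ℝ≥0∞ := fun κ t =>
    if ht : t ∈ (setupDist GG LS κ).support then
      ((Setup.ofMem ht).found mc A).expect fun a => if a = (setupKey GG LS κ t).val then 1 else 0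
    else 0
  have hf : ∀ t, ∀ ht : t ∈ (setupDist GG LS κ).support, f κ t =
      ((Setup.ofMem ht).found mc A).expect fun a =>
        if a = (setupKey GG LS κ t).val then 1 else 0 := fun t ht => dif_pos ht
  rw [hadv f (fun κ t ht => dif_pos ht) κ, cmaAdv_eq]
  set T := setupDist GG LS κ with hT
  have hinv : GG.invOrder κ = (T.expect fun t => (GG.order t.1 : ℝ≥0∞)⁻¹).toReal := by
    rw [hT, expect_setupDist κ fun d => (GG.order d : ℝ≥0∞)⁻¹]
    rfl
  rw [hinv]
  set V : Val × Val × (F κ).X → ℝ≥0∞ := fun t =>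
    ((schnorrSim GG LS mc A κ t.1 t.2.1 t.2.2).exec (A.time.eval κ)
      ⟨true, .pair (.nat 0) (setupInput GG LS κ t), []⟩).expect
        ((schnorrSim GG LS mc A κ t.1 t.2.1 t.2.2).value QH) with hV
  refine toReal_expect_le (v := T.expect V) ?_ ?_ ?_ ?_
  · rw [← PMF.expect_const_mul, ← PMF.expect_add]
    exact PMF.expect_mono fun t ht => (Setup.ofMem ht).expect_attack_le (mc := mc) hlin hQ
  -- The forking bound holds for each choice of the challenger. Jensen's inequality moves the square
  -- inside the average, and the right-hand side is linear in the averaged quantities.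
  · refine (T.sq_expect_le V).trans ?_
    rw [← PMF.expect_add, ← PMF.expect_const_mul]
    refine PMF.expect_mono fun t ht => ?_
    have h := (Setup.ofMem ht).sq_value_le (mc := mc) (A := A) QH
    rw [hf t ht]
    exact h
  · refine PMF.expect_le_one fun t ht => ?_
    rw [hf t ht]
    exact PMF.expect_le_one fun a _ => by split_ifs <;> simp
  · refine PMF.expect_le_one fun t ht => ENNReal.inv_le_one.2 ?_
    exact_mod_cast (GG.prime_order κ t.1 (mem_support_setupDist.1 ht).1).one_le

/-- `κ ^ k * √(f κ)` is the square root of `κ ^ (2 * k) * f κ`, so decay of order `2 * k` is used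
for order `k`. -/
theorem Negligible.sqrt {f : ℕ → ℝ} (hf : Negligible f) : Negligible fun κ => Real.sqrt (f κ) := by
  intro k
  have h := (hf (2 * k)).sqrt
  rw [Real.sqrt_zero] at h
  refine h.congr fun κ => ?_
  rw [Real.sqrt_mul (by positivity), pow_mul', Real.sqrt_sq (by positivity)]

theorem Negligible.eval_mul {f : ℕ → ℝ} (hf : Negligible f) (q : Polynomial ℕ) :
    Negligible fun κ => (q.eval κ : ℕ) * f κ := by
  have h := Asymptotics.SuperpolynomialDecay.polynomial_mul hf (q.map (Nat.castRingHom ℝ))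
  refine h.congr fun κ => ?_
  simp [Polynomial.eval_map, Polynomial.eval₂_at_natCast]

/-- The running time of the adversary bounds both query numbers, so the concrete bound has
polynomial factors. Negligibility of `1/p` is no separate hypothesis: it is the advantage of the
guessing adversary. -/
theorem eucma_of_dlSketchAssumption (hF : ErrSamplable F) (hLS : LS.Linearity)
    (hDL : DLSketchAssumption GG LS) : (schnorrFS GG LS).EUCMA := by
  intro A hA
  obtain ⟨B, hB, hle⟩ := exists_reduction hF hLS hA
  obtain ⟨B', hB', heq⟩ := exists_guess (Setup.sized_inp fun i => i.safe_of_ppt hA)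
  have h1 : Negligible (dlSketchAdv GG LS B) := hDL B hB
  have h2 : Negligible GG.invOrder := heq ▸ hDL B' hB'
  have h3 : Negligible fun κ => dlSketchAdv GG LS B κ + GG.invOrder κ := h1.add h2
  -- The polynomials are `QH + 1` and `Q (Q + QH)` with `Q = QH = A.time`.
  have h4 := ((h3.eval_mul (A.time + 1)).sqrt).add
    (h2.eval_mul (A.time * (A.time + A.time)))
  refine Asymptotics.SuperpolynomialDecay.trans_eventually_abs_le h4 (.of_forall fun κ => ?_)
  have h5 := hle κ _ _ (queryBound_of_ppt hA κ)
  have h6 : 0 ≤ (schnorrFS GG LS).cmaAdv A κ := ENNReal.toReal_nonneg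
  refine (abs_of_nonneg h6).trans_le ?_
  refine h5.trans ((le_of_eq ?_).trans (le_abs_self _))
  simp

end Analysis

theorem mainTheorem1 (F : ℕ → FuzzyKeySetting) (hF : ErrSamplable F) (GG : GroupGen)
    (LS : LinearSketch F GG.orders) (hLS : LS.Linearity) :
    (DLSketchAssumption GG LS → (schnorrFS GG LS).EUCMA) ∧
    ∀ A : Machine, (schnorrFS GG LS).CMAPPT A →
      ∃ B : Machine, DLSketchPPT GG LS B ∧
        ∀ κ Q QH : ℕ, (schnorrFS GG LS).QueryBound A κ Q QH →
          (schnorrFS GG LS).cmaAdv A κ ≤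
            Real.sqrt ((QH + 1 : ℝ) * (dlSketchAdv GG LS B κ + GG.invOrder κ)) +
              (Q : ℝ) * (Q + QH) * GG.invOrder κ :=
  ⟨eucma_of_dlSketchAssumption hF hLS, fun _ hA => exists_reduction hF hLS hA⟩
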